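/- Let $S$ be a complex (algebraic) K3 surface, i.e. an integral surface, smooth and proper over $\mathbb{C}$, with trivial canonical bundle and $H^1(S,\mathcal{O}_S)=0$. Let $\iota_S$ be a non symplectic involution of $S$, i.e. an automorphism of $S$ over $\mathbb{C}$ with $\iota_S^2=\mathrm{id}_S$ that does not act trivially on $H^0(S,\Omega^2_S)$. Let $\sigma$ be the automorphism $(p,q)\mapsto(q,p)$ of $S\times S$, so that $\sigma\circ(\iota_S\times\iota_S)$ is the involution $(p,q)\mapsto(\iota_S(q),\iota_S(p))$, and let $(S\times S)/(\sigma\circ(\iota_S\times\iota_S))$ be the quotient of $S\times S$ by this involution. Then the blow-up of $(S\times S)/(\sigma\circ(\iota_S\times\iota_S))$ along its singular locus (with the reduced scheme structure) is isomorphic over $\mathbb{C}$ to $S^{[2]}$, the Hilbert scheme of zero-dimensional closed subschemes of $S$ of length $2$. -/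

import Mathlib

open CategoryTheory CategoryTheory.Limits AlgebraicGeometry TopologicalSpace
open scoped KaehlerDifferential nonZeroDivisors

noncomputable section

namespace HilbSquare

/-! ## Algebraic 2-forms on a scheme over `ℂ` -/

/-- The ring `Γ(S, U)`, regarded as a `ℂ`-algebra through the structure morphism `s`. -/
def Sec {S : Scheme.{0}} (_s : S ⟶ Spec (.of ℂ)) (U : S.Opens) : Type := Γ(S, U)

instance {S : Scheme.{0}} (s : S ⟶ Spec (.of ℂ)) (U : S.Opens) : CommRing (Sec s U) :=
  inferInstanceAs (CommRing Γ(S, U))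

instance {S : Scheme.{0}} (s : S ⟶ Spec (.of ℂ)) (U : S.Opens) : Algebra ℂ (Sec s U) :=
  ((s.appLE ⊤ U le_top).hom.comp (Scheme.ΓSpecIso (.of ℂ)).inv.hom).toAlgebra

/-- The pullback of functions along a morphism `f` of schemes over `ℂ`, from an open `U` of the
target to an open `V` of the source that `f` maps into `U`. For `f = 𝟙 S` it is the restriction. -/
def secMap {S T : Scheme.{0}} {s : S ⟶ Spec (.of ℂ)} {t : T ⟶ Spec (.of ℂ)} (f : T ⟶ S)
    (hf : f ≫ s = t) (U : S.Opens) (V : T.Opens) (e : V ≤ f ⁻¹ᵁ U) : Sec s U →ₐ[ℂ] Sec t V where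
  __ := (f.appLE U V e).hom
  commutes' c := by
    subst hf
    have h : s.appLE ⊤ U le_top ≫ f.appLE U V e = (f ≫ s).appLE ⊤ V le_top :=
      Scheme.Hom.appLE_comp_appLE ..
    exact congrArg (fun g => g.hom ((Scheme.ΓSpecIso (.of ℂ)).inv.hom c)) h

/-- The module `⋀² Ω_{A/ℂ}` of algebraic 2-forms of a `ℂ`-algebra. -/
abbrev AlgTwoForms (A : Type) [CommRing A] [Algebra ℂ A] : Type := ⋀[A]^2 Ω[A⁄ℂ]

/-- The pullback of 2-forms along a homomorphism `f : A → B` of `ℂ`-algebras,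
`a • (da₁ ∧ da₂) ↦ f a • (d(f a₁) ∧ d(f a₂))`. -/
def formMap {A B : Type} [CommRing A] [CommRing B] [Algebra ℂ A] [Algebra ℂ B] (f : A →ₐ[ℂ] B) :
    AlgTwoForms A →+ AlgTwoForms B :=
  letI : Algebra A B := f.toRingHom.toAlgebra
  haveI : IsScalarTower ℂ A B := IsScalarTower.of_algebraMap_eq fun c => (f.commutes c).symm
  let w : Ω[B⁄ℂ] [⋀^Fin 2]→ₗ[A] AlgTwoForms B :=
    { (exteriorPower.ιMulti B 2 (M := Ω[B⁄ℂ])).toMultilinearMap.restrictScalars A with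
      map_eq_zero_of_eq' := (exteriorPower.ιMulti B 2 (M := Ω[B⁄ℂ])).map_eq_zero_of_eq' }
  (exteriorPower.alternatingMapLinearEquiv
    (w.compLinearMap (KaehlerDifferential.map ℂ ℂ A B))).toAddMonoidHom

/-- A global section of the sheaf `⋀² Ω_{S/ℂ}`: a family of 2-forms on the affine opens of `S`
that is compatible with restriction. -/
structure TwoForm {S : Scheme.{0}} (s : S ⟶ Spec (.of ℂ)) where
  form : ∀ U : S.affineOpens, AlgTwoForms (Sec s U.1)
  compatible : ∀ (U V : S.affineOpens) (e : V.1 ≤ (𝟙 S) ⁻¹ᵁ U.1),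
    formMap (secMap (𝟙 S) (Category.id_comp s) U.1 V.1 e) (form U) = form V

/-- The form generates the sheaf `⋀² Ω_{S/ℂ}`. -/
def TwoForm.IsGenerator {S : Scheme.{0}} {s : S ⟶ Spec (.of ℂ)} (ω : TwoForm s) : Prop :=
  ∀ U : S.affineOpens, Submodule.span (Sec s U.1) {ω.form U} = ⊤

/-- `f^* ω = ω` for an endomorphism `f` of `S` over `ℂ`. -/
def TwoForm.IsPreservedBy {S : Scheme.{0}} {s : S ⟶ Spec (.of ℂ)} (ω : TwoForm s) (f : S ⟶ S)
    (hf : f ≫ s = s) : Prop :=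
  ∀ (U V : S.affineOpens) (e : V.1 ≤ f ⁻¹ᵁ U.1),
    formMap (secMap f hf U.1 V.1 e) (ω.form U) = ω.form V

/-! ## K3 surfaces and their involutions -/

/-- The structure sheaf of `S` as a sheaf of abelian groups. -/
def structureSheafAb (S : Scheme.{0}) :
    Sheaf (Opens.grothendieckTopology S) AddCommGrpCat.{0} :=
  (sheafCompose _ (forget₂ CommRingCat.{0} RingCat.{0} ⋙ forget₂ RingCat.{0} AddCommGrpCat.{0})).obj
    S.sheaf

/-- A (complex algebraic) K3 surface: an integral surface, proper and smooth over `ℂ`, with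
trivial canonical bundle `⋀² Ω` and with `H¹(S, 𝒪_S) = 0`. -/
structure IsK3Surface {S : Scheme.{0}} (s : S ⟶ Spec (.of ℂ)) : Prop where
  isIntegral : IsIntegral S
  isProper : IsProper s
  smooth : SmoothOfRelativeDimension 2 s
  canonical_trivial : ∃ ω : TwoForm s, ω.IsGenerator
  h1_eq_zero : Subsingleton ((structureSheafAb S).H 1)

/-- A non symplectic involution: an involution of `S` over `ℂ` that does not preserve the
2-forms of `S`. -/
structure IsNonSymplecticInvolution {S : Scheme.{0}} (s : S ⟶ Spec (.of ℂ)) (ι : S ⟶ S) :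
    Prop where
  comp_eq : ι ≫ s = s
  involutive : ι ≫ ι = 𝟙 S
  not_symplectic : ¬ ∀ ω : TwoForm s, ω.IsPreservedBy ι comp_eq

/-- The switch `σ : (p, q) ↦ (q, p)` of `S × S`. -/
def switch {S : Scheme.{0}} (s : S ⟶ Spec (.of ℂ)) : pullback s s ⟶ pullback s s :=
  pullback.lift (pullback.snd s s) (pullback.fst s s) pullback.condition.symm

/-- The endomorphism `f × f : (p, q) ↦ (f p, f q)` of `S × S`. -/
def square {S : Scheme.{0}} (s : S ⟶ Spec (.of ℂ)) (f : S ⟶ S) (hf : f ≫ s = s) :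
    pullback s s ⟶ pullback s s :=
  pullback.lift (pullback.fst s s ≫ f) (pullback.snd s s ≫ f) (by
    rw [Category.assoc, Category.assoc, hf, pullback.condition])

/-! ## Quotients, singular loci, blow-ups -/

/-- `q : X ⟶ Q` is the quotient of the scheme `X` by (the group generated by) the involution `τ`:
`q` is affine and invariant, its fibres are the orbits, `Q` has the quotient topology, and the
functions on an open `U` of `Q` are the invariant functions on `q⁻¹ U`. -/
structure IsInvolutionQuotient {X Q : Scheme.{0}} (τ : X ⟶ X) (q : X ⟶ Q) : Prop where
  involutive : τ ≫ τ = 𝟙 X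
  isAffineHom : IsAffineHom q
  invariant : τ ≫ q = q
  orbits : ∀ x y : X, q x = q y ↔ y = x ∨ y = τ x
  isQuotientMap : Topology.IsQuotientMap q
  app_injective : ∀ U : Q.Opens, Function.Injective (q.app U).hom
  range_app : ∀ (U : Q.Opens) (e : q ⁻¹ᵁ U ≤ τ ⁻¹ᵁ (q ⁻¹ᵁ U)) (a : Γ(X, q ⁻¹ᵁ U)),
    (∃ c, (q.app U).hom c = a) ↔ (τ.appLE (q ⁻¹ᵁ U) (q ⁻¹ᵁ U) e).hom a = a

/-- The ideal sheaf of the singular locus of a scheme `Q` of finite type over `ℂ`, i.e. of the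
closed set of points at which `Q` is not smooth over `ℂ`, with its reduced structure. -/
def singularIdeal {Q : Scheme.{0}} (r : Q ⟶ Spec (.of ℂ)) : Q.IdealSheafData :=
  Scheme.IdealSheafData.vanishingIdeal
    (Closeds.closure {x : Q | ¬ (r.stalkMap x).hom.FormallySmooth})

/-- The ideal sheaf is invertible, i.e. locally generated by one nonzerodivisor. -/
def IsInvertibleIdeal {X : Scheme.{0}} (I : X.IdealSheafData) : Prop :=
  ∀ x : X, ∃ U : X.affineOpens, x ∈ U.1 ∧ ∃ f ∈ Γ(X, U.1)⁰, I.ideal U = Ideal.span {f}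

/-- `b : B ⟶ X` is the blow-up of `X` along the closed subscheme with ideal sheaf `I`: the
inverse image ideal of `I` on `B` is invertible, and `b` is universal for that. -/
structure IsBlowUp {X B : Scheme.{0}} (b : B ⟶ X) (I : X.IdealSheafData) : Prop where
  invertible : IsInvertibleIdeal (I.comap b)
  universal : ∀ {T : Scheme.{0}} (f : T ⟶ X), IsInvertibleIdeal (I.comap f) →
    ∃! g : T ⟶ B, g ≫ b = f

/-! ## Hilbert schemes of points -/

/-- The closed subscheme `W` of `S × T` with ideal sheaf `I` is a flat family, over `T`, of
zero-dimensional subschemes of `S` of length `n`: `W` is finite, flat and of finite presentation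
over `T`, of rank `n`. -/
structure IsPointFamily (n : ℕ) {S T : Scheme.{0}} (s : S ⟶ Spec (.of ℂ)) (t : T ⟶ Spec (.of ℂ))
    (I : (pullback s t).IdealSheafData) : Prop where
  isFinite : IsFinite (I.subschemeι ≫ pullback.snd s t)
  flat : Flat (I.subschemeι ≫ pullback.snd s t)
  finitePresentation : LocallyOfFinitePresentation (I.subschemeι ≫ pullback.snd s t)
  rank_eq : ∀ x : T, (I.subschemeι ≫ pullback.snd s t).finrank x = n

/-- `id × f : S × T ⟶ S × H` for a morphism `f : T ⟶ H` over `ℂ`. -/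
def idProd {S T H : Scheme.{0}} (s : S ⟶ Spec (.of ℂ)) {t : T ⟶ Spec (.of ℂ)}
    {h : H ⟶ Spec (.of ℂ)} (f : T ⟶ H) (hf : f ≫ h = t) : pullback s t ⟶ pullback s h :=
  pullback.lift (pullback.fst s t) (pullback.snd s t ≫ f) (by
    rw [Category.assoc, hf, pullback.condition])

/-- `H` is the Hilbert scheme `S^{[n]}` of `n` points of `S`, with universal family the closed
subscheme of `S × H` with ideal sheaf `Z`: every flat family of length `n` zero-dimensional
subschemes of `S` over a `ℂ`-scheme `T` is the pullback of `Z` under exactly one `T ⟶ H`. -/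
structure IsHilbertScheme (n : ℕ) {S H : Scheme.{0}} (s : S ⟶ Spec (.of ℂ))
    (h : H ⟶ Spec (.of ℂ)) (Z : (pullback s h).IdealSheafData) : Prop where
  family : IsPointFamily n s h Z
  universal : ∀ {T : Scheme.{0}} (t : T ⟶ Spec (.of ℂ)) (I : (pullback s t).IdealSheafData),
    IsPointFamily n s t I → ∃! f : T ⟶ H, ∃ hf : f ≫ h = t, Z.comap (idProd s f hf) = I

end HilbSquare

end

/-!
The Hilbert scheme `H` of pairs of points of the surface `S` carries a Hilbert-Chow morphism
`c : H ⟶ Q` to the quotient `Q` of the square by the involution. The proof shows that `c` is the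
blow-up of the singular locus of `Q`; since blow-ups are characterised by a universal property
(`IsBlowUp.exists_iso`), this identifies `H` with any other blow-up of it.

With respect to the projections `pr₁` and `pr₂ ≫ ι` of `S × S`, the involution
`(p, q) ↦ (ι q, ι p)` is the interchange of the two factors (`SwapSquare.ofInvolution`), so `Q` is a
symmetric square. As `2` is invertible, both sides can be described by rings with an involution, in
terms of even and odd elements. A flat family of length two over `B` is locally a double cover
`Spec B[√f]` of the base (`exists_classify`), where the discriminant `f` is unique up to the square
of a unit. The pair formed by the projection of the cover to `S` and its conjugate is an
equivariant morphism from the cover to the square, and on the invariants it gives the Hilbert-Chow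
morphism `Spec B ⟶ Q` of the family.

*The centre.* The ideal of the singular locus of `Q` is generated by the products of two odd
functions on the square (`singularIdeal_ideal`). Where the square of an odd function is invertible,
smoothness descends from the square to `Q` (`formallySmooth_invariants`). At the image of the
diagonal, the relation `u² v² = (uv)²` between odd functions obstructs smoothness
(`not_formallySmooth_stalkMap`). The inverse image of this ideal on the base of a family is
generated by the discriminant `f`, because the cover is embedded in `S × Spec B`, so that the
imaginary parts of the images of the odd functions generate the unit ideal
(`HC.comap_singularIdeal`).

*The universal property.* Conversely, let `Spec B ⟶ Q` be a morphism under which the inverse image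
of the ideal of the singular locus is generated by a nonzerodivisor. Locally this is the image of
`u²` for an odd function `u`, and the morphism extends to an equivariant homomorphism to `B[√f]`
with `u ↦ √f`, because the image of `w u` can be divided by `f` for every odd function `w`
(`exists_equivariant_hom`). So the morphism is locally the Hilbert-Chow morphism of a family
(`exists_hc_of_comap`), and this family is unique up to isomorphism (`HC.exists_classify_imp`).

*Invertibility.* The inverse image of the singular locus on `H` is a Cartier divisor if the
discriminants of the universal family are nonzerodivisors. In local coordinates, the odd
differences `u = x₀ ⊗ 1 - 1 ⊗ x₀` and `v = x₁ ⊗ 1 - 1 ⊗ x₁` form a regular sequence that cuts out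
the diagonal, and the chart `R[v / u]` of the blow-up of the diagonal is a double cover of its
invariants `D`, whose discriminant `u²` is a nonzerodivisor (`exists_double`). Near its branch
locus, every family on which `x₀` has an invertible imaginary part is pulled back from this one
(`Coordinates.exists_universal_double`). So near a point of the branch locus `H` is locally a
retract of `Spec D`, and its discriminant is a nonzerodivisor
(`Classify.exists_mem_nonZeroDivisors`).

These facts together give `isBlowUp_hilbertChow`; that the isomorphism is one over `ℂ` is
`hilbertChow_comp`.
-/

noncomputable section

namespace HilbSquare

/-! ### The double cover `B[√f]` of a ring -/

/-- The algebra `B[√f]`, free over `B` with basis `1, √f`. -/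
abbrev Dbl (B : Type*) [CommRing B] (f : B) : Type _ := QuadraticAlgebra B f 0

namespace Dbl

variable {B C D : Type*} [CommRing B] [CommRing C] [CommRing D]

/-- The square root of `f` in `B[√f]`. -/
abbrev root (f : B) : Dbl B f := ⟨0, 1⟩

lemma root_mul_root (f : B) : root f * root f = algebraMap B (Dbl B f) f := by
  ext <;> simp

lemma eq_add (f : B) (x : Dbl B f) :
    x = algebraMap B (Dbl B f) x.re + algebraMap B (Dbl B f) x.im * root f := by
  ext <;> simp

/-- The homomorphism `B[√f] → C` that extends `g : B → C` and sends `√f` to a square root `e` of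
`g f`. -/
def eval {f : B} (g : B →+* C) (e : C) (he : e * e = g f) : Dbl B f →+* C where
  toFun x := g x.re + g x.im * e
  map_one' := by simp [QuadraticAlgebra.re_one, QuadraticAlgebra.im_one]
  map_zero' := by simp
  map_add' x y := by simp; ring
  map_mul' x y := by
    simp only [QuadraticAlgebra.re_mul, QuadraticAlgebra.im_mul, map_add, map_mul, zero_mul,
      add_zero]
    linear_combination (- g x.im * g y.im) * he

lemma eval_apply {f : B} (g : B →+* C) (e : C) (he : e * e = g f) (x : Dbl B f) :
    eval g e he x = g x.re + g x.im * e := rfl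

@[simp]
lemma eval_algebraMap {f : B} (g : B →+* C) (e : C) (he : e * e = g f) (b : B) :
    eval g e he (algebraMap B (Dbl B f) b) = g b := by
  simp [eval_apply]

@[simp]
lemma eval_root {f : B} (g : B →+* C) (e : C) (he : e * e = g f) :
    eval g e he (root f) = e := by
  simp [eval_apply]

lemma hom_ext {f : B} {g₁ g₂ : Dbl B f →+* C}
    (h : g₁.comp (algebraMap B _) = g₂.comp (algebraMap B _))
    (h' : g₁ (root f) = g₂ (root f)) : g₁ = g₂ := by
  ext x
  have h (b) := congr($h b)
  simp only [RingHom.comp_apply] at h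
  rw [eq_add f x, map_add, map_mul, map_add, map_mul, h, h, h']

/-- The conjugation `√f ↦ -√f`. -/
def conj (f : B) : Dbl B f →+* Dbl B f :=
  eval (algebraMap B _) (-root f) (by rw [neg_mul_neg, root_mul_root])

@[simp] lemma re_conj (f : B) (x : Dbl B f) : (conj f x).re = x.re := by simp [conj, eval_apply]
@[simp] lemma im_conj (f : B) (x : Dbl B f) : (conj f x).im = -x.im := by simp [conj, eval_apply]

@[simp] lemma conj_conj (f : B) (x : Dbl B f) : conj f (conj f x) = x := by ext <;> simp

lemma conj_comp_algebraMap (f : B) : (conj f).comp (algebraMap B _) = algebraMap B _ := by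
  ext b <;> simp

/-- The base change `B[√f] → C[√(χ f)]`, rescaled so that `√f ↦ d √f'` where `χ f = d² f'`. -/
def map {f : B} (χ : B →+* C) (d f' : C) (h : χ f = d * d * f') : Dbl B f →+* Dbl C f' :=
  eval ((algebraMap C _).comp χ) (algebraMap C _ d * root f') (by
    rw [RingHom.comp_apply, h, map_mul, map_mul, ← root_mul_root]; ring)

@[simp] lemma re_map {f : B} (χ : B →+* C) (d f' : C) (h : χ f = d * d * f') (x : Dbl B f) :
    (map χ d f' h x).re = χ x.re := by simp [map, eval_apply]
@[simp] lemma im_map {f : B} (χ : B →+* C) (d f' : C) (h : χ f = d * d * f') (x : Dbl B f) :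
    (map χ d f' h x).im = χ x.im * d := by simp [map, eval_apply]

lemma map_comp_algebraMap {f : B} (χ : B →+* C) (d f' : C) (h : χ f = d * d * f') :
    (map χ d f' h).comp (algebraMap B _) = (algebraMap C _).comp χ := by
  ext b <;> simp

lemma map_comp_conj {f : B} (χ : B →+* C) (d f' : C) (h : χ f = d * d * f') :
    (map χ d f' h).comp (conj f) = (conj f').comp (map χ d f' h) := by
  ext b <;> simp

/-- A homomorphism of double covers over the base that is bijective commutes with the
conjugations. -/
lemma comp_conj_of_bijective {f f' : B} (h2 : IsUnit (2 : B)) (e : Dbl B f →+* Dbl B f')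
    (he : e.comp (algebraMap B _) = algebraMap B _) (hb : Function.Bijective e) :
    e.comp (conj f) = (conj f').comp e := by
  have he' (b) : e (algebraMap B _ b) = algebraMap B _ b := congr($he b)
  have key : ∀ x, e x = algebraMap B _ x.re + algebraMap B _ x.im * e (root f) := fun x => by
    conv_lhs => rw [eq_add f x, map_add, map_mul, he', he']
  obtain ⟨y, hy⟩ := hb.2 (root f')
  have h1 : y.im * (e (root f)).im = 1 := by
    have := congr(($(key y)).im); simp [hy] at this; exact this.symm
  have h3 : (e (root f)).re = 0 := by
    have := congr((e $(root_mul_root f)).im)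
    rw [he', map_mul] at this
    simp only [QuadraticAlgebra.im_mul, zero_mul, add_zero, QuadraticAlgebra.algebraMap_im] at this
    have h4 : 2 * (e (root f)).re = 0 := by linear_combination y.im * this - 2 * (e (root f)).re * h1
    exact (h2.mul_right_eq_zero).1 h4
  ext x <;> simp only [RingHom.comp_apply, re_conj, im_conj]
  · rw [key, key x]; simp [h3]
  · rw [key, key x]; simp

end Dbl

/-! ### Even and odd elements of a ring with an involution -/

section Parity

variable {R₀ R B : Type*} [CommRing R₀] [CommRing R] [CommRing B]

/-- `i : R₀ → R` identifies `R₀` with the invariants of the involution `τ` of `R`, and `2` is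
invertible. -/
structure IsInvolutionRing (i : R₀ →+* R) (τ : R →+* R) : Prop where
  two : IsUnit (2 : R₀)
  invol : ∀ r, τ (τ r) = r
  inj : Function.Injective i
  range : ∀ r, (∃ c, i c = r) ↔ τ r = r

/-- The ideal of the invariants that is generated by the products of two elements of `G`. -/
def productIdeal (i : R₀ →+* R) (G : Set R) : Ideal R₀ :=
  Ideal.span {c | ∃ u ∈ G, ∃ v ∈ G, i c = u * v}

/-- The odd elements of a ring with an involution. -/
def oddSet (τ : R →+* R) : Set R := {r | τ r = -r}

namespace IsInvolutionRing

variable {i : R₀ →+* R} {τ : R →+* R} (h : IsInvolutionRing i τ)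
include h

lemma map_i (c : R₀) : τ (i c) = i c := (h.range _).1 ⟨c, rfl⟩

lemma exists_half : ∃ c : R₀, 2 * c = 1 := h.two.exists_right_inv

/-- Every element is the sum of an even and an odd one. -/
lemma exists_even_odd (r : R) : ∃ c : R₀, ∃ u ∈ oddSet τ, r = i c + u := by
  obtain ⟨a, ha⟩ := h.exists_half
  obtain ⟨c, hc⟩ := (h.range (i a * (r + τ r))).2 (by
    rw [map_mul, map_add, h.map_i, h.invol, add_comm])
  have ha' : 2 * i a = 1 := by rw [← map_ofNat i 2, ← map_mul, ha, map_one]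
  refine ⟨c, i a * (r - τ r), ?_, ?_⟩
  · simp only [oddSet, Set.mem_ofPred_eq, map_mul, map_sub, h.map_i, h.invol]; ring
  · rw [hc]; linear_combination -r * ha'

lemma exists_mul {u v : R} (hu : u ∈ oddSet τ) (hv : v ∈ oddSet τ) : ∃ c, i c = u * v := by
  rw [h.range, map_mul, hu, hv, neg_mul_neg]

lemma eq_zero_of_odd {c : R₀} (hc : i c ∈ oddSet τ) : c = 0 := by
  have : i c = - i c := (h.map_i c).symm.trans hc
  have h2 : i (2 * c) = 0 := by rw [two_mul, map_add]; linear_combination this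
  have := h.inj (h2.trans (map_zero i).symm)
  exact h.two.mul_right_eq_zero.1 this

lemma closure_subset_oddSet {G : Set R} (hG : G ⊆ oddSet τ) {m : R}
    (hm : m ∈ AddSubmonoid.closure {x | ∃ b : R₀, ∃ g ∈ G, x = i b * g}) : m ∈ oddSet τ := by
  induction hm using AddSubmonoid.closure_induction with
  | mem x hx =>
    obtain ⟨b, g, hg, rfl⟩ := hx
    have := hG hg
    simp only [oddSet, Set.mem_ofPred_eq, map_mul, h.map_i] at this ⊢
    rw [this, mul_neg]
  | zero => simp [oddSet]
  | add x y _ _ hx hy =>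
    simp only [oddSet, Set.mem_ofPred_eq, map_add] at hx hy ⊢
    rw [hx, hy]; ring

/-- An element of the ideal generated by a set `G` of odd elements is the sum of an even
combination of products of an odd element and an element of `G`, and of a combination of `G` with
even coefficients. -/
lemma exists_decomposition {G : Set R} (hG : G ⊆ oddSet τ) {r : R} (hr : r ∈ Ideal.span G) :
    ∃ e ∈ Ideal.span {c | ∃ u ∈ oddSet τ, ∃ g ∈ G, i c = u * g},
    ∃ m ∈ AddSubmonoid.closure {x | ∃ b : R₀, ∃ g ∈ G, x = i b * g}, r = i e + m := by
  induction hr using Submodule.closure_induction with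
  | zero => exact ⟨0, zero_mem _, 0, zero_mem _, by simp⟩
  | add x y _ _ hx hy =>
    obtain ⟨e, he, m, hm, rfl⟩ := hx
    obtain ⟨e', he', m', hm', rfl⟩ := hy
    exact ⟨e + e', add_mem he he', m + m', add_mem hm hm', by rw [map_add]; ring⟩
  | smul_mem s g hg =>
    obtain ⟨c, u, hu, rfl⟩ := h.exists_even_odd s
    obtain ⟨e, he⟩ := h.exists_mul hu (hG hg)
    refine ⟨e, Ideal.subset_span ⟨u, hu, g, hg, he⟩, i c * g,
      AddSubmonoid.subset_closure ⟨c, g, hg, rfl⟩, ?_⟩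
    rw [he, smul_eq_mul]; ring

lemma mul_mem_productIdeal {G : Set R} (hG : G ⊆ oddSet τ) {m g : R} (hg : g ∈ G)
    (hm : m ∈ AddSubmonoid.closure {x | ∃ b : R₀, ∃ g ∈ G, x = i b * g}) :
    ∃ c ∈ productIdeal i G, i c = m * g := by
  induction hm using AddSubmonoid.closure_induction with
  | mem x hx =>
    obtain ⟨b, g', hg', rfl⟩ := hx
    obtain ⟨c, hc⟩ := h.exists_mul (hG hg') (hG hg)
    exact ⟨b * c, Ideal.mul_mem_left _ _ (Ideal.subset_span ⟨g', hg', g, hg, hc⟩), by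
      rw [map_mul, hc, mul_assoc]⟩
  | zero => exact ⟨0, zero_mem _, by simp⟩
  | add x y _ _ hx hy =>
    obtain ⟨c, hc, hx⟩ := hx
    obtain ⟨c', hc', hy⟩ := hy
    exact ⟨c + c', add_mem hc hc', by rw [map_add, hx, hy, add_mul]⟩

/-- If the odd elements are in the ideal generated by a set `G` of odd elements, then the
invariants in that ideal are the combinations of the products of two elements of `G`. -/
lemma productIdeal_eq_comap {G : Set R} (hG : G ⊆ oddSet τ) (hG' : oddSet τ ⊆ Ideal.span G) :
    productIdeal i G = (Ideal.span G).comap i := by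
  apply le_antisymm
  · rw [productIdeal, Ideal.span_le]
    rintro c ⟨u, hu, v, hv, hc⟩
    simp only [Ideal.coe_comap, Set.mem_preimage, SetLike.mem_coe, hc]
    exact Ideal.mul_mem_left _ _ (Ideal.subset_span hv)
  · intro c hc
    obtain ⟨e, he, m, hm, hem⟩ := h.exists_decomposition hG (Ideal.mem_comap.1 hc)
    have hm' := h.closure_subset_oddSet hG hm
    have : m = i (c - e) := by rw [map_sub, hem]; ring
    have hce : c = e := sub_eq_zero.1 (h.eq_zero_of_odd (this ▸ hm'))
    rw [hce]
    refine (Ideal.span_le.2 ?_ : Ideal.span _ ≤ productIdeal i G) he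
    rintro c ⟨u, hu, g, hg, hcug⟩
    obtain ⟨e, -, m, hm, hem⟩ := h.exists_decomposition hG (hG' hu)
    have hm' := h.closure_subset_oddSet hG hm
    have hu' : u ∈ oddSet τ := hu
    have : e = 0 := h.eq_zero_of_odd (by
      have : i e = u - m := by rw [hem]; ring
      simp only [oddSet, Set.mem_ofPred_eq] at hm' hu' ⊢
      rw [this, map_sub, hm', hu']; ring)
    rw [this, map_zero, zero_add] at hem
    obtain ⟨c', hc', h'⟩ := h.mul_mem_productIdeal hG hg hm
    rwa [h.inj (hcug.trans (hem ▸ h'.symm))]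

/-- The ideal of products can be computed with any set of odd elements that generates the same ideal
as all odd elements. -/
lemma productIdeal_eq {G : Set R} (hG : G ⊆ oddSet τ) (hG' : oddSet τ ⊆ Ideal.span G) :
    productIdeal i G = productIdeal i (oddSet τ) := by
  rw [h.productIdeal_eq_comap hG hG', h.productIdeal_eq_comap subset_rfl Ideal.subset_span]
  congr 1
  exact le_antisymm (Ideal.span_mono hG) (Ideal.span_le.2 hG')

end IsInvolutionRing

/-! ### Equivariant homomorphisms to a double cover -/

variable {i : R₀ →+* R} {τ : R →+* R} {f : B}

/-- The homomorphism on invariants that is induced by an equivariant homomorphism to a double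
cover. -/
def evenHom (h : IsInvolutionRing i τ) (h2 : IsUnit (2 : B)) (ρ : R →+* Dbl B f)
    (hρ : ρ.comp τ = (Dbl.conj f).comp ρ) : R₀ →+* B :=
  have him (c : R₀) : (ρ (i c)).im = 0 := by
    have := congr(($hρ (i c)).im)
    simp only [RingHom.comp_apply, h.map_i, Dbl.im_conj] at this
    exact h2.mul_right_eq_zero.1 (by linear_combination this)
  { toFun c := (ρ (i c)).re
    map_one' := by simp [QuadraticAlgebra.re_one]
    map_zero' := by simp
    map_add' x y := by simp
    map_mul' x y := by simp [him] }

section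

variable (h : IsInvolutionRing i τ) (h2 : IsUnit (2 : B)) {ρ : R →+* Dbl B f}
    (hρ : ρ.comp τ = (Dbl.conj f).comp ρ)
include h h2 hρ

lemma comp_eq_evenHom : ρ.comp i = (algebraMap B _).comp (evenHom h h2 ρ hρ) := by
  ext c
  · rfl
  · have := congr(($hρ (i c)).im)
    simp only [RingHom.comp_apply, h.map_i, Dbl.im_conj] at this
    exact h2.mul_right_eq_zero.1 (by simp; linear_combination this)

omit h in
lemma re_eq_zero_of_odd {u : R} (hu : u ∈ oddSet τ) : (ρ u).re = 0 := by
  have h1 := congr(($hρ u).re)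
  have hu : τ u = - u := hu
  simp only [RingHom.comp_apply, hu, map_neg, QuadraticAlgebra.re_neg, Dbl.re_conj] at h1
  exact h2.mul_right_eq_zero.1 (by linear_combination -h1)

lemma evenHom_eq_mul {u v : R} (hu : u ∈ oddSet τ) {c : R₀}
    (hc : i c = u * v) : evenHom h h2 ρ hρ c = (ρ u).im * (ρ v).im * f := by
  change (ρ (i c)).re = _
  rw [hc, map_mul, QuadraticAlgebra.re_mul, re_eq_zero_of_odd h2 hρ hu]; ring

/-- If the imaginary parts of the odd elements generate the unit ideal, the products of odd
elements generate the discriminant ideal. -/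
lemma map_productIdeal_eq_span (hspan : Ideal.span {b | ∃ u ∈ oddSet τ, (ρ u).im = b} = ⊤) :
    (productIdeal i (oddSet τ)).map (evenHom h h2 ρ hρ) = Ideal.span {f} := by
  apply le_antisymm
  · rw [productIdeal, Ideal.map_span, Ideal.span_le]
    rintro _ ⟨c, ⟨u, hu, v, hv, hc⟩, rfl⟩
    rw [evenHom_eq_mul h h2 hρ hu hc]
    exact Ideal.mul_mem_left _ _ (Ideal.mem_span_singleton_self f)
  · rw [Ideal.span_singleton_le_iff_mem]
    set K := (productIdeal i (oddSet τ)).map (evenHom h h2 ρ hρ)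
    have h1 : Ideal.span {b | ∃ u ∈ oddSet τ, (ρ u).im = b} *
        Ideal.span {b | ∃ u ∈ oddSet τ, (ρ u).im = b} ≤ K.colon {f} := by
      rw [Ideal.span_mul_span', Ideal.span_le]
      rintro _ ⟨_, ⟨u, hu, rfl⟩, _, ⟨v, hv, rfl⟩, rfl⟩
      obtain ⟨c, hc⟩ := h.exists_mul hu hv
      rw [SetLike.mem_coe, Submodule.mem_colon_singleton, smul_eq_mul,
        ← evenHom_eq_mul h h2 hρ hu hc]
      exact Ideal.mem_map_of_mem _ (Ideal.subset_span ⟨u, hu, v, hv, hc⟩)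
    rw [hspan, Ideal.top_mul, top_le_iff, Ideal.eq_top_iff_one, Submodule.mem_colon_singleton,
      one_smul] at h1
    exact h1

end

/-- Two equivariant homomorphisms to double covers of `B` with the same restriction to the
invariants differ by an isomorphism of double covers, as soon as an odd element has invertible
imaginary part under both. -/
lemma exists_map_comp_eq (h : IsInvolutionRing i τ) (h2 : IsUnit (2 : B)) {f₁ f₂ : B}
    {ρ₁ : R →+* Dbl B f₁} {ρ₂ : R →+* Dbl B f₂}
    (hρ₁ : ρ₁.comp τ = (Dbl.conj f₁).comp ρ₁) (hρ₂ : ρ₂.comp τ = (Dbl.conj f₂).comp ρ₂)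
    (he : evenHom h h2 ρ₁ hρ₁ = evenHom h h2 ρ₂ hρ₂) (hf : f₂ ∈ B⁰) {u : R}
    (hu : u ∈ oddSet τ) (hu₁ : IsUnit (ρ₁ u).im) (hu₂ : IsUnit (ρ₂ u).im) :
    ∃ (d : B) (hd : f₁ = d * d * f₂), IsUnit d ∧ (Dbl.map (RingHom.id B) d f₂ hd).comp ρ₁ = ρ₂ := by
  obtain ⟨l, hl⟩ := hu₁.exists_left_inv
  obtain ⟨c, hc⟩ := h.exists_mul hu hu
  have h1 := evenHom_eq_mul h h2 hρ₁ hu hc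
  rw [he, evenHom_eq_mul h h2 hρ₂ hu hc] at h1
  have hd : f₁ = (l * (ρ₂ u).im) * (l * (ρ₂ u).im) * f₂ := by
    linear_combination -(1 + l * (ρ₁ u).im) * f₁ * hl - l ^ 2 * h1
  refine ⟨_, hd, (IsUnit.of_mul_eq_one _ hl).mul hu₂, ?_⟩
  ext r
  · obtain ⟨e, v, hv, rfl⟩ := h.exists_even_odd r
    have := congr($he e)
    change (ρ₁ (i e)).re = (ρ₂ (i e)).re at this
    simp [re_eq_zero_of_odd h2 hρ₁ hv, re_eq_zero_of_odd h2 hρ₂ hv, this]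
  · obtain ⟨e, v, hv, rfl⟩ := h.exists_even_odd r
    have e1 := congr(($(comp_eq_evenHom h h2 hρ₁) e).im)
    have e2 := congr(($(comp_eq_evenHom h h2 hρ₂) e).im)
    simp only [RingHom.comp_apply, QuadraticAlgebra.algebraMap_im] at e1 e2
    obtain ⟨c', hc'⟩ := h.exists_mul hv hu
    have h3 := evenHom_eq_mul h h2 hρ₁ hv hc'
    rw [he, evenHom_eq_mul h h2 hρ₂ hv hc'] at h3
    have h4 : ((ρ₁ v).im * l * (ρ₂ u).im - (ρ₂ v).im) * (ρ₂ u).im * f₂ = 0 := by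
      linear_combination - (ρ₁ v).im * l * (ρ₂ u).im ^ 2 * f₂ * hl - h3 -
        (ρ₁ v).im * (ρ₁ u).im * hd
    have h5 := (mem_nonZeroDivisors_iff_right.1 hf) _ h4
    have h6 := hu₂.mul_left_eq_zero.1 h5
    simp only [RingHom.comp_apply, map_add, Dbl.im_map, QuadraticAlgebra.im_add, e1, e2,
      RingHom.id_apply]
    linear_combination h6

/-- A homomorphism `φ` on the invariants extends to an equivariant homomorphism to `B[√f]`, with
`f = φ (u²)`, if `u` is odd and `f` is a nonzerodivisor that generates the ideal of the products
of odd elements. -/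
lemma exists_equivariant_hom (h : IsInvolutionRing i τ) (φ : R₀ →+* B) {u : R}
    (hu : u ∈ oddSet τ) {c₀ : R₀} (hc₀ : i c₀ = u * u) (hf : φ c₀ ∈ B⁰)
    (hI : (productIdeal i (oddSet τ)).map φ ≤ Ideal.span {φ c₀}) :
    ∃ ρ : R →+* Dbl B (φ c₀), ρ.comp τ = (Dbl.conj _).comp ρ ∧
      ρ.comp i = (algebraMap B _).comp φ ∧ ρ u = Dbl.root _ := by
  have hf := mem_nonZeroDivisors_iff_right.1 hf
  have cancel {x y : B} (hxy : x * φ c₀ = y * φ c₀) : x = y :=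
    sub_eq_zero.1 (hf _ (by rw [sub_mul, hxy, sub_self]))
  -- `Rel r x` says that `x` is the value at `r = c + w`, with even part `c` and odd part `w`: its
  -- real part is `φ c`, and its imaginary part is the quotient of `φ (w u)` by `φ (u²)`
  let Rel (r : R) (x : Dbl B (φ c₀)) : Prop := ∃ c, ∃ w ∈ oddSet τ, ∃ p, r = i c + w ∧
    i p = w * u ∧ x.re = φ c ∧ x.im * φ c₀ = φ p
  have ex (r) : ∃ x, Rel r x := by
    obtain ⟨c, w, hw, rfl⟩ := h.exists_even_odd r
    obtain ⟨p, hp⟩ := h.exists_mul hw hu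
    obtain ⟨y, hy⟩ := Ideal.mem_span_singleton'.1
      (hI (Ideal.mem_map_of_mem φ (Ideal.subset_span ⟨w, hw, u, hu, hp⟩)))
    exact ⟨⟨φ c, y⟩, c, w, hw, p, rfl, hp, rfl, hy⟩
  have uniq {r x y} (hx : Rel r x) (hy : Rel r y) : x = y := by
    obtain ⟨c, w, hw, p, hr, hp, hxr, hxi⟩ := hx
    obtain ⟨c', w', hw', p', hr', hp', hyr, hyi⟩ := hy
    have e1 : i (c - c') = w' - w := by rw [map_sub]; linear_combination hr' - hr
    have e2 : c = c' := sub_eq_zero.1 (h.eq_zero_of_odd (by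
      simp only [oddSet, Set.mem_ofPred_eq] at hw hw' ⊢
      rw [e1, map_sub, hw, hw']; ring))
    subst e2
    have e3 : w = w' := by rw [sub_self, map_zero] at e1; exact (sub_eq_zero.1 e1.symm).symm
    subst e3
    have e4 : p = p' := h.inj (hp.trans hp'.symm)
    subst e4
    ext
    · rw [hxr, hyr]
    · exact cancel (hxi.trans hyi.symm)
  choose F hF using ex
  have hi (c) : Rel (i c) (algebraMap B _ (φ c)) :=
    ⟨c, 0, by simp [oddSet], 0, by simp, by simp, by simp, by simp⟩
  have hodd {x y : R} (hx : x ∈ oddSet τ) (hy : y ∈ oddSet τ) : x + y ∈ oddSet τ := by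
    simp only [oddSet, Set.mem_ofPred_eq, map_add] at hx hy ⊢; rw [hx, hy]; ring
  have hodd' {x : R} (c) (hx : x ∈ oddSet τ) : i c * x ∈ oddSet τ := by
    simp only [oddSet, Set.mem_ofPred_eq, map_mul, h.map_i] at hx ⊢; rw [hx]; ring
  let ρ : R →+* Dbl B (φ c₀) :=
    { toFun := F
      map_one' := uniq (hF 1) (by simpa using hi 1)
      map_zero' := uniq (hF 0) (by simpa using hi 0)
      map_add' x y := by
        refine uniq (hF _) ?_
        obtain ⟨c, w, hw, p, hr, hp, hxr, hxi⟩ := hF x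
        obtain ⟨c', w', hw', p', hr', hp', hyr, hyi⟩ := hF y
        refine ⟨c + c', w + w', hodd hw hw', p + p', ?_, ?_, ?_, ?_⟩
        · rw [hr, hr', map_add]; ring
        · rw [map_add, hp, hp']; ring
        · rw [QuadraticAlgebra.re_add, hxr, hyr, map_add]
        · rw [QuadraticAlgebra.im_add, add_mul, hxi, hyi, map_add]
      map_mul' x y := by
        refine uniq (hF _) ?_
        obtain ⟨c, w, hw, p, hr, hp, hxr, hxi⟩ := hF x
        obtain ⟨c', w', hw', p', hr', hp', hyr, hyi⟩ := hF y
        obtain ⟨m, hm⟩ := h.exists_mul hw hw'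
        have hpp : p * p' = m * c₀ := h.inj (by
          rw [map_mul, map_mul, hp, hp', hm, hc₀]; ring)
        have hmm : (F x).im * (F y).im * φ c₀ = φ m := cancel (by
          rw [← map_mul, ← hpp, map_mul, ← hxi, ← hyi]; ring)
        refine ⟨c * c' + m, i c * w' + i c' * w, hodd (hodd' _ hw') (hodd' _ hw),
          c * p' + c' * p, ?_, ?_, ?_, ?_⟩
        · rw [hr, hr', map_add, map_mul, hm]; ring
        · rw [map_add, map_mul, map_mul, hp, hp']; ring
        · rw [QuadraticAlgebra.re_mul, hxr, hyr, map_add, map_mul, ← hmm]; ring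
        · rw [QuadraticAlgebra.im_mul, map_add, map_mul, map_mul, ← hxi, ← hyi, hxr, hyr]; ring }
  refine ⟨ρ, ?_, ?_, ?_⟩
  · refine RingHom.ext fun x => uniq (hF _) ?_
    obtain ⟨c, w, hw, p, hr, hp, hxr, hxi⟩ := hF x
    refine ⟨c, -w, ?_, -p, ?_, ?_, ?_, ?_⟩
    · simp only [oddSet, Set.mem_ofPred_eq, map_neg] at hw ⊢; rw [hw]
    · rw [hr, map_add, h.map_i, hw]
    · rw [map_neg, hp]; ring
    · rw [RingHom.comp_apply, Dbl.re_conj]; exact hxr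
    · rw [RingHom.comp_apply, Dbl.im_conj, neg_mul, map_neg]; exact congr(- $hxi)
  · exact RingHom.ext fun c => uniq (hF _) (hi c)
  · exact uniq (hF _) ⟨0, u, hu, c₀, by simp, hc₀, by simp, by simp⟩

end Parity

/-! ### Formal smoothness of rings of invariants -/

lemma isNilpotent_of_forall_mul_eq_zero {R : Type*} [CommRing R] {I : Ideal R}
    (h : ∀ x ∈ I, ∀ y ∈ I, x * y = 0) : IsNilpotent I := by
  refine ⟨2, ?_⟩
  rw [sq, Ideal.zero_eq_bot, eq_bot_iff, Ideal.mul_le]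
  exact fun x hx y hy => h x hx y hy

section Smooth

variable {K R₀ R : Type*} [CommRing K] [CommRing R₀] [CommRing R] [Algebra K R₀] [Algebra K R]

/-- If an odd element has an invertible square, formal smoothness descends to the invariants:
a map from the invariants to `B ⧸ I` extends to a map `R → (B ⧸ I)[√f]`, which lifts to `B[√f']`,
and the even part of the lift is multiplicative on the invariants since its odd part has values in
the square zero ideal `I`. -/
lemma formallySmooth_invariants (i : R₀ →ₐ[K] R) {τ : R →+* R}
    (h : IsInvolutionRing (i : R₀ →+* R) τ) [Algebra.FormallySmooth K R] {u : R}
    (hu : u ∈ oddSet τ) {c₀ : R₀} (hc₀ : i c₀ = u * u) (hc₀' : IsUnit c₀) :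
    Algebra.FormallySmooth K R₀ := by
  rw [Algebra.FormallySmooth.iff_comp_surjective]
  intro B _ _ I hI φ
  have hunit : IsUnit (φ c₀) := hc₀'.map φ
  obtain ⟨ρ, -, hρi, -⟩ := exists_equivariant_hom h (φ : R₀ →+* B ⧸ I) hu hc₀
    hunit.mem_nonZeroDivisors (by
      change _ ≤ Ideal.span {φ c₀}
      rw [Ideal.span_singleton_eq_top.2 hunit]; exact le_top)
  obtain ⟨f', hf'⟩ := Ideal.Quotient.mk_surjective (φ c₀)
  have hρi (c) : ρ (i c) = algebraMap _ _ (φ c) := congr($hρi c)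
  let ρK : R →ₐ[K] Dbl (B ⧸ I) (φ c₀) :=
    { ρ with
      commutes' := fun k => by
        change ρ (algebraMap K R k) = _
        rw [← i.commutes k, hρi, φ.commutes]
        rfl }
  have hf'' : Ideal.Quotient.mk I f' = 1 * 1 * φ c₀ := by rw [hf', one_mul, one_mul]
  let g : Dbl B f' →ₐ[K] Dbl (B ⧸ I) (φ c₀) :=
    { Dbl.map (Ideal.Quotient.mk I) 1 (φ c₀) hf'' with
      commutes' := fun k => by
        change Dbl.map (Ideal.Quotient.mk I) 1 (φ c₀) hf'' (algebraMap B _ (algebraMap K B k)) =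
          algebraMap (B ⧸ I) _ (algebraMap K (B ⧸ I) k)
        ext <;> simp }
  have gre (x) : (g x).re = Ideal.Quotient.mk I x.re := Dbl.re_map _ _ _ hf'' x
  have gim (x) : (g x).im = Ideal.Quotient.mk I x.im :=
    (Dbl.im_map _ _ _ hf'' x).trans (mul_one _)
  have hg : Function.Surjective g := fun y => by
    obtain ⟨p, hp⟩ := Ideal.Quotient.mk_surjective y.re
    obtain ⟨q, hq⟩ := Ideal.Quotient.mk_surjective y.im
    exact ⟨⟨p, q⟩, by ext <;> simp [gre, gim, hp, hq]⟩
  have hI' {x y : B} (hx : x ∈ I) (hy : y ∈ I) : x * y = 0 := by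
    have := Ideal.mul_mem_mul hx hy
    rwa [← pow_two, hI, Ideal.mem_bot] at this
  have hker : IsNilpotent (RingHom.ker (g : Dbl B f' →+* Dbl (B ⧸ I) (φ c₀))) := by
    refine isNilpotent_of_forall_mul_eq_zero fun x hx y hy => ?_
    have mem {x} (hx : x ∈ RingHom.ker (g : Dbl B f' →+* Dbl (B ⧸ I) (φ c₀))) :
        x.re ∈ I ∧ x.im ∈ I := by
      have hx : g x = 0 := hx
      constructor
      · rw [← Ideal.Quotient.eq_zero_iff_mem, ← gre, hx]; rfl
      · rw [← Ideal.Quotient.eq_zero_iff_mem, ← gim, hx]; rfl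
    obtain ⟨h1, h2⟩ := mem hx
    obtain ⟨h3, h4⟩ := mem hy
    ext
    · simp [hI' h1 h3, mul_assoc, hI' h2 h4]
    · simp [hI' h1 h4, hI' h2 h3]
  let ψ : R →ₐ[K] Dbl B f' := Algebra.FormallySmooth.liftOfSurjective ρK g hg hker
  have hψ (r) : g (ψ r) = ρ r := Algebra.FormallySmooth.liftOfSurjective_apply ρK g hg hker r
  have hre (c) : Ideal.Quotient.mk I (ψ (i c)).re = φ c := by
    rw [← gre, hψ, hρi]; rfl
  have him (c) : (ψ (i c)).im ∈ I := by
    rw [← Ideal.Quotient.eq_zero_iff_mem, ← gim, hψ, hρi]; rfl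
  refine ⟨{ toFun := fun c => (ψ (i c)).re
            map_one' := by simp [QuadraticAlgebra.re_one]
            map_zero' := by simp
            map_add' := fun x y => by simp
            map_mul' := fun x y => by simp [mul_assoc, hI' (him x) (him y)]
            commutes' := fun k => by rw [i.commutes, ψ.commutes]; rfl }, ?_⟩
  ext c
  exact hre c

end Smooth

section Singular

variable {K R₀ κ : Type*} [CommRing K] [CommRing R₀] [Field κ] [Algebra K R₀] [Algebra K κ]

/-- The relation `u² v² = (uv)²` obstructs smoothness: it cannot be lifted along
`κ[W] ⧸ W³ → κ[W] ⧸ W²` if `u²`, `v²` map to `0` and `uv` to `W`. -/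
lemma not_formallySmooth_of_dual (χ : R₀ →ₐ[K] Dbl κ 0) {c₁ c₂ c₃ : R₀} (hc : c₁ * c₂ = c₃ * c₃)
    (h₁ : χ c₁ = 0) (h₂ : χ c₂ = 0) (h₃ : χ c₃ = Dbl.root 0) (p : Ideal R₀) [p.IsPrime]
    (hp : ∀ c, c ∉ p → (χ c).re ≠ 0) :
    ¬ Algebra.FormallySmooth K (Localization.AtPrime p) := by
  intro hsm
  have hunit (c : p.primeCompl) : IsUnit (χ c) := by
    rw [QuadraticAlgebra.isUnit_iff_norm_isUnit, isUnit_iff_ne_zero]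
    simpa [QuadraticAlgebra.norm_def] using hp c.1 c.2
  let χ' : Localization.AtPrime p →ₐ[K] Dbl κ 0 :=
    IsLocalization.liftAlgHom (M := p.primeCompl) (f := χ) hunit
  have hχ' (c) : χ' (algebraMap R₀ _ c) = χ c := IsLocalization.lift_eq _ _
  let J : Ideal (Polynomial κ) := Ideal.span {Polynomial.X ^ 3}
  let g₀ : Polynomial κ →ₐ[κ] Dbl κ 0 := Polynomial.aeval (Dbl.root 0)
  have hroot : (Dbl.root 0 : Dbl κ 0) ^ 2 = 0 := by rw [sq, Dbl.root_mul_root, map_zero]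
  have hg₀ (q : Polynomial κ) : g₀ q = ⟨q.coeff 0, q.coeff 1⟩ := by
    obtain ⟨a, b, q', rfl⟩ : ∃ (a b : κ) (q' : Polynomial κ),
        q = Polynomial.C a + Polynomial.C b * Polynomial.X + Polynomial.X ^ 2 * q' :=
      ⟨q.coeff 0, q.coeff 1, q.divX.divX, by
        conv_lhs => rw [← q.divX_mul_X_add, ← q.divX.divX_mul_X_add]
        simp [Polynomial.coeff_divX]; ring⟩
    simp only [g₀, map_add, map_mul, map_pow, Polynomial.aeval_C, Polynomial.aeval_X, hroot]
    ext <;> simp [pow_two, mul_assoc]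
  let g₁ : (Polynomial κ ⧸ J) →ₐ[κ] Dbl κ 0 := Ideal.Quotient.liftₐ J g₀ (by
    have : J ≤ RingHom.ker g₀ := by
      rw [Ideal.span_singleton_le_iff_mem, RingHom.mem_ker]
      change g₀ (Polynomial.X ^ 3) = 0
      rw [map_pow, show g₀ Polynomial.X = Dbl.root 0 from Polynomial.aeval_X _, pow_succ, hroot,
        zero_mul]
    exact fun a ha => this ha)
  let g : (Polynomial κ ⧸ J) →ₐ[K] Dbl κ 0 := g₁.restrictScalars K
  have hgmk (q) : g (Ideal.Quotient.mk J q) = ⟨q.coeff 0, q.coeff 1⟩ := hg₀ q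
  have hg : Function.Surjective g := fun y =>
    ⟨Ideal.Quotient.mk J (Polynomial.C y.re + Polynomial.C y.im * Polynomial.X), by
      rw [hgmk]; ext <;> simp⟩
  have hker : IsNilpotent (RingHom.ker (g : (Polynomial κ ⧸ J) →+* Dbl κ 0)) := by
    refine isNilpotent_of_forall_mul_eq_zero fun x hx y hy => ?_
    have mem (x) (hx : x ∈ RingHom.ker (g : (Polynomial κ ⧸ J) →+* Dbl κ 0)) :
        ∃ q, x = Ideal.Quotient.mk J (Polynomial.X ^ 2 * q) := by
      obtain ⟨q, rfl⟩ := Ideal.Quotient.mk_surjective x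
      have hx : g (Ideal.Quotient.mk J q) = 0 := hx
      rw [hgmk] at hx
      have h0 : q.coeff 0 = 0 := congr(($hx).re)
      have h1 : q.coeff 1 = 0 := congr(($hx).im)
      obtain ⟨q', rfl⟩ := Polynomial.X_pow_dvd_iff.2 (fun d hd => by
        interval_cases d; exacts [h0, h1] : ∀ d < 2, q.coeff d = 0)
      exact ⟨q', rfl⟩
    obtain ⟨q, rfl⟩ := mem x hx
    obtain ⟨q', rfl⟩ := mem y hy
    rw [← map_mul, Ideal.Quotient.eq_zero_iff_mem]
    exact Ideal.mem_span_singleton.2 ⟨Polynomial.X * q * q', by ring⟩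
  let ψ : Localization.AtPrime p →ₐ[K] Polynomial κ ⧸ J :=
    Algebra.FormallySmooth.liftOfSurjective χ' g hg hker
  have hψ (r) : g (ψ r) = χ' r := Algebra.FormallySmooth.liftOfSurjective_apply χ' g hg hker r
  obtain ⟨q₁, hq₁⟩ := Ideal.Quotient.mk_surjective (ψ (algebraMap R₀ _ c₁))
  obtain ⟨q₂, hq₂⟩ := Ideal.Quotient.mk_surjective (ψ (algebraMap R₀ _ c₂))
  obtain ⟨q₃, hq₃⟩ := Ideal.Quotient.mk_surjective (ψ (algebraMap R₀ _ c₃))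
  have e₁ := hψ (algebraMap R₀ _ c₁)
  have e₂ := hψ (algebraMap R₀ _ c₂)
  have e₃ := hψ (algebraMap R₀ _ c₃)
  rw [← hq₁, hgmk, hχ', h₁] at e₁
  rw [← hq₂, hgmk, hχ', h₂] at e₂
  rw [← hq₃, hgmk, hχ', h₃] at e₃
  have e : Ideal.Quotient.mk J (q₁ * q₂ - q₃ * q₃) = 0 := by
    rw [map_sub, map_mul, map_mul, hq₁, hq₂, hq₃, ← map_mul, ← map_mul, ← map_mul, ← map_mul, hc,
      sub_self]
  rw [Ideal.Quotient.eq_zero_iff_mem, Ideal.mem_span_singleton, Polynomial.X_pow_dvd_iff] at e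
  have := e 2 (by norm_num)
  have a10 : q₁.coeff 0 = 0 := congr(($e₁).re)
  have a11 : q₁.coeff 1 = 0 := congr(($e₁).im)
  have a20 : q₂.coeff 0 = 0 := congr(($e₂).re)
  have a30 : q₃.coeff 0 = 0 := congr(($e₃).re)
  have a31 : q₃.coeff 1 = 1 := congr(($e₃).im)
  rw [Polynomial.coeff_sub, Polynomial.coeff_mul, Polynomial.coeff_mul] at this
  simp [Finset.Nat.antidiagonal_succ, a10, a11, a20, a30, a31] at this

end Singular

/-! ### Second order jets along two derivations -/

section Jets

variable {K A κ : Type*} [CommRing K] [CommRing A] [Algebra K A] [CommRing κ] [Algebra K κ]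

/-- The ring `κ[ε₁, ε₂]` with `ε₁² = ε₂² = 0`. -/
abbrev Jet (κ : Type*) [CommRing κ] : Type _ := Dbl (Dbl κ 0) 0

/-- The second order expansion `a ↦ exp (t ε₁ D₁) exp (t ε₂ D₂) a` in `κ[ε₁, ε₂]`. -/
def jet (g : A →ₐ[K] κ) (D₁ D₂ : Derivation K A A) (t : K) : A →ₐ[K] Jet κ where
  toFun a := ⟨⟨g a, t • g (D₁ a)⟩, ⟨t • g (D₂ a), t • t • g (D₁ (D₂ a))⟩⟩
  map_one' := by ext <;> simp [QuadraticAlgebra.re_one, QuadraticAlgebra.im_one]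
  map_zero' := by ext <;> simp
  map_add' x y := by ext <;> simp
  map_mul' x y := by
    ext <;> simp [Derivation.leibniz, Algebra.smul_def] <;> ring
  commutes' k := by
    change _ = algebraMap (Dbl κ 0) (Jet κ) (algebraMap κ (Dbl κ 0) (algebraMap K κ k))
    ext <;> simp

/-- The involution `ε₁ ↦ -ε₁`, `ε₂ ↦ -ε₂`. -/
def jetConj (κ : Type*) [CommRing κ] : Jet κ →+* Jet κ :=
  Dbl.map (Dbl.conj 0) (-1) 0 (by simp)

lemma jetConj_jet (g : A →ₐ[K] κ) (D₁ D₂ : Derivation K A A) (t : K) (a : A) :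
    jetConj κ (jet g D₁ D₂ t a) = jet g D₁ D₂ (-t) a := by
  ext <;> simp [jetConj, jet]

/-- The homomorphism from the invariants to `κ[ε₁ε₂]` that is induced by an equivariant
homomorphism to `κ[ε₁, ε₂]`. -/
def jetEven {R₀ R : Type*} [CommRing R₀] [CommRing R] {i : R₀ →+* R} {τ : R →+* R}
    (h : IsInvolutionRing i τ) (h2 : IsUnit (2 : κ)) (ψ : R →+* Jet κ)
    (hψ : ψ.comp τ = (jetConj κ).comp ψ) : R₀ →+* Dbl κ 0 :=
  have hri (c : R₀) : (ψ (i c)).re.im = 0 := by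
    have := congr(($hψ (i c)).re.im)
    simp only [RingHom.comp_apply, h.map_i, jetConj, Dbl.re_map, Dbl.im_conj] at this
    exact h2.mul_right_eq_zero.1 (by linear_combination this)
  have hir (c : R₀) : (ψ (i c)).im.re = 0 := by
    have := congr(($hψ (i c)).im.re)
    simp only [RingHom.comp_apply, h.map_i, jetConj, Dbl.im_map, mul_neg, mul_one,
      QuadraticAlgebra.re_neg, Dbl.re_conj] at this
    exact h2.mul_right_eq_zero.1 (by linear_combination this)
  { toFun c := ⟨(ψ (i c)).re.re, (ψ (i c)).im.im⟩
    map_one' := by ext <;> simp [QuadraticAlgebra.re_one, QuadraticAlgebra.im_one]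
    map_zero' := by ext <;> simp
    map_add' x y := by ext <;> simp
    map_mul' x y := by ext <;> simp [hri, hir] }

end Jets

section

open TensorProduct

/-! ### Coordinates on a smooth algebra -/

section Flat

/-- A relation with two terms that only has trivial solutions keeps this property under flat base
change. -/
lemma mem_span_of_flat {P T : Type*} [CommRing P] [CommRing T] [Algebra P T] [Module.Flat P T]
    {p q : P} (h : ∀ a b : P, q * a = p * b → a ∈ Ideal.span {p}) {r r' : T}
    (hr : algebraMap P T q * r = algebraMap P T p * r') : r ∈ Ideal.span {algebraMap P T p} := by
  have := Module.Flat.isTrivialRelation_of_sum_smul_eq_zero (R := P) (M := T) (f := ![q, -p])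
    (x := ![r, r']) (by simp [Algebra.smul_def, hr])
  obtain ⟨k, a, y, h1, h2⟩ := this
  have h1 := h1 0
  simp only [Matrix.cons_val_zero] at h1
  rw [h1]
  refine sum_mem fun j _ => ?_
  have h3 := h2 j
  simp only [Fin.sum_univ_two, Matrix.cons_val_zero, Matrix.cons_val_one] at h3
  obtain ⟨c, hc⟩ := Ideal.mem_span_singleton'.1 (h (a 0 j) (a 1 j) (by linear_combination h3))
  rw [← hc, Algebra.smul_def, map_mul]
  exact Ideal.mem_span_singleton'.2 ⟨algebraMap P T c * y j, by ring⟩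

lemma eq_zero_of_flat {P T : Type*} [CommRing P] [CommRing T] [Algebra P T] [Module.Flat P T]
    {p : P} (h : ∀ a : P, p * a = 0 → a = 0) {r : T} (hr : algebraMap P T p * r = 0) : r = 0 := by
  have := Module.Flat.isTrivialRelation_of_sum_smul_eq_zero (R := P) (M := T) (f := ![p])
    (x := ![r]) (by simp [Algebra.smul_def, hr])
  obtain ⟨k, a, y, h1, h2⟩ := this
  have h1 := h1 0
  simp only [Matrix.cons_val_zero] at h1
  rw [h1]
  refine Finset.sum_eq_zero fun j _ => ?_
  have h3 := h2 j
  simp only [Finset.univ_unique, Fin.default_eq_zero, Matrix.cons_val_zero,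
    Finset.sum_singleton, Fin.isValue] at h3
  rw [h _ h3, zero_smul]

variable {A : Type*} [CommRing A]

/-- This and `mvPolynomial_regular_snd` say that `x - X₀`, `y - X₁` is a regular sequence in
`A[X₀, X₁]`. -/
lemma mvPolynomial_regular_fst (x : A) (a : MvPolynomial (Fin 2) A)
    (h : (MvPolynomial.C x - MvPolynomial.X 0) * a = 0) : a = 0 := by
  let e := MvPolynomial.finSuccEquiv A 1
  have h1 : e (MvPolynomial.C x - MvPolynomial.X 0) =
      -(Polynomial.X - Polynomial.C (MvPolynomial.C x)) := by
    rw [map_sub]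
    simp [e, MvPolynomial.finSuccEquiv_apply]
  have h2 := congr(e $h)
  rw [map_mul, map_zero, h1] at h2
  have h3 := (Polynomial.monic_X_sub_C (MvPolynomial.C x : MvPolynomial (Fin 1) A)).isRegular.left
  have h4 : e a = 0 := h3 (by
    change (Polynomial.X - Polynomial.C _) * e a = (Polynomial.X - Polynomial.C _) * 0
    linear_combination -h2)
  exact e.injective (h4.trans (map_zero e).symm)

lemma mvPolynomial_regular_snd (x y : A) (a b : MvPolynomial (Fin 2) A)
    (h : (MvPolynomial.C y - MvPolynomial.X 1) * a = (MvPolynomial.C x - MvPolynomial.X 0) * b) :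
    a ∈ Ideal.span {MvPolynomial.C x - MvPolynomial.X (R := A) (0 : Fin 2)} := by
  let θ : MvPolynomial (Fin 2) A →ₐ[A] Polynomial A :=
    MvPolynomial.aeval ![Polynomial.C x, Polynomial.X]
  let η : Polynomial A →ₐ[A] MvPolynomial (Fin 2) A := Polynomial.aeval (MvPolynomial.X 1)
  set J := Ideal.span {MvPolynomial.C x - MvPolynomial.X (R := A) (0 : Fin 2)}
  have hJ : ((Ideal.Quotient.mkₐ A J).comp η).comp θ = Ideal.Quotient.mkₐ A J := by
    apply MvPolynomial.algHom_ext
    intro i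
    fin_cases i
    · have : Ideal.Quotient.mk J (MvPolynomial.C x) = Ideal.Quotient.mk J (MvPolynomial.X 0) :=
        Ideal.Quotient.eq.2 (Ideal.mem_span_singleton_self _)
      simpa [θ, η] using this
    · simp [θ, η]
  have h1 := congr(θ $h)
  simp only [map_mul, map_sub] at h1
  have e0 : θ (MvPolynomial.X 0) = Polynomial.C x := by simp [θ]
  have e1 : θ (MvPolynomial.X 1) = Polynomial.X := by simp [θ]
  have eC (z) : θ (MvPolynomial.C z) = Polynomial.C z := by simp [θ]
  rw [e0, e1, eC, eC, sub_self, zero_mul] at h1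
  have h3 := (Polynomial.monic_X_sub_C y).isRegular.left
  have h4 : θ a = 0 := h3 (by
    change (Polynomial.X - Polynomial.C y) * θ a = (Polynomial.X - Polynomial.C y) * 0
    linear_combination -h1)
  rw [← Ideal.Quotient.eq_zero_iff_mem]
  have := congr($hJ a)
  simp only [AlgHom.comp_apply, h4, map_zero] at this
  exact this.symm

end Flat

section Coordinates

variable (K A : Type) [CommRing K] [CommRing A] [Algebra K A]

/-- Coordinates on a smooth `K`-algebra of relative dimension two: two elements whose
differentials are a basis of the module of differentials. -/
structure Coordinates where
  x : Fin 2 → A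
  basis : Module.Basis (Fin 2) A Ω[A⁄K]
  basis_apply : ∀ i, basis i = KaehlerDifferential.D K A (x i)

variable {K A}

/-- The same coordinates in the opposite order. -/
def Coordinates.swap (X : Coordinates K A) : Coordinates K A where
  x i := X.x (Equiv.swap 0 1 i)
  basis := X.basis.reindex (Equiv.swap 0 1)
  basis_apply i := by simp [X.basis_apply]

/-- The derivation that is dual to a coordinate. -/
def Coordinates.deriv (X : Coordinates K A) (i : Fin 2) : Derivation K A A :=
  (X.basis.coord i).compDer (KaehlerDifferential.D K A)

lemma Coordinates.deriv_apply (X : Coordinates K A) (i j : Fin 2) :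
    X.deriv i (X.x j) = if j = i then 1 else 0 := by
  simp [Coordinates.deriv, ← X.basis_apply, Finsupp.single_apply]

/-- A smooth algebra is étale, so flat, over the polynomial ring in its coordinates. -/
lemma Coordinates.flat [Algebra.Smooth K A] (X : Coordinates K A) :
    (MvPolynomial.aeval X.x : MvPolynomial (Fin 2) K →ₐ[K] A).toRingHom.Flat := by
  let P := MvPolynomial (Fin 2) K
  algebraize [(MvPolynomial.aeval X.x : MvPolynomial (Fin 2) K →ₐ[K] A).toRingHom]
  have : IsScalarTower K P A := .of_algebraMap_eq fun k => by
    rw [RingHom.algebraMap_toAlgebra]; simp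
  have hX (i) : algebraMap P A (MvPolynomial.X i) = X.x i := by
    rw [RingHom.algebraMap_toAlgebra]
    exact MvPolynomial.aeval_X _ _
  have hbij : Function.Bijective (KaehlerDifferential.mapBaseChange K P A) := by
    let b := (KaehlerDifferential.mvPolynomialBasis K (Fin 2)).baseChange A
    have : KaehlerDifferential.mapBaseChange K P A =
        (b.equiv X.basis (Equiv.refl _)).toLinearMap := by
      apply b.ext
      intro i
      have h1 : b i = 1 ⊗ₜ[P] KaehlerDifferential.D K P (MvPolynomial.X i) := by
        simp [b, KaehlerDifferential.mvPolynomialBasis_apply, P]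
      rw [LinearEquiv.coe_coe, Module.Basis.equiv_apply, h1, Equiv.refl_apply, X.basis_apply,
        KaehlerDifferential.mapBaseChange_tmul, KaehlerDifferential.map_D, hX, one_smul]
    rw [this]
    exact (b.equiv X.basis (Equiv.refl _)).bijective
  have : Algebra.FinitePresentation P A := .of_restrict_scalars_finitePresentation K P A
  have h1 : Subsingleton (Algebra.H1Cotangent P A) := by
    refine ⟨fun a b => ?_⟩
    have key (z : Algebra.H1Cotangent P A) : z = 0 := by
      have h2 := (Algebra.H1Cotangent.exact_δ_mapBaseChange K P A).apply_apply_eq_zero z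
      have h3 : Algebra.H1Cotangent.δ K P A z = 0 := hbij.1 (h2.trans (map_zero _).symm)
      obtain ⟨w, rfl⟩ := (Algebra.H1Cotangent.exact_map_δ K P A z).1 h3
      rw [Subsingleton.elim w 0, map_zero]
    rw [key a, key b]
  have h4 : Subsingleton Ω[A⁄P] := by
    refine ⟨fun a b => ?_⟩
    have key (z : Ω[A⁄P]) : z = 0 := by
      obtain ⟨w, rfl⟩ := KaehlerDifferential.map_surjective K P A z
      obtain ⟨v, rfl⟩ := hbij.2 w
      exact (KaehlerDifferential.exact_mapBaseChange_map K P A).apply_apply_eq_zero v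
    rw [key a, key b]
  have : Algebra.FormallySmooth P A := ⟨inferInstance, h1⟩
  have : Algebra.Smooth P A := ⟨inferInstance, inferInstance⟩
  exact inferInstanceAs (Module.Flat P A)

/-- The free variables of a standard smooth presentation are coordinates, since their
differentials form a basis. -/
lemma exists_coordinates [Nontrivial A] [Algebra.IsStandardSmoothOfRelativeDimension 2 K A] :
    Nonempty (Coordinates K A) := by
  obtain ⟨ι, σ, _, _, P, hP⟩ := Algebra.IsStandardSmoothOfRelativeDimension.out (n := 2) (R := K)
    (S := A)
  have : Nat.card ((Set.range P.map)ᶜ : Set ι) = 2 := by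
    have := P.rank_kaehlerDifferential
    have h2 := P.basisKaehler.mk_eq_rank''
    rw [this, hP] at h2
    rw [Nat.card, h2]
    simp
  let e : ((Set.range P.map)ᶜ : Set ι) ≃ Fin 2 := Finite.equivFinOfCardEq this
  exact ⟨⟨fun i => P.val (e.symm i), P.basisKaehler.reindex e, fun i => by simp⟩⟩

end Coordinates

end

section

/-! ### The universal double cover -/

open TensorProduct Polynomial

section Blowup

variable {K R : Type} [CommRing K] [CommRing R] [Algebra K R] (τ : R →ₐ[K] R) (u v : R)

/-- The chart `R[v / u]` of the blow-up of the ideal `(u, v)`. -/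
def Chart : Type := R[X] ⧸ Ideal.span {C u * X - C v}

instance : CommRing (Chart u v) := inferInstanceAs (CommRing (R[X] ⧸ Ideal.span {C u * X - C v}))

instance : Algebra K (Chart u v) :=
  inferInstanceAs (Algebra K (R[X] ⧸ Ideal.span {C u * X - C v}))

variable {u v}

/-- The projection `R[X] → R[v / u]`, `X ↦ v / u`. -/
def Chart.mk : R[X] →+* Chart u v := Ideal.Quotient.mk _

lemma Chart.mk_surjective : Function.Surjective (Chart.mk : R[X] →+* Chart u v) :=
  Ideal.Quotient.mk_surjective

lemma Chart.hom_ext {B : Type*} [CommRing B] {g₁ g₂ : Chart u v →+* B}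
    (h : g₁.comp mk = g₂.comp mk) : g₁ = g₂ :=
  Ideal.Quotient.ringHom_ext h

lemma Chart.mul_eq : (mk (C u) * mk X : Chart u v) = mk (C v) :=
  Ideal.Quotient.eq.2 (Ideal.mem_span_singleton_self _)

/-- If `u, v` is a regular sequence, then `u` is a nonzerodivisor on `R[v / u]`. -/
lemma Chart.regular (hu : ∀ a, u * a = 0 → a = 0)
    (hv : ∀ a b, v * a = u * b → a ∈ Ideal.span {u}) {z : Chart u v}
    (hz : mk (C u) * z = 0) : z = 0 := by
  obtain ⟨p, rfl⟩ := Chart.mk_surjective z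
  obtain ⟨q, hq⟩ := Ideal.mem_span_singleton'.1 (Ideal.Quotient.eq_zero_iff_mem.1 hz)
  have h1 (n : ℕ) : ∃ c, c * u = q.coeff n := by
    rw [← Ideal.mem_span_singleton']
    refine hv _ ((X * q - p).coeff n) ?_
    rw [← coeff_C_mul, ← coeff_C_mul]
    congr 1
    linear_combination -hq
  have h2 : C u ∣ q := (C_dvd_iff_dvd_coeff _ _).2 fun n => by
    obtain ⟨c, hc⟩ := h1 n
    exact ⟨c, by rw [← hc, mul_comm]⟩
  obtain ⟨q', rfl⟩ := h2
  have h3 : C u * (q' * (C u * X - C v) - p) = 0 := by linear_combination hq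
  have h4 : q' * (C u * X - C v) - p = 0 := by
    ext n
    have := congr(coeff $h3 n)
    rw [coeff_C_mul, coeff_zero] at this
    exact hu _ this
  exact Ideal.Quotient.eq_zero_iff_mem.2 (Ideal.mem_span_singleton'.2 ⟨q', sub_eq_zero.1 h4⟩)

variable {τ}

/-- The involution of the chart `R[v / u]` that is induced by an involution of `R` with respect to
which `u` and `v` are odd. -/
def Chart.invol (hu : τ u = -u) (hv : τ v = -v) : Chart u v →ₐ[K] Chart u v :=
  Ideal.quotientMapₐ _ (Polynomial.mapAlgHom τ) (by
    rw [Ideal.span_singleton_le_iff_mem, Ideal.mem_comap, Ideal.mem_span_singleton']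
    exact ⟨-1, by simp [hu, hv]; ring⟩)

lemma Chart.invol_mk (hu : τ u = -u) (hv : τ v = -v) (p : R[X]) :
    Chart.invol hu hv (mk p) = mk (p.map (τ : R →+* R)) := rfl

lemma Chart.invol_invol (h : ∀ r, τ (τ r) = r) (hu : τ u = -u) (hv : τ v = -v) (z : Chart u v) :
    Chart.invol hu hv (Chart.invol hu hv z) = z := by
  obtain ⟨p, rfl⟩ := Chart.mk_surjective z
  rw [invol_mk, invol_mk]
  congr 1
  ext n
  simp [h]

/-- On the chart, the ideal generated by the differences `z - τ z` is contained in the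
principal ideal of `u`. -/
lemma Chart.sub_mem (hu : τ u = -u) (hv : τ v = -v)
    (h : ∀ r, r - τ r ∈ Ideal.span {u, v}) (z : Chart u v) :
    z - Chart.invol hu hv z ∈ Ideal.span {(mk (C u) : Chart u v)} := by
  obtain ⟨p, rfl⟩ := Chart.mk_surjective z
  rw [invol_mk, ← map_sub]
  induction p using Polynomial.induction_on' with
  | add p q hp hq =>
    have : p + q - (p + q).map (τ : R →+* R) =
      (p - p.map (τ : R →+* R)) + (q - q.map (τ : R →+* R)) := by
      rw [Polynomial.map_add]; ring
    rw [this, map_add]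
    exact add_mem hp hq
  | monomial n a =>
    obtain ⟨x, y, hxy⟩ := Ideal.mem_span_pair.1 (h a)
    rw [Polynomial.map_monomial, ← map_sub]
    change mk (monomial n (a - τ a)) ∈ _
    rw [← hxy, Ideal.mem_span_singleton', ← C_mul_X_pow_eq_monomial]
    refine ⟨mk (C x * X ^ n) + mk (C y * X ^ (n + 1)), ?_⟩
    simp only [map_add, map_mul, map_pow, pow_succ]
    rw [← Chart.mul_eq]
    ring

/-- Blowing up a fixed locus that is cut out by a regular sequence `u, v` of odd elements makes the
quotient by the involution a double cover, branched along a Cartier divisor; it is universal among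
the equivariant homomorphisms to double covers for which the image of `u` is a generator. -/
lemma exists_double (h2 : IsUnit (2 : K)) (h : ∀ r, τ (τ r) = r) (hu : τ u = -u) (hv : τ v = -v)
    (hsub : ∀ r, r - τ r ∈ Ideal.span {u, v}) (hur : ∀ a, u * a = 0 → a = 0)
    (hvr : ∀ a b, v * a = u * b → a ∈ Ideal.span {u}) :
    ∃ (D : Type) (_ : CommRing D) (_ : Algebra K D) (fD : D) (_ : fD ∈ D⁰)
      (μ : R →ₐ[K] Dbl D fD),
      (μ : R →+* Dbl D fD).comp (τ : R →+* R) = (Dbl.conj fD).comp (μ : R →+* Dbl D fD) ∧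
      μ u = Dbl.root fD ∧
      ∀ (B : Type) [CommRing B] [Algebra K B] (f : B) (ρ : R →ₐ[K] Dbl B f),
        (ρ : R →+* Dbl B f).comp (τ : R →+* R) = (Dbl.conj f).comp (ρ : R →+* Dbl B f) →
        IsUnit (ρ u).im → ∃ (χ : D →ₐ[K] B) (hd : (χ : D →+* B) fD = (ρ u).im * (ρ u).im * f),
          (Dbl.map (χ : D →+* B) _ f hd).comp (μ : R →+* Dbl D fD) = ρ := by
  let τ' := Chart.invol hu hv
  let u' : Chart u v := Chart.mk (C u)
  have hu' : τ' u' = -u' := by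
    simp only [τ', u', Chart.invol_mk, map_C]
    rw [← map_neg, ← C_neg, ← hu]; rfl
  -- `D` is the ring of invariants of the chart `R[v / u]`, with discriminant `u²`; as every odd
  -- element of the chart is the product of an invariant and `u`, the chart is `D[√(u²)]`
  let D := AlgHom.equalizer τ' (AlgHom.id K (Chart u v))
  have hinv : IsInvolutionRing (D.val : D →+* Chart u v) (τ' : Chart u v →+* Chart u v) :=
    { two := by simpa only [map_ofNat] using h2.map (algebraMap K D)
      invol := Chart.invol_invol h hu hv
      inj := Subtype.val_injective
      range := fun r => ⟨by rintro ⟨c, rfl⟩; exact c.2, fun hr => ⟨⟨r, hr⟩, rfl⟩⟩ }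
  let fD : D := ⟨u' * u', by
    change τ' (u' * u') = u' * u'
    rw [map_mul, hu', neg_mul_neg]⟩
  have hreg {z : Chart u v} (hz : u' * z = 0) : z = 0 := Chart.regular hur hvr hz
  have hsq : u' * u' = (D.val : D →+* Chart u v) fD := rfl
  let E : Dbl D fD →+* Chart u v := Dbl.eval (D.val : D →+* Chart u v) u' hsq
  have hodd (r : Chart u v) (hr : r ∈ oddSet (τ' : Chart u v →+* Chart u v)) :
      ∃ c : D, r = c * u' := by
    obtain ⟨l, hl⟩ := h2.exists_left_inv
    obtain ⟨c, hc⟩ := Ideal.mem_span_singleton'.1 (Chart.sub_mem hu hv hsub (l • r))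
    have h3 : c * u' = r := by
      rw [hc, map_smul, show Chart.invol hu hv r = - r from hr, smul_neg, sub_neg_eq_add,
        ← two_smul K, smul_smul, mul_comm, hl, one_smul]
    refine ⟨⟨c, ?_⟩, h3.symm⟩
    change τ' c = c
    have h4 : τ' r = -r := hr
    rw [← h3, map_mul, hu'] at h4
    exact sub_eq_zero.1 (hreg (by linear_combination -h4))
  have hE : Function.Bijective E := by
    refine ⟨(injective_iff_map_eq_zero _).2 fun x hx => ?_, fun r => ?_⟩
    · have hx : (x.re : Chart u v) + x.im * u' = 0 := hx
      have h5 := congr(τ' $hx)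
      have h6 (c : D) : τ' c = c := c.2
      rw [map_add, map_mul, h6, h6, hu', map_zero] at h5
      have h7 : (2 : Chart u v) * x.re = 0 := by linear_combination hx + h5
      have h8 : (x.re : Chart u v) = 0 := IsUnit.mul_right_eq_zero (by
        simpa only [map_ofNat] using h2.map (algebraMap K (Chart u v))) |>.1 h7
      have h9 : (x.im : Chart u v) = 0 := hreg (by linear_combination hx - h8)
      exact QuadraticAlgebra.ext (Subtype.ext h8) (Subtype.ext h9)
    · obtain ⟨c, w, hw, rfl⟩ := hinv.exists_even_odd r
      obtain ⟨c', rfl⟩ := hodd w hw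
      exact ⟨⟨c, c'⟩, rfl⟩
  let Ea : Dbl D fD →ₐ[K] Chart u v :=
    { E with
      commutes' k := by
        rw [IsScalarTower.algebraMap_apply K D (Dbl D fD)]
        exact Dbl.eval_algebraMap (D.val : D →+* Chart u v) u' hsq _ }
  let e : Dbl D fD ≃ₐ[K] Chart u v := AlgEquiv.ofBijective Ea hE
  let j : R →ₐ[K] Chart u v := (Ideal.Quotient.mkₐ K _ : R[X] →ₐ[K] Chart u v).comp CAlgHom
  have hEu : e.symm u' = Dbl.root fD := by
    rw [AlgEquiv.symm_apply_eq]
    exact (Dbl.eval_root (D.val : D →+* Chart u v) u' hsq).symm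
  have hconj (x : Dbl D fD) : E (Dbl.conj fD x) = τ' (E x) := by
    have h6 (c : D) : τ' c = c := c.2
    change D.val _ + D.val _ * u' = τ' (D.val _ + D.val _ * u')
    rw [Dbl.re_conj, Dbl.im_conj, map_add, map_mul, hu']
    simp only [Subalgebra.coe_val, h6, Subalgebra.coe_neg]
    ring
  have hfD : fD ∈ (D : Type)⁰ := by
    rw [mem_nonZeroDivisors_iff_right]
    intro c hc
    refine Subtype.ext (hreg (hreg ?_))
    have := congrArg Subtype.val hc
    change (c : Chart u v) * (u' * u') = 0 at this
    linear_combination this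
  let μ : R →ₐ[K] Dbl D fD := e.symm.toAlgHom.comp j
  refine ⟨D, inferInstance, inferInstance, fD, hfD, μ, ?_, hEu, ?_⟩
  · ext r : 1
    apply e.injective
    change e (e.symm (j (τ r))) = E (Dbl.conj fD (e.symm (j r)))
    rw [hconj]
    change _ = τ' (e (e.symm (j r)))
    rw [AlgEquiv.apply_symm_apply, AlgEquiv.apply_symm_apply]
    change _ = Chart.mk (Polynomial.map (τ : R →+* R) (C r))
    rw [map_C]
    rfl
  · intro B _ _ f ρ hρ hunit
    have h2B : IsUnit (2 : B) := by simpa only [map_ofNat] using h2.map (algebraMap K B)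
    have hρ0 {x : R} (hx : τ x = -x) : ρ x = algebraMap B _ (ρ x).im * Dbl.root f := by
      conv_lhs => rw [Dbl.eq_add f (ρ x)]
      have := re_eq_zero_of_odd (τ := (τ : R →+* R)) h2B hρ (u := x) hx
      rw [show (ρ x).re = 0 from this]; simp
    obtain ⟨l, hl⟩ := hunit.exists_left_inv
    -- the quotient `ρ v / ρ u`, which extends `ρ` to the chart
    let w : Dbl B f := algebraMap B _ ((ρ v).im * l)
    have hw : ρ u * w = ρ v := by
      rw [hρ0 hu, hρ0 hv]
      simp only [w, map_mul]
      have hl := congr(algebraMap B (Dbl B f) $hl)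
      rw [map_mul, map_one] at hl
      linear_combination (algebraMap B (Dbl B f) (ρ v).im * Dbl.root f) * hl
    let ρ' : Chart u v →+* Dbl B f := Ideal.Quotient.lift _ (eval₂RingHom (ρ : R →+* Dbl B f) w) (by
      intro a ha
      obtain ⟨c, rfl⟩ := Ideal.mem_span_singleton'.1 ha
      simp [hw])
    have hρ'mk (p) : ρ' (Chart.mk p) = eval₂ (ρ : R →+* Dbl B f) w p := rfl
    have hρ' : ρ'.comp (τ' : Chart u v →+* Chart u v) = (Dbl.conj f).comp ρ' := by
      refine Chart.hom_ext (Polynomial.ringHom_ext ?_ ?_)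
      · intro a
        have : ρ (τ a) = Dbl.conj f (ρ a) := congr($hρ a)
        simp only [RingHom.comp_apply, RingHom.coe_coe, τ', Chart.invol_mk, map_C, hρ'mk, eval₂_C]
        exact this
      · simp only [RingHom.comp_apply, RingHom.coe_coe, τ', Chart.invol_mk, map_X, hρ'mk, eval₂_X]
        exact congr($(Dbl.conj_comp_algebraMap f) _).symm
    let χ := evenHom hinv h2B ρ' hρ'
    have hχ : ρ'.comp (D.val : D →+* Chart u v) = (algebraMap B _).comp χ :=
      comp_eq_evenHom hinv h2B hρ'
    have hu'' : ρ' u' = ρ u := by simp [u', hρ'mk]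
    have hd : χ fD = (ρ u).im * (ρ u).im * f := by
      rw [← hu'']
      exact evenHom_eq_mul hinv h2B hρ' (u := u') hu' rfl
    refine ⟨{ χ with
      commutes' k := ?_ }, hd, ?_⟩
    · change (ρ' (algebraMap K (Chart u v) k)).re = _
      have : algebraMap K (Chart u v) k = Chart.mk (C (algebraMap K R k)) := rfl
      rw [this, hρ'mk, eval₂_C, RingHom.coe_coe, AlgHom.commutes,
        IsScalarTower.algebraMap_apply K B (Dbl B f), QuadraticAlgebra.algebraMap_re]
    · have key : Dbl.map χ (ρ u).im f hd = ρ'.comp E := by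
        apply Dbl.hom_ext
        · rw [Dbl.map_comp_algebraMap, ← hχ]
          ext c : 1
          exact congr(ρ' $(Dbl.eval_algebraMap (D.val : D →+* Chart u v) u' hsq c)).symm
        · have h1 := hρ0 hu
          rw [Dbl.map, Dbl.eval_root, RingHom.comp_apply, Dbl.eval_root, hu'']
          exact h1.symm
      change (Dbl.map χ (ρ u).im f hd).comp _ = _
      rw [key]
      ext r : 1
      change ρ' (e (e.symm (j r))) = ρ r
      rw [AlgEquiv.apply_symm_apply]
      exact (hρ'mk (C r)).trans (by simp)

end Blowup

end

section

open TensorProduct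

section UniversalDouble

variable {K A : Type} [CommRing K] [CommRing A] [Algebra K A]

/-- The equation `x ⊗ 1 - 1 ⊗ x` of the diagonal. -/
def diagEq (x : A) : A ⊗[K] A := x ⊗ₜ 1 - 1 ⊗ₜ x

lemma comm_diagEq (x : A) :
    Algebra.TensorProduct.comm K A A (diagEq x) = -(diagEq x : A ⊗[K] A) := by
  simp [diagEq]

/-- Near the diagonal the ideal of the diagonal is generated by the coordinate differences. -/
lemma Coordinates.exists_mul_mem_span [Algebra.FiniteType K A] (X : Coordinates K A) :
    ∃ e : A ⊗[K] A, e - 1 ∈ KaehlerDifferential.ideal K A ∧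
      ∀ z ∈ KaehlerDifferential.ideal K A, e * z ∈ Ideal.span {diagEq (X.x 0), diagEq (X.x 1)} := by
  set J := KaehlerDifferential.ideal K A
  obtain ⟨e, he, h⟩ := Submodule.exists_sub_one_mem_and_smul_le_of_fg_of_le_sup (I := J)
    (N := Ideal.span {diagEq (X.x 0), diagEq (X.x 1)}) (N' := J) (P := J)
    (KaehlerDifferential.ideal_fg K A) le_rfl (by
      intro z hz
      have h1 := X.basis.sum_repr (J.toCotangent ⟨z, hz⟩)
      rw [Fin.sum_univ_two, X.basis_apply, X.basis_apply] at h1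
      set a := X.basis.repr (J.toCotangent ⟨z, hz⟩)
      have hmem (i) : -diagEq (X.x i) ∈ J := by
        have := KaehlerDifferential.one_smul_sub_smul_one_mem_ideal K (X.x i)
        rwa [diagEq, neg_sub]
      have hD (i) : KaehlerDifferential.D K A (X.x i) = J.toCotangent ⟨_, hmem i⟩ := by
        rw [KaehlerDifferential.D_apply]
        congr 2
        simp [diagEq]
      rw [← algebraMap_smul (A ⊗[K] A) (a 0), ← algebraMap_smul (A ⊗[K] A) (a 1), hD, hD] at h1
      have h2 : J.toCotangent (algebraMap A (A ⊗[K] A) (a 0) • ⟨_, hmem 0⟩ +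
          algebraMap A (A ⊗[K] A) (a 1) • ⟨_, hmem 1⟩ - ⟨z, hz⟩) = 0 := by
        rw [map_sub, map_add, sub_eq_zero]
        exact h1
      rw [Ideal.toCotangent_eq_zero] at h2
      have h3 : algebraMap A (A ⊗[K] A) (a 0) * (-diagEq (X.x 0)) +
          algebraMap A (A ⊗[K] A) (a 1) * (-diagEq (X.x 1)) - z ∈ J ^ 2 := h2
      rw [sq] at h3
      rw [Submodule.mem_sup]
      refine ⟨_, Ideal.mem_span_pair.2 ⟨-algebraMap A (A ⊗[K] A) (a 0),
        -algebraMap A (A ⊗[K] A) (a 1), rfl⟩, _, neg_mem h3, ?_⟩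
      ring)
  exact ⟨e, he, fun z hz => h (Submodule.smul_mem_pointwise_smul _ _ _ hz)⟩

lemma sub_comm_mem (r : A ⊗[K] A) :
    r - Algebra.TensorProduct.comm K A A r ∈ KaehlerDifferential.ideal K A := by
  rw [KaehlerDifferential.ideal, RingHom.mem_ker]
  rw [map_sub, sub_eq_zero]
  induction r with
  | zero => simp
  | add x y hx hy => rw [map_add, map_add, map_add, hx, hy]
  | tmul x y => simp [mul_comm]

/-- The coordinate differences form a regular sequence on every flat algebra over `A ⊗ A`. -/
lemma Coordinates.exists_flat [Algebra.Smooth K A] (X : Coordinates K A) :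
    ∃ φ : MvPolynomial (Fin 2) A →+* A ⊗[K] A, φ.Flat ∧
      ∀ i, φ (MvPolynomial.C (X.x i) - MvPolynomial.X i) = diagEq (X.x i) := by
  refine ⟨(Algebra.TensorProduct.lTensor (S := K) A (MvPolynomial.aeval X.x : _ →ₐ[K] A)).toRingHom.comp
    (MvPolynomial.algebraTensorAlgEquiv K A).symm.toRingEquiv.toRingHom,
    RingHom.Flat.comp (.of_bijective (RingEquiv.bijective _)) (X.flat.lTensor A), fun i => ?_⟩
  rw [map_sub]
  have h1 : (MvPolynomial.algebraTensorAlgEquiv K A).symm (MvPolynomial.C (X.x i)) =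
      (X.x i) ⊗ₜ[K] (1 : MvPolynomial (Fin 2) K) :=
    (MvPolynomial.algebraTensorAlgEquiv K A).symm.commutes _
  have h2 := MvPolynomial.algebraTensorAlgEquiv_symm_X K A i
  simp only [RingHom.comp_apply]
  congr 1
  · refine (congrArg _ h1).trans ?_
    exact (Algebra.TensorProduct.map_tmul _ _ _ _).trans (by simp)
  · refine (congrArg _ h2).trans ?_
    exact (Algebra.TensorProduct.map_tmul _ _ _ _).trans (by simp)

/-- A homomorphism from `A` to a double cover and its conjugate give a homomorphism from
`A ⊗ A`. -/
def pairHom {B : Type} [CommRing B] [Algebra K B] {f : B} (ν : A →ₐ[K] Dbl B f) :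
    A ⊗[K] A →ₐ[K] Dbl B f :=
  Algebra.TensorProduct.lift ν
    ({ (Dbl.conj f).comp (ν : A →+* Dbl B f) with
        commutes' k := by
          change Dbl.conj f (ν _) = _
          rw [AlgHom.commutes, IsScalarTower.algebraMap_apply K B (Dbl B f)]
          exact congr($(Dbl.conj_comp_algebraMap f) _) } : A →ₐ[K] Dbl B f)
    (fun _ _ => Commute.all _ _)

variable {B : Type} [CommRing B] [Algebra K B] {f : B} (ν : A →ₐ[K] Dbl B f)

lemma pairHom_tmul (a b : A) : pairHom ν (a ⊗ₜ b) = ν a * Dbl.conj f (ν b) :=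
  Algebra.TensorProduct.lift_tmul ..

lemma pairHom_diagEq (a : A) : pairHom ν (diagEq a) = ⟨0, 2 * (ν a).im⟩ := by
  rw [diagEq, map_sub, pairHom_tmul, pairHom_tmul]
  ext <;> simp [two_mul]

lemma pairHom_comp {C : Type} [CommRing C] [Algebra K C] {f' : C} (m : Dbl B f →ₐ[K] Dbl C f')
    (hm : (m : Dbl B f →+* Dbl C f').comp (Dbl.conj f) = (Dbl.conj f').comp m) (z : A ⊗[K] A) :
    pairHom (m.comp ν) z = m (pairHom ν z) := by
  induction z with
  | zero => simp
  | add x y hx hy => rw [map_add, map_add, map_add, hx, hy]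
  | tmul x y =>
    rw [pairHom_tmul, pairHom_tmul, map_mul]
    exact congrArg (m (ν x) * ·) congr($hm (ν y)).symm

/-- The pair of `ν` and its conjugate is equivariant for the interchange of the factors. -/
lemma pairHom_comp_comm : (pairHom ν : A ⊗[K] A →+* Dbl B f).comp
    ((Algebra.TensorProduct.comm K A A).toAlgHom : A ⊗[K] A →+* A ⊗[K] A) =
      (Dbl.conj f).comp (pairHom ν : A ⊗[K] A →+* Dbl B f) := by
  refine RingHom.ext fun x => ?_
  change pairHom ν (Algebra.TensorProduct.comm K A A x) = Dbl.conj f (pairHom ν x)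
  induction x with
  | zero => simp
  | add x y hx hy => rw [map_add, map_add, map_add, map_add, hx, hy]
  | tmul x y =>
    rw [Algebra.TensorProduct.comm_tmul, pairHom_tmul, pairHom_tmul, map_mul, Dbl.conj_conj,
      mul_comm]

/-- The image of the ideal of the diagonal lies in the ideal generated by `√f`. -/
lemma re_pairHom_of_mem {z : A ⊗[K] A} (hz : z ∈ KaehlerDifferential.ideal K A) :
    (pairHom ν z).re ∈ Ideal.span {f} := by
  rw [← KaehlerDifferential.span_range_eq_ideal] at hz
  induction hz using Submodule.span_induction with
  | zero => simp
  | add x y _ _ hx hy => rw [map_add, QuadraticAlgebra.re_add]; exact add_mem hx hy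
  | mem x hx =>
    obtain ⟨a, rfl⟩ := hx
    have : (1 ⊗ₜ a - a ⊗ₜ 1 : A ⊗[K] A) = - diagEq a := by simp [diagEq]
    simp [this, pairHom_diagEq]
  | smul r x hxm hx =>
    rw [smul_eq_mul, map_mul, QuadraticAlgebra.re_mul]
    refine add_mem (Ideal.mul_mem_left _ _ hx) ?_
    rw [mul_assoc]
    exact Ideal.mul_mem_right _ _ (Ideal.mem_span_singleton_self f)

/-- The double cover that is universal among the homomorphisms `ν : A → B[√f]` for which
`√f` divides the difference of the first coordinate and its conjugate exactly once; the universal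
one is only reached where a function `g ≡ 1 mod f` is invertible, which includes the zeros
of `f`. -/
lemma Coordinates.exists_universal_double [Algebra.Smooth K A] (h2 : IsUnit (2 : K))
    (X : Coordinates K A) :
    ∃ (D : Type) (_ : CommRing D) (_ : Algebra K D) (fD : D) (_ : fD ∈ D⁰)
      (μ : A →ₐ[K] Dbl D fD), IsUnit (μ (X.x 0)).im ∧
      ∀ (B : Type) [CommRing B] [Algebra K B] (f : B) (ν : A →ₐ[K] Dbl B f),
        IsUnit (ν (X.x 0)).im → ∃ g : B, g - 1 ∈ Ideal.span {f} ∧ ∀ (C : Type) [CommRing C]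
          [Algebra K C] (π : B →ₐ[K] C) (hπ : (π : B →+* C) f = 1 * 1 * π f), IsUnit (π g) →
          ∃ (χ : D →ₐ[K] C) (d : C) (_ : IsUnit d) (hd : (χ : D →+* C) fD = d * d * π f),
            (Dbl.map (χ : D →+* C) d (π f) hd).comp (μ : A →+* Dbl D fD) =
              (Dbl.map (π : B →+* C) 1 (π f) hπ).comp (ν : A →+* Dbl B f) := by
  obtain ⟨e, he, heJ⟩ := X.exists_mul_mem_span
  let τ : A ⊗[K] A →ₐ[K] A ⊗[K] A := (Algebra.TensorProduct.comm K A A).toAlgHom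
  have hττ (z) : τ (τ z) = z := (Algebra.TensorProduct.comm K A A).symm_apply_apply z
  -- the neighbourhood `e ≠ 0` of the diagonal is made invariant
  let e₀ := e * τ e
  have hτe₀ : τ e₀ = e₀ := by rw [map_mul, hττ, mul_comm]
  let R := Localization.Away e₀
  let j : A ⊗[K] A →ₐ[K] R := Algebra.algHom K _ R
  have hju : IsUnit (j e₀) := IsLocalization.Away.algebraMap_isUnit e₀
  have hpow {P : Type} [CommRing P] [Algebra K P] {F : A ⊗[K] A →ₐ[K] P} (hF : IsUnit (F e₀))
      (y : Submonoid.powers e₀) : IsUnit (F y) := by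
    obtain ⟨_, n, rfl⟩ := y
    rw [map_pow]; exact hF.pow n
  let τ' : R →ₐ[K] R := IsLocalization.liftAlgHom (M := Submonoid.powers e₀) (f := j.comp τ)
    (hpow (by rw [AlgHom.comp_apply, hτe₀]; exact hju))
  have hτ'j (z) : τ' (j z) = j (τ z) := IsLocalization.lift_eq _ _
  have hsurj (r : R) : ∃ z, ∃ w : R, IsUnit w ∧ τ' w = w ∧ w * r = j z := by
    obtain ⟨n, z, hz⟩ := IsLocalization.Away.surj e₀ r
    refine ⟨z, j e₀ ^ n, hju.pow n, by rw [map_pow, hτ'j, hτe₀], (mul_comm _ _).trans hz⟩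
  let u : R := j (diagEq (X.x 0))
  let v : R := j (diagEq (X.x 1))
  have hodd (i) : τ' (j (diagEq (X.x i))) = - j (diagEq (X.x i)) := by
    rw [hτ'j, ← map_neg]; exact congrArg j (comm_diagEq _)
  have hinv (r : R) : τ' (τ' r) = r := by
    obtain ⟨z, w, hw, hw', h⟩ := hsurj r
    have := congr(τ' (τ' $h))
    rw [map_mul, map_mul, hw', hw', hτ'j, hτ'j, hττ, ← h] at this
    exact hw.mul_right_injective this
  have hsub (r : R) : r - τ' r ∈ Ideal.span {u, v} := by
    obtain ⟨z, w, hw, hw', h⟩ := hsurj r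
    have h3 : j (e * (z - τ z)) ∈ Ideal.span {u, v} := by
      have := Ideal.mem_map_of_mem j (heJ _ (sub_comm_mem z))
      rwa [Ideal.map_span, Set.image_pair] at this
    have h4 := congr(τ' $h)
    rw [map_mul, hw', hτ'j] at h4
    have h5 : j e * w * (r - τ' r) ∈ Ideal.span {u, v} := by
      rw [map_mul, map_sub, ← h, ← h4] at h3
      convert h3 using 1
      ring
    have hje : IsUnit (j e) := isUnit_of_mul_isUnit_left (by rw [← map_mul]; exact hju)
    exact (Ideal.unit_mul_mem_iff_mem _ (hje.mul hw)).1 h5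
  obtain ⟨φ, hφ, hφ'⟩ := X.exists_flat
  have hflat : ((j : A ⊗[K] A →+* R).comp φ).Flat :=
    hφ.comp (RingHom.flat_algebraMap_iff.2 (IsLocalization.flat _ (Submonoid.powers e₀)))
  let : Algebra (MvPolynomial (Fin 2) A) R := ((j : A ⊗[K] A →+* R).comp φ).toAlgebra
  have : Module.Flat (MvPolynomial (Fin 2) A) R := hflat
  have hmap (i) : algebraMap (MvPolynomial (Fin 2) A) R
      (MvPolynomial.C (X.x i) - MvPolynomial.X i) = j (diagEq (X.x i)) := congrArg j (hφ' i)
  have hur (a : R) (ha : u * a = 0) : a = 0 :=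
    eq_zero_of_flat (mvPolynomial_regular_fst (X.x 0)) (by rw [hmap]; exact ha)
  have hvr (a b : R) (ha : v * a = u * b) : a ∈ Ideal.span {u} := by
    have := mem_span_of_flat (T := R) (mvPolynomial_regular_snd (X.x 0) (X.x 1)) (r := a) (r' := b)
      (by rw [hmap, hmap]; exact ha)
    rwa [hmap] at this
  obtain ⟨D, _, _, fD, hfD, μ, hμ, hμu, huniv⟩ :=
    exists_double h2 hinv (hodd 0) (hodd 1) hsub hur hvr
  let ι₁ : A →ₐ[K] R := j.comp Algebra.TensorProduct.includeLeft
  let ι₂ : A →ₐ[K] R := j.comp Algebra.TensorProduct.includeRight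
  have hι (a) : j (diagEq a) = ι₁ a - ι₂ a := by
    simp [diagEq, ι₁, ι₂]
  have hι' (a) : τ' (ι₁ a) = ι₂ a := by
    simp only [ι₁, ι₂, AlgHom.comp_apply, hτ'j]; congr 1
  refine ⟨D, inferInstance, inferInstance, fD, hfD, μ.comp ι₁, ?_, fun B _ _ f ν hν => ?_⟩
  · have h3 := congr(($hμu).im)
    have h4 : μ (ι₂ (X.x 0)) = Dbl.conj fD (μ (ι₁ (X.x 0))) := by
      rw [← hι']; exact congr($hμ _)
    change (μ (j _)).im = 1 at h3
    rw [hι, map_sub, h4, QuadraticAlgebra.im_sub, Dbl.im_conj] at h3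
    exact IsUnit.of_mul_eq_one 2 (by rw [AlgHom.comp_apply]; linear_combination h3)
  · -- the norm of the image of `e`
    have hn : pairHom ν e₀ = algebraMap B _ ((pairHom ν e).re * (pairHom ν e).re -
        f * (pairHom ν e).im * (pairHom ν e).im) := by
      have h3 : pairHom ν (τ e) = Dbl.conj f (pairHom ν e) := congr($(pairHom_comp_comm ν) e)
      rw [map_mul, h3]
      ext <;> simp <;> ring
    refine ⟨(pairHom ν e).re * (pairHom ν e).re - f * (pairHom ν e).im * (pairHom ν e).im,
      ?_, fun C _ _ π hπ hg => ?_⟩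
    · obtain ⟨c, hc⟩ := Ideal.mem_span_singleton'.1 (re_pairHom_of_mem ν he)
      rw [map_sub, map_one, QuadraticAlgebra.re_sub, QuadraticAlgebra.re_one] at hc
      refine Ideal.mem_span_singleton'.2
        ⟨c * ((pairHom ν e).re + 1) - (pairHom ν e).im * (pairHom ν e).im, ?_⟩
      linear_combination ((pairHom ν e).re + 1) * hc
    · let m : Dbl B f →ₐ[K] Dbl C (π f) :=
        { Dbl.map (π : B →+* C) 1 (π f) hπ with
          commutes' := fun k => by
            change Dbl.map (π : B →+* C) 1 (π f) hπ (algebraMap B _ (algebraMap K B k)) =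
              algebraMap C _ (algebraMap K C k)
            rw [← π.commutes k]
            exact congr($(Dbl.map_comp_algebraMap (π : B →+* C) 1 (π f) hπ) (algebraMap K B k)) }
      have hm : (m : Dbl B f →+* Dbl C (π f)).comp (Dbl.conj f) = (Dbl.conj (π f)).comp m :=
        Dbl.map_comp_conj (π : B →+* C) 1 (π f) hπ
      let ν' : A →ₐ[K] Dbl C (π f) := m.comp ν
      have hν' : IsUnit (ν' (X.x 0)).im := by
        have : (ν' (X.x 0)).im = π (ν (X.x 0)).im * 1 := Dbl.im_map (π : B →+* C) 1 (π f) hπ _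
        rw [this, mul_one]; exact hν.map π
      have hn' : IsUnit (pairHom ν' e₀) := by
        rw [pairHom_comp ν m hm, hn]
        have hma (b : B) : m (algebraMap B _ b) = algebraMap C _ (π b) :=
          congr($(Dbl.map_comp_algebraMap (π : B →+* C) 1 (π f) hπ) b)
        rw [hma]; exact hg.map _
      let ρ : R →ₐ[K] Dbl C (π f) := IsLocalization.liftAlgHom (M := Submonoid.powers e₀)
        (f := pairHom ν') (hpow hn')
      have hρj (z) : ρ (j z) = pairHom ν' z := IsLocalization.lift_eq _ _
      have hρ : (ρ : R →+* Dbl C (π f)).comp (τ' : R →+* R) =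
          (Dbl.conj (π f)).comp (ρ : R →+* Dbl C (π f)) := by
        apply IsLocalization.ringHom_ext (Submonoid.powers e₀)
        refine RingHom.ext fun z => ?_
        change ρ (τ' (j z)) = Dbl.conj (π f) (ρ (j z))
        rw [hτ'j, hρj, hρj]
        exact congr($(pairHom_comp_comm ν') z)
      have h2C : IsUnit (2 : C) := by simpa only [map_ofNat] using h2.map (algebraMap K C)
      have hρu : IsUnit (ρ u).im := by
        rw [hρj, pairHom_diagEq]; exact h2C.mul hν'
      obtain ⟨χ, hd, hχ⟩ := huniv C (π f) ρ hρ hρu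
      refine ⟨χ, _, hρu, hd, ?_⟩
      ext a : 1
      refine congr($hχ (ι₁ a)).trans ((hρj _).trans ((pairHom_tmul ν' a 1).trans ?_))
      rw [map_one, map_one, mul_one]; rfl

end UniversalDouble

end

/-! ### Morphisms on affine charts -/

section Spec

variable {B C D : Type} [CommRing B] [CommRing C] [CommRing D] {T Y : Scheme.{0}}

/-- The morphism of spectra of a ring homomorphism. -/
abbrev sp (χ : B →+* C) : Spec (.of C) ⟶ Spec (.of B) := Spec.map (CommRingCat.ofHom χ)

lemma sp_comp_sp (χ : B →+* C) (ψ : C →+* D) : sp ψ ≫ sp χ = sp (ψ.comp χ) :=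
  (Spec.map_comp _ _).symm

lemma sp_comp_sp_assoc (χ : B →+* C) (ψ : C →+* D) (f : Spec (.of B) ⟶ T) :
    sp ψ ≫ sp χ ≫ f = sp (ψ.comp χ) ≫ f := by
  rw [← Category.assoc, sp_comp_sp]

lemma sp_id : sp (RingHom.id B) = 𝟙 _ := Spec.map_id _

lemma exists_sp (g : Spec (.of C) ⟶ Spec (.of B)) : ∃ χ : B →+* C, sp χ = g :=
  ⟨(Spec.preimage g).hom, Spec.map_preimage g⟩

lemma sp_injective {χ ψ : B →+* C} (h : sp χ = sp ψ) : χ = ψ :=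
  congrArg CommRingCat.Hom.hom (Spec.map_injective h)

/-- The inclusion of the open subscheme where `g` is invertible. -/
abbrev away (g : B) : Spec (.of (Localization.Away g)) ⟶ Spec (.of B) :=
  sp (algebraMap B (Localization.Away g))

instance (g : B) : IsOpenImmersion (away g) := by
  exact IsOpenImmersion.of_isLocalization g

lemma range_away (g : B) :
    Set.range (away g) = (PrimeSpectrum.basicOpen g : Set (PrimeSpectrum B)) :=
  PrimeSpectrum.localization_away_comap_range (Localization.Away g) g

lemma exists_chart (x : T) : ∃ (B : Type) (_ : CommRing B) (v : Spec (.of B) ⟶ T),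
    IsOpenImmersion v ∧ x ∈ Set.range v := by
  obtain ⟨R, v, hv, hx, -⟩ := Scheme.exists_affine_mem_range_and_range_subset (X := T) (U := ⊤) (x := x)
    trivial
  exact ⟨R, inferInstance, v, hv, hx⟩

lemma exists_basicOpen_le {t : Spec (.of B)} {W : (Spec (.of B)).Opens} (h : t ∈ W) :
    ∃ g : B, t ∈ PrimeSpectrum.basicOpen g ∧ Set.range (away g) ⊆ W := by
  obtain ⟨_, ⟨g, rfl⟩, h1, h2⟩ :=
    PrimeSpectrum.isTopologicalBasis_basic_opens.exists_subset_of_mem_open h W.2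
  exact ⟨g, h1, by rw [range_away]; exact h2⟩

lemma mem_range_away {t : Spec (.of B)} {g : B} : t ∈ Set.range (away g) ↔ g ∉ t.asIdeal := by
  rw [range_away]; rfl

/-- Equality of morphisms may be checked on affine charts. -/
lemma hom_ext_of_charts {f g : T ⟶ Y} (H : ∀ x : T, ∃ (B : Type) (_ : CommRing B)
    (v : Spec (.of B) ⟶ T), IsOpenImmersion v ∧ x ∈ Set.range v ∧ v ≫ f = v ≫ g) : f = g := by
  refine Scheme.hom_ext_of_forall f g fun x => ?_
  obtain ⟨B, _, v, _, hx, h⟩ := H x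
  refine ⟨v.opensRange, hx, ?_⟩
  rw [← cancel_epi v.isoOpensRange.hom]
  simpa using h

/-- A morphism whose image lies in that of an affine chart factors through the chart. -/
lemma exists_sp_comp {v : Spec (.of B) ⟶ T} [IsOpenImmersion v] {w : Spec (.of C) ⟶ T}
    (h : Set.range w ⊆ Set.range v) : ∃ χ : B →+* C, sp χ ≫ v = w := by
  obtain ⟨χ, hχ⟩ := exists_sp (IsOpenImmersion.lift v w h)
  exact ⟨χ, by rw [hχ, IsOpenImmersion.lift_fac]⟩

/-- A morphism from an affine scheme into an affine open is a ring homomorphism. -/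
lemma exists_sp_comp_fromSpec {U : T.Opens} (hU : IsAffineOpen U) {w : Spec (.of C) ⟶ T}
    (h : ∀ x, w x ∈ U) : ∃ ρ : Γ(T, U) →+* C, sp ρ ≫ hU.fromSpec = w :=
  exists_sp_comp (v := hU.fromSpec) (by
    rw [IsAffineOpen.range_fromSpec]
    exact Set.range_subset_iff.2 h)

lemma sp_comp_fromSpec_injective {U : T.Opens} (hU : IsAffineOpen U) {ρ ρ' : Γ(T, U) →+* C}
    (h : sp ρ ≫ hU.fromSpec = sp ρ' ≫ hU.fromSpec) : ρ = ρ' :=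
  sp_injective ((cancel_mono hU.fromSpec).1 h)

lemma sp_comp_fromSpec_mem {U : T.Opens} (hU : IsAffineOpen U) (ρ : Γ(T, U) →+* C)
    (x : Spec (.of C)) : (sp ρ ≫ hU.fromSpec) x ∈ U := by
  have : (sp ρ ≫ hU.fromSpec) x = hU.fromSpec (sp ρ x) := Scheme.Hom.comp_apply _ _ _
  rw [this, ← SetLike.mem_coe, ← hU.range_fromSpec]
  exact ⟨_, rfl⟩

/-- Morphisms that are locally determined by a property glue. -/
lemma exists_hom_of_local (P : ∀ (B : Type) [CommRing B], (Spec (.of B) ⟶ T) →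
      (Spec (.of B) ⟶ Y) → Prop)
    (hres : ∀ (B C : Type) [CommRing B] [CommRing C] (χ : B →+* C) (v : Spec (.of B) ⟶ T)
      (k : Spec (.of B) ⟶ Y), IsOpenImmersion v → IsOpenImmersion (sp χ) → P B v k →
        P C (sp χ ≫ v) (sp χ ≫ k))
    (huniq : ∀ (B : Type) [CommRing B] (v : Spec (.of B) ⟶ T) (k k' : Spec (.of B) ⟶ Y),
      IsOpenImmersion v → P B v k → P B v k' → k = k')
    (hloc : ∀ x : T, ∃ (B : Type) (_ : CommRing B) (v : Spec (.of B) ⟶ T) (k : Spec (.of B) ⟶ Y),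
      IsOpenImmersion v ∧ x ∈ Set.range v ∧ P B v k) :
    ∃ c : T ⟶ Y, ∀ (B : Type) [CommRing B] (v : Spec (.of B) ⟶ T) (k : Spec (.of B) ⟶ Y),
      IsOpenImmersion v → P B v k → v ≫ c = k := by
  have agree {B B' : Type} [CommRing B] [CommRing B'] {v : Spec (.of B) ⟶ T}
      {k : Spec (.of B) ⟶ Y} {v' : Spec (.of B') ⟶ T} {k' : Spec (.of B') ⟶ Y}
      (hv : IsOpenImmersion v) (hv' : IsOpenImmersion v') (h : P B v k) (h' : P B' v' k') :
      pullback.fst v v' ≫ k = pullback.snd v v' ≫ k' := by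
    refine hom_ext_of_charts fun x => ?_
    obtain ⟨C, _, w, hw, hx⟩ := exists_chart x
    refine ⟨C, _, w, hw, hx, ?_⟩
    obtain ⟨χ, hχ⟩ := exists_sp (w ≫ pullback.fst v v')
    obtain ⟨χ', hχ'⟩ := exists_sp (w ≫ pullback.snd v v')
    have h1 : IsOpenImmersion (sp χ) := by rw [hχ]; infer_instance
    have h2 : IsOpenImmersion (sp χ') := by rw [hχ']; infer_instance
    have h3 := hres _ _ χ v k hv h1 h
    have h4 := hres _ _ χ' v' k' hv' h2 h'
    have h5 : sp χ ≫ v = sp χ' ≫ v' := by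
      rw [hχ, hχ', Category.assoc, Category.assoc, pullback.condition]
    rw [h5] at h3
    rw [← Category.assoc, ← Category.assoc, ← hχ, ← hχ']
    exact huniq _ _ _ _ inferInstance h3 h4
  choose B hB v k hv hx hP using hloc
  let 𝒰 : T.OpenCover := {
    I₀ := T, X x := Spec (.of (B x)), f x := v x
    mem₀ := by
      rw [Scheme.presieve₀_mem_precoverage_iff]
      exact ⟨fun x => ⟨x, hx x⟩, hv⟩ }
  refine ⟨𝒰.glueMorphisms k fun x y => agree (hv x) (hv y) (hP x) (hP y), fun C _ w m hw h => ?_⟩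
  set c := 𝒰.glueMorphisms k fun x y => agree (hv x) (hv y) (hP x) (hP y)
  have hc (x) : v x ≫ c = k x := 𝒰.ι_glueMorphisms k _ x
  refine Scheme.Cover.hom_ext (𝒰.pullback₁ w) _ _ fun (x : T) => ?_
  have h1 : pullback.fst w (v x) ≫ w ≫ c = pullback.fst w (v x) ≫ m := by
    rw [pullback.condition_assoc]
    exact (congrArg (pullback.snd w (v x) ≫ ·) (hc x)).trans (agree hw (hv x) h (hP x)).symm
  exact h1

end Spec

/-! ### Ideal sheaves on affine charts -/

section Ideals

variable {B C D : Type} [CommRing B] [CommRing C] [CommRing D] {T Y : Scheme.{0}}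

lemma ker_eq_comap_of_isPullback {X Y Z W : Scheme.{0}} {i : X ⟶ Y} {g : X ⟶ Z} {f : Y ⟶ W}
    {j : Z ⟶ W} [IsClosedImmersion j] (h : IsPullback i g f j) : i.ker = j.ker.comap f := by
  rw [← Scheme.IdealSheafData.ker_fst_of_isClosedImmersion, ← h.isoPullback_hom_fst,
    Scheme.Hom.ker_comp_of_isIso]

lemma isClosedImmersion_sp {χ : B →+* C} (h : Function.Surjective χ) :
    IsClosedImmersion (sp χ) := IsClosedImmersion.spec_of_surjective (CommRingCat.ofHom χ) h

/-- The ideal sheaf on the spectrum of a ring that is given by an ideal. -/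
def specIdeal (𝔞 : Ideal B) : (Spec (.of B)).IdealSheafData := (sp (Ideal.Quotient.mk 𝔞)).ker

lemma comap_specIdeal (𝔞 : Ideal B) (χ : B →+* C) :
    (specIdeal 𝔞).comap (sp χ) = specIdeal (𝔞.map χ) := by
  have := isClosedImmersion_sp (Ideal.Quotient.mk_surjective (I := 𝔞))
  refine (ker_eq_comap_of_isPullback (g := sp (Ideal.quotientMap (𝔞.map χ) χ Ideal.le_comap_map))
    (IsPullback.flip (isPullback_SpecMap_of_isPushout (CommRingCat.ofHom (Ideal.Quotient.mk 𝔞))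
      (CommRingCat.ofHom χ) (CommRingCat.ofHom _) (CommRingCat.ofHom _) ?_))).symm
  refine ⟨⟨by ext; simp⟩, ⟨PushoutCocone.isColimitAux' _ fun c => ?_⟩⟩
  let a : (B ⧸ 𝔞) →+* c.pt := c.inl.hom
  let b : C →+* c.pt := c.inr.hom
  have hab (x : B) : a (Ideal.Quotient.mk 𝔞 x) = b (χ x) := congr($(c.condition).hom x)
  have hb : ∀ x ∈ 𝔞.map χ, b x = 0 := by
    change 𝔞.map χ ≤ RingHom.ker b
    rw [Ideal.map_le_iff_le_comap]
    intro x hx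
    change b (χ x) = 0
    rw [← hab, Ideal.Quotient.eq_zero_iff_mem.2 hx, map_zero]
  refine ⟨CommRingCat.ofHom (Ideal.Quotient.lift _ b hb), ?_, ?_, ?_⟩
  · refine CommRingCat.hom_ext (Ideal.Quotient.ringHom_ext (RingHom.ext fun x => ?_))
    exact (hab x).symm
  · ext x; rfl
  · intro m _ hm
    refine CommRingCat.hom_ext (Ideal.Quotient.ringHom_ext (RingHom.ext fun x => ?_))
    exact congr($(hm).hom x)

lemma le_of_specIdeal_le {𝔞 𝔟 : Ideal B} (h : specIdeal 𝔞 ≤ specIdeal 𝔟) : 𝔞 ≤ 𝔟 := by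
  have := isClosedImmersion_sp (Ideal.Quotient.mk_surjective (I := 𝔞))
  have h' : (sp (Ideal.Quotient.mk 𝔞)).ker ≤ (sp (Ideal.Quotient.mk 𝔟)).ker := h
  obtain ⟨χ, hχ⟩ := exists_sp (IsClosedImmersion.lift (sp (Ideal.Quotient.mk 𝔞))
    (sp (Ideal.Quotient.mk 𝔟)) h')
  have h1 : χ.comp (Ideal.Quotient.mk 𝔞) = Ideal.Quotient.mk 𝔟 :=
    sp_injective (by rw [← sp_comp_sp, hχ, IsClosedImmersion.lift_fac])
  intro x hx
  rw [← Ideal.Quotient.eq_zero_iff_mem, ← h1, RingHom.comp_apply,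
    Ideal.Quotient.eq_zero_iff_mem.2 hx, map_zero]

lemma specIdeal_injective {𝔞 𝔟 : Ideal B} (h : specIdeal 𝔞 = specIdeal 𝔟) : 𝔞 = 𝔟 :=
  le_antisymm (le_of_specIdeal_le h.le) (le_of_specIdeal_le h.ge)

lemma comap_fromSpec (I : Y.IdealSheafData) {U : Y.Opens} (hU : IsAffineOpen U) :
    I.comap hU.fromSpec = specIdeal (I.ideal ⟨U, hU⟩) := by
  let φ : Spec (.of (Γ(Y, U) ⧸ I.ideal ⟨U, hU⟩)) ⟶ I.subscheme := I.subschemeCover.f ⟨U, hU⟩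
  have : IsOpenImmersion φ := I.subschemeCover.openCover.map_prop ⟨U, hU⟩
  have hφ : φ.opensRange = I.subschemeι ⁻¹ᵁ U := I.opensRange_subschemeCover_map ⟨U, hU⟩
  have h : IsPullback (sp (Ideal.Quotient.mk (I.ideal ⟨U, hU⟩))) φ hU.fromSpec I.subschemeι := by
    refine IsOpenImmersion.isPullback _ _ _ _
      ((I.subschemeCover_map_subschemeι ⟨U, hU⟩).trans (I.glueDataObjι_ι ⟨U, hU⟩)) ?_
    rw [hφ, IsAffineOpen.opensRange_fromSpec]
  rw [specIdeal, ker_eq_comap_of_isPullback h, Scheme.IdealSheafData.ker_subschemeι]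

lemma comap_sp_fromSpec (I : Y.IdealSheafData) {U : Y.Opens} (hU : IsAffineOpen U)
    (ρ : Γ(Y, U) →+* C) :
    I.comap (sp ρ ≫ hU.fromSpec) = specIdeal ((I.ideal ⟨U, hU⟩).map ρ) := by
  rw [Scheme.IdealSheafData.comap_comp, comap_fromSpec]
  exact comap_specIdeal _ _

lemma IsInvertibleIdeal.exists_chart {J : T.IdealSheafData} (h : IsInvertibleIdeal J) (x : T) :
    ∃ (B : Type) (_ : CommRing B) (v : Spec (.of B) ⟶ T) (f : B), IsOpenImmersion v ∧
      x ∈ Set.range v ∧ f ∈ B⁰ ∧ J.comap v = specIdeal (Ideal.span {f}) := by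
  obtain ⟨⟨U, hU⟩, hx, f, hf, hJ⟩ := h x
  exact ⟨_, _, IsAffineOpen.fromSpec hU, f, IsAffineOpen.isOpenImmersion_fromSpec hU, by
    rwa [IsAffineOpen.range_fromSpec hU], hf, by rw [← hJ]; exact comap_fromSpec J hU⟩

lemma isInvertibleIdeal_of_charts {J : T.IdealSheafData}
    (h : ∀ x, ∃ (B : Type) (_ : CommRing B) (v : Spec (.of B) ⟶ T) (f : B), IsOpenImmersion v ∧
      x ∈ Set.range v ∧ f ∈ B⁰ ∧ J.comap v = specIdeal (Ideal.span {f})) :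
    IsInvertibleIdeal J := by
  intro x
  obtain ⟨B, _, v, f, hv, hx, hf, hJ⟩ := h x
  have hU : IsAffineOpen v.opensRange := isAffineOpen_opensRange v
  obtain ⟨χ, hχ⟩ := exists_sp_comp (v := hU.fromSpec) (w := v) (by rw [hU.range_fromSpec]; rfl)
  obtain ⟨ψ, hψ⟩ := exists_sp_comp (v := v) (w := hU.fromSpec) (by rw [hU.range_fromSpec]; rfl)
  have h1 : ψ.comp χ = RingHom.id _ := sp_comp_fromSpec_injective hU (by
    rw [← sp_comp_sp, Category.assoc, hχ, hψ, sp_id, Category.id_comp])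
  have h2 : χ.comp ψ = RingHom.id _ := sp_injective ((cancel_mono v).1 (by
    rw [← sp_comp_sp, Category.assoc, hψ, hχ, sp_id, Category.id_comp]))
  have h3 : (J.ideal ⟨_, hU⟩).map χ = Ideal.span {f} := specIdeal_injective
    ((comap_sp_fromSpec J hU χ).symm.trans ((congrArg J.comap hχ).trans hJ))
  refine ⟨⟨_, hU⟩, hx, ψ f, ?_, ?_⟩
  · rw [mem_nonZeroDivisors_iff_right] at hf ⊢
    intro z hz
    have h4 := hf (χ z) (by
      have := congr(χ $hz)
      rwa [map_mul, ← RingHom.comp_apply χ ψ, h2, map_zero] at this)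
    rw [← RingHom.id_apply z, ← h1, RingHom.comp_apply, h4, map_zero]
  · have := congr(Ideal.map ψ $h3)
    rwa [Ideal.map_map, h1, Ideal.map_id, Ideal.map_span, Set.image_singleton] at this

end Ideals

/-! ### Families of pairs of points -/

section Families

variable {B C D : Type} [CommRing B] [CommRing C] [CommRing D] {S H : Scheme.{0}}

/-- The projection of a double cover. -/
abbrev Dbl.proj (f : B) : Spec (.of (Dbl B f)) ⟶ Spec (.of B) := sp (algebraMap B (Dbl B f))

/-- The conjugation of a double cover. -/
abbrev Dbl.conjSpec (f : B) : Spec (.of (Dbl B f)) ⟶ Spec (.of (Dbl B f)) := sp (Dbl.conj f)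

lemma Dbl.conjSpec_proj (f : B) : conjSpec f ≫ proj f = proj f := by
  rw [sp_comp_sp, Dbl.conj_comp_algebraMap]

lemma Dbl.flat_surjective_proj (f : B) : Flat (proj f) ∧ Surjective (proj f) := by
  refine (flat_and_surjective_SpecMap_iff _).2 ?_
  change (algebraMap B (Dbl B f)).FaithfullyFlat
  rw [RingHom.faithfullyFlat_algebraMap_iff]
  cases subsingleton_or_nontrivial B
  · exact ⟨fun m hm => (hm.ne_top (Subsingleton.elim _ _)).elim⟩
  · infer_instance

instance (f : B) : Epi (Dbl.proj f) := by
  obtain ⟨_, _⟩ := Dbl.flat_surjective_proj f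
  exact Flat.epi_of_flat_of_surjective _

instance (f : B) : IsFinite (Dbl.proj f) := by
  rw [IsFinite.SpecMap_iff]
  exact RingHom.finite_algebraMap.2 inferInstance

/-- The double cover `C[√f']` is the base change of `B[√f]`, where `χ f = d² f'` for a unit `d`. -/
lemma Dbl.isPushout_map {f : B} (χ : B →+* C) (d f' : C) (h : χ f = d * d * f') (hd : IsUnit d) :
    IsPushout (CommRingCat.ofHom (algebraMap B (Dbl B f))) (CommRingCat.ofHom χ)
      (CommRingCat.ofHom (Dbl.map χ d f' h)) (CommRingCat.ofHom (algebraMap C (Dbl C f'))) := by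
  obtain ⟨l, hl⟩ := hd.exists_left_inv
  refine ⟨⟨by rw [← CommRingCat.ofHom_comp, Dbl.map_comp_algebraMap]; rfl⟩,
    ⟨PushoutCocone.isColimitAux' _ fun c => ?_⟩⟩
  let a : Dbl B f →+* c.pt := c.inl.hom
  let b : C →+* c.pt := c.inr.hom
  have hab (x : B) : a (algebraMap _ _ x) = b (χ x) := congr($(c.condition).hom x)
  have hbl : b l * b d = 1 := by rw [← map_mul, hl, map_one]
  have he : b l * a (Dbl.root f) * (b l * a (Dbl.root f)) = b f' := by
    have h1 : a (Dbl.root f) * a (Dbl.root f) = b d * b d * b f' := by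
      rw [← map_mul, Dbl.root_mul_root, hab, h, map_mul, map_mul]
    linear_combination (b l * b l) * h1 + b f' * (b l * b d + 1) * hbl
  let e : Dbl C f' →+* c.pt := Dbl.eval b _ he
  have heb (x : C) : e (algebraMap _ _ x) = b x := Dbl.eval_algebraMap b _ he x
  have her : e (Dbl.root f') = b l * a (Dbl.root f) := Dbl.eval_root b _ he
  have hm : Dbl.map χ d f' h (Dbl.root f) = algebraMap C _ d * Dbl.root f' := Dbl.eval_root ..
  refine ⟨CommRingCat.ofHom e, ?_, ?_, ?_⟩
  · refine CommRingCat.hom_ext (Dbl.hom_ext (RingHom.ext fun x => ?_) ?_)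
    · change e (((Dbl.map χ d f' h).comp (algebraMap _ _)) x) = a (algebraMap _ _ x)
      rw [hab, Dbl.map_comp_algebraMap, RingHom.comp_apply, heb]
    · change e (Dbl.map χ d f' h (Dbl.root f)) = a (Dbl.root f)
      rw [hm, map_mul, heb, her]
      linear_combination a (Dbl.root f) * hbl
  · exact CommRingCat.hom_ext (RingHom.ext heb)
  · intro m hm1 hm2
    let m' : Dbl C f' →+* c.pt := m.hom
    have h1 (x : C) : m' (algebraMap _ _ x) = b x := congr($(hm2).hom x)
    have h2 (x : Dbl B f) : m' (Dbl.map χ d f' h x) = a x := congr($(hm1).hom x)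
    refine CommRingCat.hom_ext (Dbl.hom_ext (RingHom.ext fun x => ?_) ?_)
    · exact (h1 x).trans (heb x).symm
    · change m' (Dbl.root f') = e (Dbl.root f')
      have h3 := h2 (Dbl.root f)
      rw [hm, map_mul, h1] at h3
      rw [her, ← h3]
      linear_combination -m' (Dbl.root f') * hbl

lemma mono_of_affine {X Y : Scheme.{0}} {f : X ⟶ Y} (h : ∀ (C : Type) [CommRing C]
    (g₁ g₂ : Spec (.of C) ⟶ X), g₁ ≫ f = g₂ ≫ f → g₁ = g₂) : Mono f := by
  refine ⟨fun g₁ g₂ hg => hom_ext_of_charts fun x => ?_⟩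
  obtain ⟨C, _, v, hv, hx⟩ := exists_chart x
  exact ⟨C, _, v, hv, hx, h _ _ _ (by rw [Category.assoc, hg, Category.assoc])⟩

/-- A family, over the spectrum of `B`, of subschemes of length two of `S` that is given by a closed
immersion of a double cover `Spec B[√f]` into `S × Spec B`. Here `t` is the structure morphism of the
base over `ℂ`, `f` is the discriminant, and `j` is the projection of the double cover to `S`, a
morphism over `ℂ` by `w`. As the double cover is finite over the base, it suffices that it is a
monomorphism to `S × Spec B`; this is tested on affine schemes. -/
structure Family (s : S ⟶ Spec (.of ℂ)) (B : Type) [CommRing B] where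
  t : Spec (.of B) ⟶ Spec (.of ℂ)
  f : B
  j : Spec (.of (Dbl B f)) ⟶ S
  w : j ≫ s = Dbl.proj f ≫ t
  mono : ∀ (C : Type) [CommRing C] (g₁ g₂ : Dbl B f →+* C),
    g₁.comp (algebraMap B _) = g₂.comp (algebraMap B _) → sp g₁ ≫ j = sp g₂ ≫ j → g₁ = g₂

namespace Family

variable {s : S ⟶ Spec (.of ℂ)} (F : Family s B)

/-- The embedding of the double cover into `S × Spec B`. -/
def emb : Spec (.of (Dbl B F.f)) ⟶ pullback s F.t := pullback.lift F.j (Dbl.proj F.f) F.w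

@[simp] lemma emb_fst : F.emb ≫ pullback.fst s F.t = F.j := pullback.lift_fst ..
@[simp] lemma emb_snd : F.emb ≫ pullback.snd s F.t = Dbl.proj F.f := pullback.lift_snd ..

instance [IsSeparated s] : IsClosedImmersion F.emb := by
  rw [IsClosedImmersion.iff_isFinite_and_mono]
  constructor
  · have : IsFinite (F.emb ≫ pullback.snd s F.t) := by rw [emb_snd]; infer_instance
    exact MorphismProperty.of_postcomp (W := @IsFinite) (W' := @IsSeparated) F.emb
      (pullback.snd s F.t) inferInstance this
  · refine mono_of_affine fun C _ g₁ g₂ h => ?_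
    obtain ⟨g₁, rfl⟩ := exists_sp g₁
    obtain ⟨g₂, rfl⟩ := exists_sp g₂
    congr 2
    refine F.mono C g₁ g₂ (sp_injective ?_) ?_
    · simpa [sp_comp_sp] using congr($h ≫ pullback.snd s F.t)
    · simpa using congr($h ≫ pullback.fst s F.t)

/-- The base change of a family, with a rescaling of the discriminant by the square of a unit. -/
abbrev map (χ : B →+* C) (d f' : C) (h : χ F.f = d * d * f') (hd : IsUnit d) : Family s C where
  t := sp χ ≫ F.t
  f := f'
  j := sp (Dbl.map χ d f' h) ≫ F.j
  w := by
    rw [Category.assoc, F.w, sp_comp_sp_assoc, sp_comp_sp_assoc, Dbl.map_comp_algebraMap]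
  mono E _ g₁ g₂ h₁ h₂ := by
    rw [sp_comp_sp_assoc, sp_comp_sp_assoc] at h₂
    have h3 := F.mono E _ _ (by
      rw [RingHom.comp_assoc, Dbl.map_comp_algebraMap, RingHom.comp_assoc,
        Dbl.map_comp_algebraMap, ← RingHom.comp_assoc, h₁, RingHom.comp_assoc]) h₂
    refine Dbl.hom_ext h₁ ?_
    have h4 := congr($h3 (Dbl.root F.f))
    have h5 := congr($h₁ d)
    simp only [RingHom.comp_apply, Dbl.map, Dbl.eval_root, map_mul] at h4 h5
    rw [h5] at h4
    exact ((hd.map (algebraMap C (Dbl C f'))).map g₂).mul_right_injective h4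

/-- The base change of a family. -/
abbrev baseChange (χ : B →+* C) : Family s C := F.map χ 1 (χ F.f) (by ring) isUnit_one

/-- The family is the pullback under `v` of the family with ideal sheaf `Z`. -/
def Classify {h : H ⟶ Spec (.of ℂ)} (Z : (pullback s h).IdealSheafData)
    (v : Spec (.of B) ⟶ H) : Prop :=
  ∃ hv : v ≫ h = F.t, Z.comap (idProd s v hv) = F.emb.ker

lemma idProd_fst {T : Scheme.{0}} {t : T ⟶ Spec (.of ℂ)} {h : H ⟶ Spec (.of ℂ)} (v : T ⟶ H)
    (hv : v ≫ h = t) : idProd s v hv ≫ pullback.fst s h = pullback.fst s t := pullback.lift_fst ..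

lemma idProd_snd {T : Scheme.{0}} {t : T ⟶ Spec (.of ℂ)} {h : H ⟶ Spec (.of ℂ)} (v : T ⟶ H)
    (hv : v ≫ h = t) : idProd s v hv ≫ pullback.snd s h = pullback.snd s t ≫ v :=
  pullback.lift_snd ..

lemma idProd_comp {T T' : Scheme.{0}} {t : T ⟶ Spec (.of ℂ)} {t' : T' ⟶ Spec (.of ℂ)}
    {h : H ⟶ Spec (.of ℂ)} (v : T ⟶ H) (hv : v ≫ h = t) (g : T' ⟶ T) (hg : g ≫ t = t')
    (hgv : (g ≫ v) ≫ h = t') : idProd s (g ≫ v) hgv = idProd s g hg ≫ idProd s v hv := by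
  apply pullback.hom_ext
  · rw [Category.assoc, idProd_fst, idProd_fst, idProd_fst]
  · rw [Category.assoc, idProd_snd, idProd_snd, ← Category.assoc (idProd s g hg), idProd_snd,
      Category.assoc]

lemma isPullback_idProd {T : Scheme.{0}} {t : T ⟶ Spec (.of ℂ)} {h : H ⟶ Spec (.of ℂ)} (v : T ⟶ H)
    (hv : v ≫ h = t) :
    IsPullback (idProd s v hv) (pullback.snd s t) (pullback.snd s h) v := by
  subst hv
  refine IsPullback.of_right (t := IsPullback.of_hasPullback s h) ?_ (idProd_snd v rfl)
  rw [idProd_fst]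
  exact IsPullback.of_hasPullback _ _

lemma map_t (χ : B →+* C) (d f' : C) (h : χ F.f = d * d * f') (hd : IsUnit d) :
    sp χ ≫ F.t = (F.map χ d f' h hd).t := rfl

lemma isPullback_emb (χ : B →+* C) (d f' : C) (h : χ F.f = d * d * f')
    (hd : IsUnit d) : IsPullback (F.map χ d f' h hd).emb (sp (Dbl.map χ d f' h))
      (idProd s (sp χ) (F.map_t χ d f' h hd)) F.emb := by
  refine IsPullback.of_right (t := (isPullback_idProd (sp χ) (F.map_t χ d f' h hd)).flip) ?_ ?_
  · rw [emb_snd, emb_snd]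
    exact (isPullback_SpecMap_of_isPushout _ _ _ _ (Dbl.isPushout_map χ d f' h hd)).flip
  · apply pullback.hom_ext
    · rw [Category.assoc, idProd_fst, Category.assoc, emb_fst, emb_fst]
    · rw [Category.assoc, idProd_snd, Category.assoc, emb_snd, ← Category.assoc, emb_snd]
      exact (sp_comp_sp _ _).trans
        ((congrArg sp (Dbl.map_comp_algebraMap χ d f' h).symm).trans (sp_comp_sp _ _).symm)

lemma Classify.map [IsSeparated s] {F : Family s B} {h : H ⟶ Spec (.of ℂ)}
    {Z : (pullback s h).IdealSheafData}
    {v : Spec (.of B) ⟶ H} (hF : F.Classify Z v) (χ : B →+* C) (d f' : C)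
    (hd' : χ F.f = d * d * f') (hd : IsUnit d) : (F.map χ d f' hd' hd).Classify Z (sp χ ≫ v) := by
  obtain ⟨hv, hZ⟩ := hF
  refine ⟨by rw [Category.assoc, hv], ?_⟩
  rw [ker_eq_comap_of_isPullback (F.isPullback_emb χ d f' hd' hd), ← hZ,
    ← Scheme.IdealSheafData.comap_comp]
  exact congrArg Z.comap (idProd_comp v hv (sp χ) (F.map_t χ d f' hd' hd) _)

section PointFamily

instance (f : B) : Module.FinitePresentation B (Dbl B f) :=
  Module.finitePresentation_of_projective B _

/-- A family given by a double cover is a flat family of subschemes of length two. -/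
lemma isPointFamily [IsSeparated s] : IsPointFamily 2 s F.t F.emb.ker := by
  have h : F.emb.toImage ≫ F.emb.ker.subschemeι ≫ pullback.snd s F.t = Dbl.proj F.f := by
    rw [← Category.assoc]
    exact (congrArg (· ≫ pullback.snd s F.t) F.emb.toImage_imageι).trans F.emb_snd
  have hflat := (Dbl.flat_surjective_proj F.f).1
  have hfp : LocallyOfFinitePresentation (Dbl.proj F.f) := by
    rw [LocallyOfFinitePresentation.SpecMap_iff]
    exact RingHom.finitePresentation_algebraMap.2 (.of_finitePresentation _ _)
  have h' : F.emb.ker.subschemeι ≫ pullback.snd s F.t = inv F.emb.toImage ≫ Dbl.proj F.f := by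
    rw [← h, IsIso.inv_hom_id_assoc]
  have h1 : IsFinite (F.emb.ker.subschemeι ≫ pullback.snd s F.t) := by rw [h']; infer_instance
  have h2 : Flat (F.emb.ker.subschemeι ≫ pullback.snd s F.t) := by rw [h']; infer_instance
  refine ⟨h1, h2, by rw [h']; infer_instance, fun x => ?_⟩
  · rw [← Scheme.Hom.finrank_comp_left_of_isIso F.emb.toImage, h]
    have := PrimeSpectrum.nontrivial x
    exact (Scheme.Hom.finrank_SpecMap_algebraMap B (Dbl B F.f) x).trans (by
      rw [Module.rankAtStalk_eq_finrank_of_free]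
      have : Nontrivial B := this
      exact QuadraticAlgebra.finrank_eq_two ..)

end PointFamily

/-- Two families with the same classifying morphism are isomorphic. -/
lemma Classify.exists_hom [IsSeparated s] {F₁ F₂ : Family s B} {h : H ⟶ Spec (.of ℂ)}
    {Z : (pullback s h).IdealSheafData} {v : Spec (.of B) ⟶ H} (h₁ : F₁.Classify Z v)
    (h₂ : F₂.Classify Z v) : F₁.t = F₂.t ∧ ∃ e : Dbl B F₁.f →+* Dbl B F₂.f,
      Function.Bijective e ∧ e.comp (algebraMap B _) = algebraMap B _ ∧ sp e ≫ F₁.j = F₂.j := by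
  obtain ⟨hv, hZ⟩ := h₁
  obtain ⟨hv', hZ'⟩ := h₂
  obtain ⟨t, f₁, j₁, w₁, m₁⟩ := F₁
  obtain ⟨t', f₂, j₂, w₂, m₂⟩ := F₂
  obtain rfl : v ≫ h = t := hv
  obtain rfl : v ≫ h = t' := hv'
  let F₁ : Family s B := ⟨v ≫ h, f₁, j₁, w₁, m₁⟩
  let F₂ : Family s B := ⟨v ≫ h, f₂, j₂, w₂, m₂⟩
  have hk : F₁.emb.ker = F₂.emb.ker := hZ.symm.trans hZ'
  have fac := IsClosedImmersion.lift_fac F₁.emb F₂.emb hk.le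
  have hiso := IsClosedImmersion.isIso_of_ker_eq F₂.emb F₁.emb _ fac hk.symm
  obtain ⟨e, he⟩ := exists_sp (IsClosedImmersion.lift F₁.emb F₂.emb hk.le)
  rw [← he] at fac hiso
  refine ⟨rfl, e, ?_, sp_injective ?_, ?_⟩
  · exact isIso_SpecMap_iff.1 hiso
  · rw [← sp_comp_sp]
    have := congr($fac ≫ pullback.snd s (v ≫ h))
    rw [Category.assoc] at this
    exact (congrArg (sp e ≫ ·) F₁.emb_snd).symm.trans (this.trans F₂.emb_snd)
  · have := congr($fac ≫ pullback.fst s (v ≫ h))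
    rw [Category.assoc] at this
    exact (congrArg (sp e ≫ ·) F₁.emb_fst).symm.trans (this.trans F₂.emb_fst)

lemma isUnit_two_of_hom (t : Spec (.of B) ⟶ Spec (.of ℂ)) : IsUnit (2 : B) := by
  obtain ⟨χ, -⟩ := exists_sp t
  simpa only [map_ofNat] using (isUnit_iff_ne_zero.2 (two_ne_zero (α := ℂ))).map χ

/-- The discriminants of isomorphic double covers generate the same ideal: an isomorphism commutes
with the conjugations, so it takes the root to a multiple of the root. -/
lemma span_eq_of_bijective {f₁ f₂ : B} (h2 : IsUnit (2 : B)) (e : Dbl B f₁ →+* Dbl B f₂)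
    (he : e.comp (algebraMap B _) = algebraMap B _) (hb : Function.Bijective e) :
    f₁ ∈ Ideal.span {f₂} := by
  have h1 := congr(($(Dbl.comp_conj_of_bijective h2 e he hb) (Dbl.root f₁)).re)
  have h3 : Dbl.conj f₁ (Dbl.root f₁) = - Dbl.root f₁ := by ext <;> simp
  simp only [RingHom.comp_apply, h3, map_neg, QuadraticAlgebra.re_neg, Dbl.re_conj] at h1
  have h4 : (e (Dbl.root f₁)).re = 0 := h2.mul_right_eq_zero.1 (by linear_combination -h1)
  have h5 := congr((e $(Dbl.root_mul_root f₁)).re)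
  rw [map_mul, QuadraticAlgebra.re_mul, h4, ← RingHom.comp_apply, he,
    QuadraticAlgebra.algebraMap_re] at h5
  exact Ideal.mem_span_singleton'.2 ⟨(e (Dbl.root f₁)).im * (e (Dbl.root f₁)).im, by
    linear_combination h5⟩

/-- A family is classified by the base change of the morphism for an isomorphic family. -/
lemma classify_of_map_comp [IsSeparated s] {F₁ F₂ : Family s B} {h : H ⟶ Spec (.of ℂ)}
    {Z : (pullback s h).IdealSheafData} {v : Spec (.of B) ⟶ H} (h₁ : F₁.Classify Z v)
    (ht : F₁.t = F₂.t) (d : B) (hd : IsUnit d) (hf : F₁.f = d * d * F₂.f)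
    (hj : sp (Dbl.map (RingHom.id B) d F₂.f hf) ≫ F₁.j = F₂.j) : F₂.Classify Z v := by
  have h3 : F₁.map (RingHom.id B) d F₂.f hf hd = F₂ := by
    obtain ⟨t, f₁, j₁, w₁, m₁⟩ := F₁
    obtain ⟨t', f₂, j₂, w₂, m₂⟩ := F₂
    obtain rfl : t = t' := ht
    have ht : sp (RingHom.id B) ≫ t = t := by rw [sp_id, Category.id_comp]
    simp only at hj hf
    simp only [map, hj, ht]
  have := h₁.map (RingHom.id B) d F₂.f hf hd
  rwa [h3, sp_id, Category.id_comp] at this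

end Family

end Families

/-! ### The quotient of the square of a surface by an interchange of the factors -/

/-- A square `X` of `S` over `ℂ`, with projections `a` and `b`, and the interchange `σ` of the two
factors. For an involution `ι` of `S`, the projections `pr₁` and `pr₂ ≫ ι` of `S × S` make
`(p, q) ↦ (ι q, ι p)` such an interchange. -/
structure SwapSquare {S : Scheme.{0}} (s : S ⟶ Spec (.of ℂ)) where
  X : Scheme.{0}
  a : X ⟶ S
  b : X ⟶ S
  isPullback : IsPullback a b s s
  σ : X ⟶ X
  σ_a : σ ≫ a = b
  σ_b : σ ≫ b = a

lemma sp_app_fromSpec {X Q : Scheme.{0}} {q : X ⟶ Q} {D : Q.Opens} (hD : IsAffineOpen D)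
    (hD' : IsAffineOpen (q ⁻¹ᵁ D)) : sp (q.app D).hom ≫ hD.fromSpec = hD'.fromSpec ≫ q := by
  have := hD.SpecMap_appLE_fromSpec q hD' le_rfl
  rwa [Scheme.Hom.appLE_eq_app] at this

namespace SwapSquare

variable {S : Scheme.{0}} {s : S ⟶ Spec (.of ℂ)} (M : SwapSquare s) {Q : Scheme.{0}}
  {q : M.X ⟶ Q} (hq : IsInvolutionQuotient M.σ q) {B C : Type} [CommRing B] [CommRing C]

lemma hom_ext {T : Scheme.{0}} {f g : T ⟶ M.X} (ha : f ≫ M.a = g ≫ M.a)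
    (hb : f ≫ M.b = g ≫ M.b) : f = g := M.isPullback.hom_ext ha hb

/-- The diagonal of the square. -/
def diag : S ⟶ M.X := M.isPullback.lift (𝟙 S) (𝟙 S) rfl

@[simp] lemma diag_a : M.diag ≫ M.a = 𝟙 S := M.isPullback.lift_fst ..
@[simp] lemma diag_b : M.diag ≫ M.b = 𝟙 S := M.isPullback.lift_snd ..

/-- A morphism that is invariant under the interchange factors through the diagonal. -/
lemma eq_comp_diag {T : Scheme.{0}} {f : T ⟶ M.X} (h : f ≫ M.σ = f) : f = (f ≫ M.a) ≫ M.diag := by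
  refine M.hom_ext (by simp) ?_
  rw [Category.assoc, diag_b, Category.comp_id]
  conv_lhs => rw [← h, Category.assoc, M.σ_b]

include hq

lemma le_preimage (D : Q.Opens) : q ⁻¹ᵁ D ≤ M.σ ⁻¹ᵁ (q ⁻¹ᵁ D) := by
  rw [← Scheme.Hom.comp_preimage, hq.invariant]

/-- The involution on the functions on the preimage of an open set of the quotient. -/
def invol (D : Q.Opens) : Γ(M.X, q ⁻¹ᵁ D) →+* Γ(M.X, q ⁻¹ᵁ D) :=
  (M.σ.appLE (q ⁻¹ᵁ D) (q ⁻¹ᵁ D) (M.le_preimage hq D)).hom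

lemma invol_invol (D : Q.Opens) (z : Γ(M.X, q ⁻¹ᵁ D)) :
    M.invol hq D (M.invol hq D z) = z := by
  have h : M.σ.appLE (q ⁻¹ᵁ D) (q ⁻¹ᵁ D) (M.le_preimage hq D) ≫
      M.σ.appLE (q ⁻¹ᵁ D) (q ⁻¹ᵁ D) (M.le_preimage hq D) = 𝟙 _ := by
    rw [Scheme.Hom.appLE_comp_appLE]
    simp only [hq.involutive]
    exact (Scheme.Hom.appLE_eq_app ..).trans (Scheme.Hom.id_app _)
  exact congr($(h).hom z)

lemma isInvolutionRing (r : Q ⟶ Spec (.of ℂ)) (D : Q.Opens) :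
    IsInvolutionRing (q.app D).hom (M.invol hq D) where
  two := by
    let χ : ℂ →+* Γ(Q, D) := (r.appLE ⊤ D le_top).hom.comp (Scheme.ΓSpecIso (.of ℂ)).inv.hom
    simpa only [map_ofNat] using (isUnit_iff_ne_zero.2 (two_ne_zero (α := ℂ))).map χ
  invol := M.invol_invol hq D
  inj := hq.app_injective D
  range c := hq.range_app D (M.le_preimage hq D) c

lemma sp_invol_fromSpec {D : Q.Opens} (hD' : IsAffineOpen (q ⁻¹ᵁ D)) :
    sp (M.invol hq D) ≫ hD'.fromSpec = hD'.fromSpec ≫ M.σ :=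
  hD'.SpecMap_appLE_fromSpec M.σ hD' (M.le_preimage hq D)

omit hq in
/-- The morphism to the square that is given by a family of pairs and its conjugate. -/
def pair (F : Family s B) : Spec (.of (Dbl B F.f)) ⟶ M.X :=
  M.isPullback.lift F.j (Dbl.conjSpec F.f ≫ F.j) (by
    rw [Category.assoc, F.w, ← Category.assoc, Dbl.conjSpec_proj])

omit hq

@[simp] lemma pair_a (F : Family s B) : M.pair F ≫ M.a = F.j := M.isPullback.lift_fst ..
@[simp] lemma pair_b (F : Family s B) : M.pair F ≫ M.b = Dbl.conjSpec F.f ≫ F.j :=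
  M.isPullback.lift_snd ..

lemma conjSpec_pair (F : Family s B) : Dbl.conjSpec F.f ≫ M.pair F = M.pair F ≫ M.σ := by
  apply M.hom_ext
  · rw [Category.assoc, Category.assoc, M.σ_a, pair_a, pair_b]
  · rw [Category.assoc, Category.assoc, M.σ_b, pair_a, pair_b, sp_comp_sp_assoc]
    have : (Dbl.conj F.f).comp (Dbl.conj F.f) = RingHom.id _ := RingHom.ext fun x => by simp
    rw [this, sp_id, Category.id_comp]

lemma pair_map (F : Family s B) (χ : B →+* C) (d f' : C) (h : χ F.f = d * d * f') (hd : IsUnit d) :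
    M.pair (F.map χ d f' h hd) = sp (Dbl.map χ d f' h) ≫ M.pair F := by
  apply M.hom_ext
  · rw [Category.assoc, pair_a, pair_a]
  · rw [Category.assoc, pair_b, pair_b, sp_comp_sp_assoc, ← Dbl.map_comp_conj, ← sp_comp_sp_assoc]

/-- The morphism `k` to the quotient is the Hilbert-Chow morphism of the family: it sends a pair to
its class. -/
def HC (q : M.X ⟶ Q) (F : Family s B) (k : Spec (.of B) ⟶ Q) : Prop :=
  Dbl.proj F.f ≫ k = M.pair F ≫ q

variable {M}

lemma HC.map {F : Family s B} {k : Spec (.of B) ⟶ Q} (hk : M.HC q F k) (χ : B →+* C) (d f' : C)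
    (h : χ F.f = d * d * f') (hd : IsUnit d) : M.HC q (F.map χ d f' h hd) (sp χ ≫ k) := by
  rw [HC, pair_map, Category.assoc, ← hk, ← Category.assoc, ← Category.assoc, sp_comp_sp,
    sp_comp_sp, ← Dbl.map_comp_algebraMap]

lemma HC.unique {F : Family s B} {k k' : Spec (.of B) ⟶ Q} (hk : M.HC q F k) (hk' : M.HC q F k') :
    k = k' := (cancel_epi (Dbl.proj F.f)).1 (hk.trans hk'.symm)

/-- Families with the same classifying morphism are isomorphic, so that they have the same
Hilbert-Chow morphism. -/
lemma HC.unique_of_classify [IsSeparated s] {F F' : Family s B} {k k' : Spec (.of B) ⟶ Q}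
    (hk : M.HC q F k) (hk' : M.HC q F' k') {H : Scheme.{0}} {h : H ⟶ Spec (.of ℂ)}
    {Z : (pullback s h).IdealSheafData} {v : Spec (.of B) ⟶ H} (hF : F.Classify Z v)
    (hF' : F'.Classify Z v) : k = k' := by
  obtain ⟨-, e, hb, he, hj⟩ := hF.exists_hom hF'
  refine HC.unique (F := F') (q := q) (M := M) ?_ hk'
  have h1 : M.pair F' = sp e ≫ M.pair F := by
    apply M.hom_ext
    · rw [Category.assoc, pair_a, pair_a, hj]
    · rw [Category.assoc, pair_b, pair_b, ← hj, sp_comp_sp_assoc, sp_comp_sp_assoc,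
        Dbl.comp_conj_of_bijective (Family.isUnit_two_of_hom F.t) e he hb]
  rw [HC, h1, Category.assoc, ← hk, sp_comp_sp_assoc, he]

/-- The Hilbert-Chow morphism of a family is a morphism over `ℂ`. -/
lemma HC.comp_eq {F : Family s B} {k : Spec (.of B) ⟶ Q} (hk : M.HC q F k) {r : Q ⟶ Spec (.of ℂ)}
    (hr : q ≫ r = M.a ≫ s) : k ≫ r = F.t := by
  rw [← cancel_epi (Dbl.proj F.f), ← Category.assoc, hk, Category.assoc, hr, ← F.w,
    ← Category.assoc, pair_a]

include hq

/-- On an affine chart of the quotient, the Hilbert-Chow morphism is an equivariant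
homomorphism. -/
lemma HC.exists_hom {F : Family s B} {k : Spec (.of B) ⟶ Q} (hk : M.HC q F k) {D : Q.Opens}
    (hD : IsAffineOpen D) (hD' : IsAffineOpen (q ⁻¹ᵁ D)) {φ : Γ(Q, D) →+* B}
    (hφ : sp φ ≫ hD.fromSpec = k) :
    ∃ ρ : Γ(M.X, q ⁻¹ᵁ D) →+* Dbl B F.f, sp ρ ≫ hD'.fromSpec = M.pair F ∧
      ρ.comp (M.invol hq D) = (Dbl.conj F.f).comp ρ ∧
      ρ.comp (q.app D).hom = (algebraMap B _).comp φ := by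
  obtain ⟨ρ, hρ⟩ := exists_sp_comp_fromSpec hD' (w := M.pair F) fun x => by
    change q (M.pair F x) ∈ D
    rw [← Scheme.Hom.comp_apply, ← hk, ← hφ, ← Category.assoc, sp_comp_sp]
    exact sp_comp_fromSpec_mem hD _ x
  refine ⟨ρ, hρ, sp_comp_fromSpec_injective hD' ?_, sp_comp_fromSpec_injective hD ?_⟩
  · rw [← sp_comp_sp, Category.assoc, M.sp_invol_fromSpec hq hD', ← Category.assoc, hρ,
      ← M.conjSpec_pair, ← hρ, sp_comp_sp_assoc]
  · rw [← sp_comp_sp, ← sp_comp_sp, Category.assoc, Category.assoc, hφ, hk, ← hρ,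
      sp_app_fromSpec hD hD', Category.assoc]

/-- A family whose pairs lie over an affine open `D` of the quotient has a Hilbert-Chow morphism: the
homomorphism on invariants that is induced by the pair. -/
lemma exists_hc_of_mem (r : Q ⟶ Spec (.of ℂ)) (F : Family s B) {D : Q.Opens} (hD : IsAffineOpen D)
    (hD' : IsAffineOpen (q ⁻¹ᵁ D)) (h : ∀ x, M.pair F x ∈ q ⁻¹ᵁ D) :
    ∃ k, M.HC q F k := by
  obtain ⟨ρ, hρ⟩ := exists_sp_comp_fromSpec hD' h
  have hρτ : ρ.comp (M.invol hq D) = (Dbl.conj F.f).comp ρ := sp_comp_fromSpec_injective hD' (by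
    rw [← sp_comp_sp, Category.assoc, M.sp_invol_fromSpec hq hD', ← Category.assoc, hρ,
      ← M.conjSpec_pair, ← hρ, sp_comp_sp_assoc])
  have h2 := Family.isUnit_two_of_hom F.t
  refine ⟨sp (evenHom (M.isInvolutionRing hq r D) h2 ρ hρτ) ≫ hD.fromSpec, ?_⟩
  rw [HC, sp_comp_sp_assoc, ← comp_eq_evenHom, ← hρ, ← sp_comp_sp, Category.assoc, Category.assoc,
    sp_app_fromSpec hD hD']

end SwapSquare

/-! ### Flat families of length two are locally double covers -/

section LocalStructure

variable {B C O : Type} [CommRing B] [CommRing C] [CommRing O]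

/-- An algebra with a basis, in which one coordinate of `1` is a unit, is a double cover: complete
the square in the equation of the other basis element. -/
lemma Dbl.exists_bijective_of_basis [Algebra C O] (h2 : IsUnit (2 : C)) (b : Module.Basis (Fin 2) C O)
    (hu : IsUnit (b.repr 1 0)) : ∃ (f : C) (e : Dbl C f →+* O), Function.Bijective e ∧
      e.comp (algebraMap C _) = algebraMap C O := by
  obtain ⟨m, hm⟩ := h2.exists_left_inv
  obtain ⟨u, hu'⟩ := hu.exists_left_inv
  have sum (z : O) : z = b.repr z 0 • b 0 + b.repr z 1 • b 1 := by
    conv_lhs => rw [← b.sum_repr z, Fin.sum_univ_two]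
  have indep (x y : C) (h : x • b 0 + y • b 1 = 0) : x = 0 ∧ y = 0 := by
    have := Fintype.linearIndependent_iff.1 b.linearIndependent ![x, y]
      (by simpa [Fin.sum_univ_two] using h)
    exact ⟨this 0, this 1⟩
  set x := b.repr 1 0
  set y := b.repr 1 1
  set θ := b 1
  set p := b.repr (θ * θ) 0
  set q := b.repr (θ * θ) 1
  let A := algebraMap C O
  have h1 : 1 = A x * b 0 + A y * θ := by simpa only [Algebra.smul_def] using sum 1
  have hθ : θ * θ = A p * b 0 + A q * θ := by simpa only [Algebra.smul_def] using sum (θ * θ)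
  have hb : b 0 = A u * (1 - A y * θ) := by
    have : A u * A x = 1 := by rw [← map_mul, hu', map_one]
    linear_combination (-b 0) * this - A u * h1
  have hm' : A m * 2 = 1 := by rw [← map_ofNat A 2, ← map_mul, hm, map_one]
  let R := q - p * u * y
  have hR : A R = A q - A p * A u * A y := by simp [R]
  let f := p * u + m * m * R * R
  have hf : A f = A p * A u + A m * A m * A R * A R := by simp [f]
  let ε := θ - A (m * R)
  have hε : ε = θ - A m * A R := by simp [ε]
  have he : ε * ε = A f := by
    rw [hε, hf]
    linear_combination hθ + A p * hb - A R * θ * hm' - θ * hR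
  let e := Dbl.eval A ε he
  have hev (z) : e z = A z.re + A z.im * ε := Dbl.eval_apply ..
  refine ⟨f, e, ⟨?_, fun z => ?_⟩, RingHom.ext fun z => Dbl.eval_algebraMap _ _ he z⟩
  · rw [injective_iff_map_eq_zero]
    intro z hz
    rw [hev] at hz
    obtain ⟨h3, h4⟩ := indep ((z.re - z.im * (m * R)) * x) ((z.re - z.im * (m * R)) * y + z.im) (by
      simp only [Algebra.smul_def]
      change A _ * b 0 + A _ * θ = 0
      simp only [map_mul, map_sub, map_add]
      rw [hε] at hz
      linear_combination hz - (A z.re - A z.im * (A m * A R)) * h1)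
    have h5 : z.re - z.im * (m * R) = 0 := by
      linear_combination u * h3 - (z.re - z.im * (m * R)) * hu'
    rw [h5] at h4
    have h6 : z.im = 0 := by linear_combination h4
    rw [h6] at h5
    ext
    · simpa using h5
    · exact h6
  · refine ⟨⟨b.repr z 0 * u + (b.repr z 1 - b.repr z 0 * u * y) * (m * R),
      b.repr z 1 - b.repr z 0 * u * y⟩, ?_⟩
    rw [hev]
    conv_rhs => rw [sum z]
    simp only [Algebra.smul_def, map_mul, map_sub, map_add]
    change _ = A _ * b 0 + A _ * θ
    rw [hε]
    linear_combination - A (b.repr z 0) * hb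

/-- A free algebra of rank two is a double cover near every point, because `1` is a part of a basis
there. -/
lemma Dbl.exists_bijective_away_of_basis [Algebra C O] (h2 : IsUnit (2 : C))
    (b : Module.Basis (Fin 2) C O) (t : PrimeSpectrum C) : ∃ g ∉ t.asIdeal,
      ∃ (f : Localization.Away g)
        (e : Dbl (Localization.Away g) f →+* TensorProduct C (Localization.Away g) O),
        Function.Bijective e ∧ e.comp (algebraMap _ _) = algebraMap (Localization.Away g) _ := by
  have key : ∃ i, b.repr 1 i ∉ t.asIdeal := by
    by_contra! h
    have hmem (z : O) (i) : b.repr z i ∈ t.asIdeal := by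
      have hz : z = b.repr 1 0 • (z * b 0) + b.repr 1 1 • (z * b 1) := by
        have := b.sum_repr 1
        rw [Fin.sum_univ_two] at this
        rw [← mul_smul_comm, ← mul_smul_comm, ← mul_add, this, mul_one]
      rw [hz]
      simp only [map_add, map_smul, Finsupp.add_apply, Finsupp.smul_apply, smul_eq_mul]
      exact add_mem (Ideal.mul_mem_right _ _ (h 0)) (Ideal.mul_mem_right _ _ (h 1))
    have := hmem (b 0) 0
    rw [b.repr_self, Finsupp.single_eq_same] at this
    exact t.2.one_notMem this
  obtain ⟨i, hi⟩ := key
  refine ⟨b.repr 1 i, hi, Dbl.exists_bijective_of_basis ?_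
    ((b.baseChange (Localization.Away (b.repr 1 i))).reindex (Equiv.swap 0 i)) ?_⟩
  · simpa only [map_ofNat] using h2.map (algebraMap C (Localization.Away (b.repr 1 i)))
  · rw [Module.Basis.repr_reindex_apply, Equiv.symm_swap, Equiv.swap_apply_left,
      Algebra.TensorProduct.one_def, Module.Basis.baseChange_repr_tmul, Algebra.smul_def, mul_one]
    exact IsLocalization.Away.algebraMap_isUnit _

/-- A finite flat algebra of rank `n` is free near every point. -/
lemma exists_basis_away [Algebra C O] [Module.Finite C O] [Module.Flat C O] {n : ℕ}
    (h : ∀ t : PrimeSpectrum C, Module.rankAtStalk O t = n) (t : PrimeSpectrum C) :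
    ∃ g ∉ t.asIdeal, Nonempty
      (Module.Basis (Fin n) (Localization.Away g) (TensorProduct C (Localization.Away g) O)) := by
  obtain ⟨g, hg, hfree⟩ := Module.Free.away_of_finite_of_flat_of_rankAtStalk_constant O t.asIdeal
    fun m _ => (h _).trans (h _).symm
  refine ⟨g, hg, ?_⟩
  let L := Localization.Away g
  have hfree' : Module.Free L (TensorProduct C L O) :=
    Module.Free.of_equiv (LocalizedModule.equivTensorProduct (Submonoid.powers g) O)
  have hne : Nontrivial L := by
    by_contra hs
    rw [not_nontrivial_iff_subsingleton,
      IsLocalization.subsingleton_iff (S := L) (M := Submonoid.powers g)] at hs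
    obtain ⟨k, hk⟩ := hs
    exact hg (t.2.mem_of_pow_mem k (by simp only at hk; rw [hk]; exact zero_mem _))
  obtain ⟨y⟩ : Nonempty (PrimeSpectrum L) := inferInstance
  have hr : Module.finrank L (TensorProduct C L O) = n := by
    have h1 := congrFun (Module.rankAtStalk_eq_finrank_of_free (R := L) (M := TensorProduct C L O)) y
    rw [Module.rankAtStalk_baseChange, h] at h1
    exact h1.symm
  exact ⟨Module.finBasisOfFinrankEq _ _ hr⟩

end LocalStructure

section Charts

variable {W T : Scheme.{0}} {C O C' : Type} [CommRing C] [CommRing O] [CommRing C']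

/-- The base change of an affine morphism to an affine scheme is given by a ring homomorphism. -/
lemma exists_isPullback_of_isAffineHom (g : W ⟶ T) [IsAffineHom g] (v : Spec (.of C) ⟶ T) :
    ∃ (O : Type) (_ : CommRing O) (_ : Algebra C O) (w : Spec (.of O) ⟶ W),
      IsPullback w (sp (algebraMap C O)) g v := by
  have : IsAffine (pullback g v) := isAffine_of_isAffineHom (pullback.snd g v)
  let O : Type := Γ(pullback g v, ⊤)
  let i : pullback g v ≅ Spec (.of O) := (pullback g v).isoSpec
  obtain ⟨φ, hφ⟩ := exists_sp (i.inv ≫ pullback.snd g v)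
  let _ : Algebra C O := φ.toAlgebra
  refine ⟨O, inferInstance, φ.toAlgebra, i.inv ≫ pullback.fst g v, ?_⟩
  refine (IsPullback.of_hasPullback g v).of_iso i (Iso.refl _) (Iso.refl _) (Iso.refl _) ?_ ?_ ?_ ?_
  · simp
  · rw [Iso.refl_hom, Category.comp_id]
    exact (Iso.inv_comp_eq i).1 hφ.symm
  · simp
  · simp

lemma isPullback_tensor [Algebra C O] [Algebra C C'] {g : W ⟶ T} {v : Spec (.of C) ⟶ T}
    {w : Spec (.of O) ⟶ W} (h : IsPullback w (sp (algebraMap C O)) g v) :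
    IsPullback (sp (Algebra.TensorProduct.includeRight : O →ₐ[C] TensorProduct C C' O).toRingHom ≫ w)
      (sp (algebraMap C' (TensorProduct C C' O))) g (sp (algebraMap C C') ≫ v) :=
  IsPullback.paste_horiz (isPullback_SpecMap_of_isPushout _ _ _ _
    (CommRingCat.isPushout_tensorProduct C C' O).flip) h

/-- The target of a finite flat morphism of degree two is covered by charts over which it is a double
cover. -/
lemma exists_double_cover (g : W ⟶ T) [IsFinite g] [Flat g]
    (hg : ∀ x, g.finrank x = 2) (t : T ⟶ Spec (.of ℂ)) (x : T) :
    ∃ (C : Type) (_ : CommRing C) (v : Spec (.of C) ⟶ T) (f : C) (w : Spec (.of (Dbl C f)) ⟶ W),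
      IsOpenImmersion v ∧ x ∈ Set.range v ∧ IsPullback w (Dbl.proj f) g v := by
  obtain ⟨C, _, v, hv, y, rfl⟩ := exists_chart x
  obtain ⟨O, _, _, w, hw⟩ := exists_isPullback_of_isAffineHom g v
  have h1 : IsFinite (sp (algebraMap C O)) := MorphismProperty.of_isPullback hw ‹_›
  have h2 : Flat (sp (algebraMap C O)) := MorphismProperty.of_isPullback hw ‹_›
  have h1' : Module.Finite C O := by
    rwa [IsFinite.SpecMap_iff, CommRingCat.hom_ofHom, RingHom.finite_algebraMap] at h1
  have h2' : Module.Flat C O := by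
    rwa [Flat.SpecMap_iff, CommRingCat.hom_ofHom, RingHom.flat_algebraMap_iff] at h2
  have h3 (t : PrimeSpectrum C) : Module.rankAtStalk O t = 2 := by
    exact (Scheme.Hom.finrank_SpecMap_algebraMap C O t).symm.trans
      ((Scheme.Hom.finrank_of_isPullback _ _ _ _ hw t).trans (hg _))
  obtain ⟨a, ha, ⟨b⟩⟩ := exists_basis_away h3 y
  obtain ⟨y', hy'⟩ := mem_range_away.2 ha
  obtain ⟨a', ha', f, e, he, hea⟩ :=
    Dbl.exists_bijective_away_of_basis (Family.isUnit_two_of_hom (away a ≫ v ≫ t)) b y'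
  obtain ⟨y'', hy''⟩ := mem_range_away.2 ha'
  obtain ⟨w', hw'⟩ : ∃ w', IsPullback w' (sp (algebraMap (Localization.Away a') (TensorProduct _ _
      (TensorProduct C (Localization.Away a) O)))) g (away a' ≫ away a ≫ v) :=
    ⟨_, isPullback_tensor (C' := Localization.Away a')
      (isPullback_tensor (C' := Localization.Away a) hw)⟩
  have hiso : IsIso (sp e) := isIso_SpecMap_iff.2 he
  refine ⟨_, _, away a' ≫ away a ≫ v, f, inv (sp e) ≫ w', inferInstance, ⟨y'', ?_⟩,
    hw'.of_iso (asIso (sp e)) (Iso.refl _) (Iso.refl _) (Iso.refl _) ?_ ?_ ?_ ?_⟩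
  · rw [Scheme.Hom.comp_apply, Scheme.Hom.comp_apply, hy'', hy']
  · simp
  · rw [Iso.refl_hom, Category.comp_id, asIso_hom, sp_comp_sp, hea]
  · simp
  · simp

end Charts

section Families

variable {S H : Scheme.{0}} {s : S ⟶ Spec (.of ℂ)} {B C : Type} [CommRing B] [CommRing C]

/-- The base of a flat family of subschemes of length two is covered by charts over which it is a
double cover. -/
lemma exists_classify [IsSeparated s] {h : H ⟶ Spec (.of ℂ)} {Z : (pullback s h).IdealSheafData}
    (hZ : IsPointFamily 2 s h Z) (x : H) :
    ∃ (C : Type) (_ : CommRing C) (v : Spec (.of C) ⟶ H) (F : Family s C),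
      IsOpenImmersion v ∧ x ∈ Set.range v ∧ F.Classify Z v := by
  have := hZ.isFinite
  have := hZ.flat
  obtain ⟨C, _, v, f, w, hv, hx, hw⟩ := exists_double_cover (Z.subschemeι ≫ pullback.snd s h)
    hZ.rank_eq h x
  let F : Family s C := {
    t := v ≫ h
    f := f
    j := w ≫ Z.subschemeι ≫ pullback.fst s h
    w := by
      rw [Category.assoc, Category.assoc, pullback.condition, ← Category.assoc, ← Category.assoc,
        Category.assoc w, hw.w, Category.assoc]
    mono E _ g₁ g₂ h₁ h₂ := by
      refine sp_injective (hw.hom_ext ?_ ?_)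
      · rw [← cancel_mono Z.subschemeι]
        apply pullback.hom_ext
        · simpa using h₂
        · have h3 := hw.w
          have (g : Dbl C f →+* E) : ((sp g ≫ w) ≫ Z.subschemeι) ≫ pullback.snd s h =
              sp (g.comp (algebraMap C _)) ≫ v := by
            rw [Category.assoc, Category.assoc, hw.w, sp_comp_sp_assoc]
          rw [this, this, h₁]
      · rw [sp_comp_sp, sp_comp_sp, h₁] }
  refine ⟨C, _, v, F, hv, hx, rfl, ?_⟩
  have hp : IsPullback F.emb w (idProd s v rfl) Z.subschemeι := by
    have he : F.emb ≫ pullback.snd s (v ≫ h) = Dbl.proj f := F.emb_snd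
    refine (IsPullback.of_bot (v₁₁ := F.emb) ?_ ?_ (Family.isPullback_idProd v rfl)).flip
    · exact he ▸ hw
    · apply pullback.hom_ext
      · rw [Category.assoc, Category.assoc, Family.idProd_fst]
        exact F.emb_fst.symm
      · rw [Category.assoc, hw.w, Category.assoc, Family.idProd_snd, ← he, Category.assoc]
  rw [ker_eq_comap_of_isPullback hp, Scheme.IdealSheafData.ker_subschemeι]

/-- Every neighbourhood of a fibre of a double cover contains the preimage of a neighbourhood in the
base. -/
lemma Dbl.exists_notMem_of_mem {f : B} (W : (Spec (.of (Dbl B f))).Opens) (y : Spec (.of (Dbl B f)))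
    (hy : y ∈ W) (hy' : Dbl.conjSpec f y ∈ W) : ∃ g ∉ (Dbl.proj f y).asIdeal,
      ∀ z, g ∉ (Dbl.proj f z).asIdeal → z ∈ W := by
  obtain ⟨a, ha⟩ := (PrimeSpectrum.isClosed_iff_zeroLocus_ideal _).1 W.isOpen.isClosed_compl
  have hW (z : Spec (.of (Dbl B f))) : z ∈ W ↔ ¬ a ≤ z.asIdeal := by
    have : z ∈ (W : Set _)ᶜ ↔ a ≤ z.asIdeal := by rw [ha]; rfl
    rw [← this]; simp
  rw [hW] at hy hy'
  have : ¬ ((a : Set (Dbl B f)) ⊆ y.asIdeal ∪ (Dbl.conjSpec f y).asIdeal) := by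
    rw [Ideal.subset_union]; tauto
  -- by prime avoidance there is an `x` that vanishes outside the neighbourhood, but at no point of
  -- the fibre; its norm has the required property
  obtain ⟨x, hx, hx'⟩ := Set.not_subset.1 this
  have hg : algebraMap B (Dbl B f) (x.re * x.re - f * x.im * x.im) = x * Dbl.conj f x := by
    ext <;> simp [QuadraticAlgebra.re_mul, QuadraticAlgebra.im_mul] <;> ring
  refine ⟨x.re * x.re - f * x.im * x.im, ?_, fun z hz => (hW z).2 fun h => hz ?_⟩
  · change algebraMap B (Dbl B f) (x.re * x.re - f * x.im * x.im) ∉ y.asIdeal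
    rw [hg]
    intro h
    rcases y.2.mem_or_mem h with h | h
    · exact hx' (Or.inl h)
    · exact hx' (Or.inr h)
  · change algebraMap B (Dbl B f) (x.re * x.re - f * x.im * x.im) ∈ z.asIdeal
    rw [hg]
    exact z.asIdeal.mul_mem_right _ (h hx)

lemma Dbl.conjSpec_eq_of_mem {f : B} (y : Spec (.of (Dbl B f))) (h : f ∈ (Dbl.proj f y).asIdeal) :
    Dbl.conjSpec f y = y := by
  have h0 : Dbl.root f ∈ y.asIdeal := by
    have : Dbl.root f * Dbl.root f ∈ y.asIdeal := by rw [Dbl.root_mul_root]; exact h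
    exact (y.2.mem_or_mem this).elim id id
  refine PrimeSpectrum.ext (Ideal.ext fun x => ?_)
  change Dbl.conj f x ∈ y.asIdeal ↔ _
  have : Dbl.conj f x = x - algebraMap B _ (x.im + x.im) * Dbl.root f := by
    ext <;> simp [QuadraticAlgebra.re_mul, QuadraticAlgebra.im_mul]
  rw [this]
  exact Submodule.sub_mem_iff_left _ (Ideal.mul_mem_left _ _ h0)

namespace SwapSquare

variable (M : SwapSquare s) {Q : Scheme.{0}} {q : M.X ⟶ Q} (hq : IsInvolutionQuotient M.σ q)

include hq in
/-- The Hilbert-Chow morphism exists locally on the base of a family. -/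
lemma exists_hc (r : Q ⟶ Spec (.of ℂ)) (F : Family s B) (t : Spec (.of B)) : ∃ g ∉ t.asIdeal, ∃ k,
    M.HC q (F.baseChange (algebraMap B (Localization.Away g))) k := by
  obtain ⟨y, rfl⟩ := (Dbl.flat_surjective_proj F.f).2.surj t
  have := hq.isAffineHom
  obtain ⟨D, hD, hyD, -⟩ := exists_isAffineOpen_mem_and_subset (U := ⊤) (x := q (M.pair F y))
    trivial
  obtain ⟨g, hg, hgW⟩ := Dbl.exists_notMem_of_mem (M.pair F ⁻¹ᵁ q ⁻¹ᵁ D) y hyD (by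
    change q (M.pair F (Dbl.conjSpec F.f y)) ∈ D
    rw [← Scheme.Hom.comp_apply, ← Scheme.Hom.comp_apply, ← Category.assoc, conjSpec_pair,
      Category.assoc, hq.invariant]
    exact hyD)
  refine ⟨g, hg, M.exists_hc_of_mem hq r _ hD (hD.preimage q) fun x => ?_⟩
  rw [pair_map, Scheme.Hom.comp_apply]
  refine hgW _ ?_
  rw [← Scheme.Hom.comp_apply, sp_comp_sp, Dbl.map_comp_algebraMap, ← sp_comp_sp,
    Scheme.Hom.comp_apply, ← mem_range_away]
  exact ⟨_, rfl⟩

end SwapSquare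

end Families

/-! ### The singular locus of the quotient -/

section Scalars

variable {B : Type} [CommRing B] {Y : Scheme.{0}}

/-- The ring `Γ(Spec ℂ, ⊤)`, a copy of `ℂ`. -/
abbrev Scal : Type := Γ(Spec (.of ℂ), ⊤)

/-- The structure homomorphism of the ring of an affine scheme over `ℂ`. -/
def scal (t : Spec (.of B) ⟶ Spec (.of ℂ)) : Scal →+* B :=
  (exists_sp_comp_fromSpec (isAffineOpen_top (Spec (.of ℂ))) (w := t) fun _ => trivial).choose

lemma sp_scal (t : Spec (.of B) ⟶ Spec (.of ℂ)) :
    sp (scal t) ≫ (isAffineOpen_top _).fromSpec = t :=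
  (exists_sp_comp_fromSpec (isAffineOpen_top (Spec (.of ℂ))) (w := t) fun _ => trivial).choose_spec

lemma comp_appLE_eq_scal (y : Y ⟶ Spec (.of ℂ)) {U : Y.Opens} (hU : IsAffineOpen U)
    {ρ : Γ(Y, U) →+* B} {m : Spec (.of B) ⟶ Y} (h : sp ρ ≫ hU.fromSpec = m) :
    ρ.comp (y.appLE ⊤ U le_top).hom = scal (m ≫ y) := by
  refine sp_comp_fromSpec_injective (isAffineOpen_top _) ?_
  rw [← sp_comp_sp, sp_scal, ← h, Category.assoc, Category.assoc]
  exact congrArg (sp ρ ≫ ·) ((isAffineOpen_top _).SpecMap_appLE_fromSpec y hU le_top)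

lemma isUnit_two_scal : IsUnit (2 : Scal) := by
  simpa only [map_ofNat] using (isUnit_iff_ne_zero.2 (two_ne_zero (α := ℂ))).map
    (Scheme.ΓSpecIso (.of ℂ)).inv.hom

end Scalars

namespace SwapSquare

variable {S : Scheme.{0}} {s : S ⟶ Spec (.of ℂ)} (M : SwapSquare s) {Q : Scheme.{0}}
  {q : M.X ⟶ Q} (hq : IsInvolutionQuotient M.σ q) {E : Type} [CommRing E]

@[simp] lemma diag_σ : M.diag ≫ M.σ = M.diag := by
  apply M.hom_ext
  · rw [Category.assoc, M.σ_a, diag_b, diag_a]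
  · rw [Category.assoc, M.σ_b, diag_b, diag_a]

include hq

/-- A ring on which all odd functions vanish is a ring over the diagonal. -/
lemma eq_comp_diag_of_odd {D : Q.Opens} (hD' : IsAffineOpen (q ⁻¹ᵁ D)) {χ : Γ(M.X, q ⁻¹ᵁ D) →+* E}
    (hχ : ∀ u ∈ oddSet (M.invol hq D), χ u = 0) :
    sp χ ≫ hD'.fromSpec = ((sp χ ≫ hD'.fromSpec) ≫ M.a) ≫ M.diag := by
  apply M.eq_comp_diag
  have h : χ.comp (M.invol hq D) = χ := by
    refine RingHom.ext fun z => ?_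
    have := hχ (M.invol hq D z - z) (by
      simp only [oddSet, Set.mem_ofPred_eq, map_sub, M.invol_invol hq]; ring)
    rw [map_sub] at this
    exact sub_eq_zero.1 this
  rw [Category.assoc, ← M.sp_invol_fromSpec hq hD', sp_comp_sp_assoc, h]

/-- The odd functions generate the ideal of the diagonal. -/
lemma mem_span_odd_iff [IsSeparated s] (r : Q ⟶ Spec (.of ℂ)) {D : Q.Opens}
    (hD' : IsAffineOpen (q ⁻¹ᵁ D)) (x : Γ(M.X, q ⁻¹ᵁ D)) :
    x ∈ Ideal.span (oddSet (M.invol hq D)) ↔ (M.diag.app (q ⁻¹ᵁ D)).hom x = 0 := by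
  have h := M.isInvolutionRing hq r D
  constructor
  · intro hx
    refine (Ideal.span_le (I := RingHom.ker (M.diag.app (q ⁻¹ᵁ D)).hom)).2 (fun u hu => ?_) hx
    have h1 : M.σ.appLE (q ⁻¹ᵁ D) (q ⁻¹ᵁ D) (M.le_preimage hq D) ≫ M.diag.app (q ⁻¹ᵁ D) =
        M.diag.app (q ⁻¹ᵁ D) := by
      rw [← Scheme.Hom.appLE_eq_app, Scheme.Hom.appLE_comp_appLE]
      simp only [diag_σ]
    have h2 : (M.diag.app (q ⁻¹ᵁ D)).hom (M.invol hq D u) = (M.diag.app (q ⁻¹ᵁ D)).hom u :=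
      congr($(h1).hom u)
    have hu : M.invol hq D u = - u := hu
    rw [hu, map_neg] at h2
    have h3 : IsUnit (2 : Γ(S, M.diag ⁻¹ᵁ q ⁻¹ᵁ D)) := by
      simpa only [map_ofNat] using (h.two.map (q.app D).hom).map (M.diag.app (q ⁻¹ᵁ D)).hom
    exact h3.mul_right_eq_zero.1 (by linear_combination - h2)
  · intro hx
    let χ := Ideal.Quotient.mk (Ideal.span (oddSet (M.invol hq D)))
    have h1 := M.eq_comp_diag_of_odd hq hD' (χ := χ) fun u hu =>
      Ideal.Quotient.eq_zero_iff_mem.2 (Ideal.subset_span hu)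
    rw [← Ideal.Quotient.eq_zero_iff_mem]
    have ha : IsSeparated M.a := MorphismProperty.of_isPullback M.isPullback.flip ‹_›
    have hda : IsClosedImmersion (M.diag ≫ M.a) := by rw [diag_a]; infer_instance
    have hd : IsClosedImmersion M.diag := IsClosedImmersion.of_comp M.diag M.a
    have hS' : IsAffineOpen (M.diag ⁻¹ᵁ q ⁻¹ᵁ D) := hD'.preimage M.diag
    obtain ⟨κ, hκ⟩ := exists_sp_comp_fromSpec hS' (w := (sp χ ≫ hD'.fromSpec) ≫ M.a) fun z => by
      change M.diag (((sp χ ≫ hD'.fromSpec) ≫ M.a) z) ∈ q ⁻¹ᵁ D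
      rw [← Scheme.Hom.comp_apply, ← h1]
      exact sp_comp_fromSpec_mem hD' _ z
    have h2 : κ.comp (M.diag.app (q ⁻¹ᵁ D)).hom = χ := sp_comp_fromSpec_injective hD' (by
      rw [h1, ← hκ, ← sp_comp_sp, Category.assoc, Category.assoc, sp_app_fromSpec hD' hS'])
    change χ x = 0
    rw [← h2, RingHom.comp_apply, hx, map_zero]

/-- The ideal of products of odd functions is radical: its elements are the invariant functions that
vanish on the diagonal, which is reduced. -/
lemma isRadical_productIdeal [IsSeparated s] [IsReduced S] (r : Q ⟶ Spec (.of ℂ)) {D : Q.Opens}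
    (hD' : IsAffineOpen (q ⁻¹ᵁ D)) :
    (productIdeal (q.app D).hom (oddSet (M.invol hq D))).IsRadical := by
  rw [(M.isInvolutionRing hq r D).productIdeal_eq_comap subset_rfl Ideal.subset_span]
  rintro c ⟨n, hn⟩
  rw [Ideal.mem_comap, M.mem_span_odd_iff hq r hD'] at hn ⊢
  rw [map_pow, map_pow] at hn
  exact eq_zero_of_pow_eq_zero hn

/-- The zero locus of the products of odd functions lies in the image of the diagonal. -/
lemma exists_eq_of_productIdeal_le [Surjective q] (r : Q ⟶ Spec (.of ℂ)) {D : Q.Opens}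
    (hD : IsAffineOpen D) (hD' : IsAffineOpen (q ⁻¹ᵁ D)) (p : Spec (Γ(Q, D)))
    (hp : productIdeal (q.app D).hom (oddSet (M.invol hq D)) ≤ p.asIdeal) :
    ∃ y, hD.fromSpec p = q (M.diag y) := by
  have h := M.isInvolutionRing hq r D
  obtain ⟨z, hz⟩ := q.surjective (hD.fromSpec p)
  have hzD : z ∈ q ⁻¹ᵁ D := by
    change q z ∈ D
    rw [hz, ← SetLike.mem_coe, ← hD.range_fromSpec]; exact ⟨p, rfl⟩
  obtain ⟨w, rfl⟩ : z ∈ Set.range hD'.fromSpec := by rw [hD'.range_fromSpec]; exact hzD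
  have hw : sp (q.app D).hom w = p := by
    refine hD.fromSpec.isOpenEmbedding.injective ?_
    rw [← hz, ← Scheme.Hom.comp_apply, ← Scheme.Hom.comp_apply]
    exact congr($(sp_app_fromSpec hD hD') w)
  let χ : Γ(M.X, q ⁻¹ᵁ D) →+* (Γ(M.X, q ⁻¹ᵁ D) ⧸ w.asIdeal) := Ideal.Quotient.mk w.asIdeal
  have h1 := M.eq_comp_diag_of_odd hq hD' (χ := χ) fun u hu => by
    rw [Ideal.Quotient.eq_zero_iff_mem]
    obtain ⟨c, hc⟩ := h.exists_mul hu hu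
    have h2 : c ∈ p.asIdeal := hp (Ideal.subset_span ⟨u, hu, u, hu, hc⟩)
    rw [← hw] at h2
    have h3 : (q.app D).hom c ∈ w.asIdeal := h2
    rw [hc] at h3
    exact (w.2.mem_or_mem h3).elim id id
  obtain ⟨o, ho⟩ : ∃ o, sp χ o = w := by
    have : w.asIdeal.IsPrime := w.2
    have : IsDomain (Γ(M.X, q ⁻¹ᵁ D) ⧸ w.asIdeal) := Ideal.Quotient.isDomain w.asIdeal
    let o : PrimeSpectrum (Γ(M.X, q ⁻¹ᵁ D) ⧸ w.asIdeal) := ⟨⊥, Ideal.isPrime_bot⟩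
    refine ⟨o, PrimeSpectrum.ext ?_⟩
    change Ideal.comap χ ⊥ = w.asIdeal
    rw [← RingHom.ker_eq_comap_bot, Ideal.mk_ker]
  refine ⟨((sp χ ≫ hD'.fromSpec) ≫ M.a) o, ?_⟩
  rw [← hz, ← Scheme.Hom.comp_apply _ M.diag, ← h1, Scheme.Hom.comp_apply, ho]

end SwapSquare

/-! ### The quotient near the diagonal -/

section Surface

variable {S : Scheme.{0}} {s : S ⟶ Spec (.of ℂ)}

/-- A smooth surface has affine charts with coordinates. -/
lemma exists_coordinates_chart [SmoothOfRelativeDimension 2 s] (y : S) :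
    ∃ (U : S.Opens) (_ : IsAffineOpen U) (_ : Algebra Scal Γ(S, U)), y ∈ U ∧
      algebraMap Scal Γ(S, U) = (s.appLE ⊤ U le_top).hom ∧ Algebra.Smooth Scal Γ(S, U) ∧
      Nonempty (Coordinates Scal Γ(S, U)) := by
  obtain ⟨V, hV, U, hU, hy, e, hf⟩ :=
    SmoothOfRelativeDimension.exists_isStandardSmoothOfRelativeDimension (n := 2) (f := s) y
  have hVtop : V = ⊤ := by
    have : Subsingleton (Spec (.of ℂ)) := inferInstanceAs (Subsingleton (PrimeSpectrum ℂ))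
    ext z
    simp only [Opens.coe_top, Set.mem_univ, iff_true]
    rw [Subsingleton.elim z (s y)]
    exact e hy
  subst hVtop
  algebraize [(s.appLE ⊤ U e).hom]
  have : Nontrivial Γ(S, U) := by
    have : Nonempty U := ⟨⟨y, hy⟩⟩
    infer_instance
  have hs : Smooth s := SmoothOfRelativeDimension.smooth (n := 2) s
  refine ⟨U, hU, inferInstance, hy, rfl, ?_, exists_coordinates⟩
  exact RingHom.smooth_algebraMap.1 (s.smooth_appLE hV hU e)

end Surface

namespace SwapSquare

variable {S : Scheme.{0}} {s : S ⟶ Spec (.of ℂ)} (M : SwapSquare s) {Q : Scheme.{0}}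
  {q : M.X ⟶ Q} (hq : IsInvolutionQuotient M.σ q) {E : Type} [CommRing E]

lemma smooth_a [Smooth s] : Smooth (M.a ≫ s) := by
  have : Smooth M.a := MorphismProperty.of_isPullback M.isPullback.flip ‹_›
  infer_instance

include hq

/-- The quotient is smooth away from the ideal of products of odd functions. -/
lemma formallySmooth_stalkMap_of_not_le [Smooth s] {r : Q ⟶ Spec (.of ℂ)} (hr : q ≫ r = M.a ≫ s)
    {D : Q.Opens} (hD : IsAffineOpen D) (p : Spec (Γ(Q, D)))
    (hp : ¬ productIdeal (q.app D).hom (oddSet (M.invol hq D)) ≤ p.asIdeal) :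
    (r.stalkMap (hD.fromSpec p)).hom.FormallySmooth := by
  have := hq.isAffineHom
  have h := M.isInvolutionRing hq r D
  obtain ⟨u, hu, c, hc, hcp⟩ : ∃ u ∈ oddSet (M.invol hq D), ∃ c, (q.app D).hom c = u * u ∧
      c ∉ p.asIdeal := by
    by_contra! H
    refine hp (Ideal.span_le.2 ?_)
    rintro c ⟨u, hu, v, hv, hc⟩
    -- the square of a product `u v` of odd functions is the product of `u²` and `v²`
    obtain ⟨c₁, hc₁⟩ := h.exists_mul hu hu
    obtain ⟨c₂, hc₂⟩ := h.exists_mul hv hv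
    have h1 : c * c = c₁ * c₂ := h.inj (by rw [map_mul, map_mul, hc, hc₁, hc₂]; ring)
    have h2 : c * c ∈ p.asIdeal := by
      rw [h1]; exact p.asIdeal.mul_mem_right _ (H u hu c₁ hc₁)
    exact (p.2.mem_or_mem h2).elim id id
  let D' := Q.basicOpen c
  have hD' : IsAffineOpen D' := hD.basicOpen c
  have hle : D' ≤ D := Q.basicOpen_le c
  have hx : hD.fromSpec p ∈ D' := by
    change p ∈ hD.fromSpec ⁻¹ᵁ D'
    rw [hD.fromSpec_preimage_basicOpen]
    exact hcp
  let u' : Γ(M.X, q ⁻¹ᵁ D') := (M.X.presheaf.map (homOfLE (q.preimage_mono hle)).op).hom u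
  let c' : Γ(Q, D') := (Q.presheaf.map (homOfLE hle).op).hom c
  have hc' : IsUnit c' := RingedSpace.isUnit_res_basicOpen _ c
  have hcu : (q.app D').hom c' = u' * u' := by
    have h1 : (q.app D').hom c' =
        (M.X.presheaf.map (homOfLE (q.preimage_mono hle)).op).hom ((q.app D).hom c) :=
      congr($(q.naturality (homOfLE hle).op).hom c)
    rw [h1, hc, map_mul]
  have hu' : u' ∈ oddSet (M.invol hq D') := by
    have h1 : M.invol hq D' u' =
        (M.X.presheaf.map (homOfLE (q.preimage_mono hle)).op).hom (M.invol hq D u) := by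
      have h2 : M.X.presheaf.map (homOfLE (q.preimage_mono hle)).op ≫
          M.σ.appLE (q ⁻¹ᵁ D') (q ⁻¹ᵁ D') (M.le_preimage hq D') =
          M.σ.appLE (q ⁻¹ᵁ D) (q ⁻¹ᵁ D) (M.le_preimage hq D) ≫
          M.X.presheaf.map (homOfLE (q.preimage_mono hle)).op := by
        rw [Scheme.Hom.map_appLE, Scheme.Hom.appLE_map]
      exact congr($(h2).hom u)
    have hu : M.invol hq D u = - u := hu
    change M.invol hq D' u' = - u'
    rw [h1, hu, map_neg]
  let _ : Algebra Scal Γ(Q, D') := (r.appLE ⊤ D' le_top).hom.toAlgebra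
  let _ : Algebra Scal Γ(M.X, q ⁻¹ᵁ D') := ((q ≫ r).appLE ⊤ (q ⁻¹ᵁ D') le_top).hom.toAlgebra
  let i : Γ(Q, D') →ₐ[Scal] Γ(M.X, q ⁻¹ᵁ D') :=
    { (q.app D').hom with
      commutes' := fun k => by
        have h1 : r.appLE ⊤ D' le_top ≫ q.app D' = (q ≫ r).appLE ⊤ (q ⁻¹ᵁ D') le_top := by
          rw [← Scheme.Hom.appLE_eq_app]
          exact Scheme.Hom.appLE_comp_appLE ..
        exact congr($(h1).hom k) }
  have hsm : Algebra.FormallySmooth Scal Γ(M.X, q ⁻¹ᵁ D') := by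
    have hs : Smooth (q ≫ r) := by rw [hr]; exact M.smooth_a
    have := RingHom.smooth_algebraMap.1
      ((q ≫ r).smooth_appLE (isAffineOpen_top _) (hD'.preimage q) le_top)
    exact this.formallySmooth
  have hsm' : Algebra.FormallySmooth Scal Γ(Q, D') :=
    formallySmooth_invariants i (M.isInvolutionRing hq r D') hu' hcu hc'
  rw [formallySmooth_stalkMap_iff ⊤ (isAffineOpen_top _) D' hD' le_top hx]
  change Algebra.FormallySmooth Scal (Localization.AtPrime _)
  have := Algebra.FormallySmooth.of_isLocalization (R := Γ(Q, D'))
    (Rₘ := Localization.AtPrime (hD'.primeIdealOf ⟨_, hx⟩).asIdeal)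
    (hD'.primeIdealOf ⟨_, hx⟩).asIdeal.primeCompl
  exact Algebra.FormallySmooth.comp Scal Γ(Q, D') _

/-- The class of a point of the diagonal has neighbourhoods whose preimages lie in a given
neighbourhood of the diagonal point. -/
lemma exists_isAffineOpen_le {U : S.Opens} {y : S} (hy : y ∈ U) : ∃ D : Q.Opens, IsAffineOpen D ∧
    q (M.diag y) ∈ D ∧ q ⁻¹ᵁ D ≤ M.a ⁻¹ᵁ U ∧ q ⁻¹ᵁ D ≤ M.b ⁻¹ᵁ U := by
  let V : M.X.Opens := M.a ⁻¹ᵁ U ⊓ M.b ⁻¹ᵁ U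
  have hσa (x) : M.a (M.σ x) = M.b x := by rw [← Scheme.Hom.comp_apply, M.σ_a]
  have hσb (x) : M.b (M.σ x) = M.a x := by rw [← Scheme.Hom.comp_apply, M.σ_b]
  have hV : q ⁻¹' (q '' (V : Set M.X)) = V := by
    refine subset_antisymm ?_ (Set.subset_preimage_image _ _)
    rintro x ⟨z, hz, hzx⟩
    rcases (hq.orbits z x).1 hzx with rfl | rfl
    · exact hz
    · refine ⟨?_, ?_⟩
      · change M.a (M.σ z) ∈ U
        rw [hσa]; exact hz.2
      · change M.b (M.σ z) ∈ U
        rw [hσb]; exact hz.1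
  have hopen : IsOpen (q '' (V : Set M.X)) := by
    rw [← hq.isQuotientMap.isOpen_preimage, hV]; exact V.2
  have hmem : M.diag y ∈ V := by
    refine ⟨?_, ?_⟩
    · change M.a (M.diag y) ∈ U
      rwa [← Scheme.Hom.comp_apply, diag_a]
    · change M.b (M.diag y) ∈ U
      rwa [← Scheme.Hom.comp_apply, diag_b]
  obtain ⟨D, hD, hyD, hDV⟩ := exists_isAffineOpen_mem_and_subset (U := ⟨_, hopen⟩)
    (x := q (M.diag y)) ⟨_, hmem, rfl⟩
  have h1 (x) (hx : x ∈ q ⁻¹ᵁ D) : x ∈ V := by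
    rw [← SetLike.mem_coe, ← hV]; exact hDV hx
  exact ⟨D, hD, hyD, fun x hx => (h1 x hx).1, fun x hx => (h1 x hx).2⟩

omit hq in
/-- The function `(p, p') ↦ g p - g p'` that is defined by a function `g` on the surface. -/
def delta (q : M.X ⟶ Q) {U : S.Opens} {D : Q.Opens} (ha : q ⁻¹ᵁ D ≤ M.a ⁻¹ᵁ U)
    (hb : q ⁻¹ᵁ D ≤ M.b ⁻¹ᵁ U) (g : Γ(S, U)) : Γ(M.X, q ⁻¹ᵁ D) :=
  (M.a.appLE U (q ⁻¹ᵁ D) ha).hom g - (M.b.appLE U (q ⁻¹ᵁ D) hb).hom g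

lemma invol_appLE_a {U : S.Opens} {D : Q.Opens} (ha : q ⁻¹ᵁ D ≤ M.a ⁻¹ᵁ U)
    (hb : q ⁻¹ᵁ D ≤ M.b ⁻¹ᵁ U) (g : Γ(S, U)) :
    M.invol hq D ((M.a.appLE U (q ⁻¹ᵁ D) ha).hom g) = (M.b.appLE U (q ⁻¹ᵁ D) hb).hom g := by
  have h1 : M.a.appLE U (q ⁻¹ᵁ D) ha ≫ M.σ.appLE (q ⁻¹ᵁ D) (q ⁻¹ᵁ D) (M.le_preimage hq D) =
      M.b.appLE U (q ⁻¹ᵁ D) hb := by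
    rw [Scheme.Hom.appLE_comp_appLE]
    simp only [M.σ_a]
  exact congr($(h1).hom g)

lemma invol_appLE_b {U : S.Opens} {D : Q.Opens} (ha : q ⁻¹ᵁ D ≤ M.a ⁻¹ᵁ U)
    (hb : q ⁻¹ᵁ D ≤ M.b ⁻¹ᵁ U) (g : Γ(S, U)) :
    M.invol hq D ((M.b.appLE U (q ⁻¹ᵁ D) hb).hom g) = (M.a.appLE U (q ⁻¹ᵁ D) ha).hom g := by
  have h1 : M.b.appLE U (q ⁻¹ᵁ D) hb ≫ M.σ.appLE (q ⁻¹ᵁ D) (q ⁻¹ᵁ D) (M.le_preimage hq D) =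
      M.a.appLE U (q ⁻¹ᵁ D) ha := by
    rw [Scheme.Hom.appLE_comp_appLE]
    simp only [M.σ_b]
  exact congr($(h1).hom g)

lemma delta_mem_oddSet {U : S.Opens} {D : Q.Opens} (ha : q ⁻¹ᵁ D ≤ M.a ⁻¹ᵁ U)
    (hb : q ⁻¹ᵁ D ≤ M.b ⁻¹ᵁ U) (g : Γ(S, U)) : M.delta q ha hb g ∈ oddSet (M.invol hq D) := by
  change M.invol hq D (M.delta q ha hb g) = - M.delta q ha hb g
  rw [delta, map_sub, M.invol_appLE_a hq ha hb, M.invol_appLE_b hq ha hb, neg_sub]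

omit hq in
lemma apply_delta {U : S.Opens} (hU : IsAffineOpen U) {D : Q.Opens} (hD' : IsAffineOpen (q ⁻¹ᵁ D))
    (ha : q ⁻¹ᵁ D ≤ M.a ⁻¹ᵁ U) (hb : q ⁻¹ᵁ D ≤ M.b ⁻¹ᵁ U) {ρ : Γ(M.X, q ⁻¹ᵁ D) →+* E}
    {α β : Γ(S, U) →+* E} (hα : sp ρ ≫ hD'.fromSpec ≫ M.a = sp α ≫ hU.fromSpec)
    (hβ : sp ρ ≫ hD'.fromSpec ≫ M.b = sp β ≫ hU.fromSpec) (g : Γ(S, U)) :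
    ρ (M.delta q ha hb g) = α g - β g := by
  have h1 : ρ.comp (M.a.appLE U (q ⁻¹ᵁ D) ha).hom = α := sp_comp_fromSpec_injective hU (by
    rw [← hα, ← sp_comp_sp, Category.assoc]
    exact congrArg (sp ρ ≫ ·) (hU.SpecMap_appLE_fromSpec M.a hD' ha))
  have h2 : ρ.comp (M.b.appLE U (q ⁻¹ᵁ D) hb).hom = β := sp_comp_fromSpec_injective hU (by
    rw [← hβ, ← sp_comp_sp, Category.assoc]
    exact congrArg (sp ρ ≫ ·) (hU.SpecMap_appLE_fromSpec M.b hD' hb))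
  rw [delta, map_sub, ← h1, ← h2]; rfl

end SwapSquare

/-! ### Singularity of the quotient along the diagonal -/

section Reduction

variable {B : Type} [CommRing B]

/-- The reduction of the ring of dual numbers. -/
def Dbl.red (B : Type) [CommRing B] : Dbl B 0 →+* B := Dbl.eval (RingHom.id B) 0 (by simp)

lemma Dbl.red_apply (x : Dbl B 0) : Dbl.red B x = x.re := by simp [Dbl.red, Dbl.eval_apply]

/-- The spectrum of the ring of dual numbers has the same points as that of its reduction. -/
lemma Dbl.exists_sp_red (z : Spec (.of (Dbl B 0))) : ∃ w, sp (Dbl.red B) w = z := by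
  refine ⟨Dbl.proj 0 z, PrimeSpectrum.ext (Ideal.ext fun x => ?_)⟩
  change algebraMap B (Dbl B 0) (Dbl.red B x) ∈ z.asIdeal ↔ _
  have h0 : Dbl.root 0 ∈ z.asIdeal := by
    have : Dbl.root 0 * Dbl.root 0 ∈ z.asIdeal := by
      rw [Dbl.root_mul_root, map_zero]; exact z.asIdeal.zero_mem
    exact (z.2.mem_or_mem this).elim id id
  have : algebraMap B (Dbl B 0) (Dbl.red B x) = x - algebraMap B _ x.im * Dbl.root 0 := by
    rw [Dbl.red_apply]
    ext <;> simp [QuadraticAlgebra.re_mul, QuadraticAlgebra.im_mul]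
  rw [this]
  exact Submodule.sub_mem_iff_left _ (Ideal.mul_mem_left _ _ h0)

/-- A point of an affine open is the image of the spectrum of a field. -/
lemma exists_residue {S : Scheme.{0}} {U : S.Opens} (hU : IsAffineOpen U) {y : S} (hy : y ∈ U) :
    ∃ (κ : Type) (_ : Field κ) (g : Γ(S, U) →+* κ), ∀ w, (sp g ≫ hU.fromSpec) w = y := by
  let p := hU.primeIdealOf ⟨y, hy⟩
  refine ⟨p.asIdeal.ResidueField, inferInstance, algebraMap Γ(S, U) _, fun w => ?_⟩
  have hw : sp (algebraMap Γ(S, U) p.asIdeal.ResidueField) w = p := by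
    refine PrimeSpectrum.ext ?_
    change Ideal.comap (algebraMap Γ(S, U) p.asIdeal.ResidueField) w.asIdeal = p.asIdeal
    have h1 : w.asIdeal = (⊥ : Ideal p.asIdeal.ResidueField) :=
      (Ideal.eq_bot_or_top w.asIdeal).resolve_right w.2.ne_top
    rw [h1, ← RingHom.ker_eq_comap_bot, Ideal.ker_algebraMap_residueField]
  have : (sp (algebraMap Γ(S, U) p.asIdeal.ResidueField) ≫ hU.fromSpec) w =
    hU.fromSpec (sp (algebraMap Γ(S, U) p.asIdeal.ResidueField) w) := Scheme.Hom.comp_apply ..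
  rw [this, hw]
  exact hU.fromSpec_primeIdealOf ⟨y, hy⟩

end Reduction

namespace SwapSquare

variable {S : Scheme.{0}} {s : S ⟶ Spec (.of ℂ)} (M : SwapSquare s) {Q : Scheme.{0}}
  {q : M.X ⟶ Q} (hq : IsInvolutionQuotient M.σ q)

include hq

/-- The quotient is singular along the image of the diagonal: for coordinates `x₀`, `x₁` at the
point, the jets `exp (± (ε₁ ∂₀ + ε₂ ∂₁) / 2)` of the two factors give a tangent vector at which
`u² = v² = 0` and `u v = ε₁ ε₂` for the odd functions `u = δ x₀` and `v = δ x₁`. -/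
lemma not_formallySmooth_stalkMap [SmoothOfRelativeDimension 2 s] {r : Q ⟶ Spec (.of ℂ)}
    (hr : q ≫ r = M.a ≫ s) (y : S) : ¬ (r.stalkMap (q (M.diag y))).hom.FormallySmooth := by
  have := hq.isAffineHom
  obtain ⟨U, hU, _, hy, halg, -, ⟨X⟩⟩ := exists_coordinates_chart (s := s) y
  obtain ⟨D, hD, hyD, ha, hb⟩ := M.exists_isAffineOpen_le hq hy
  have hD' : IsAffineOpen (q ⁻¹ᵁ D) := hD.preimage q
  have h := M.isInvolutionRing hq r D
  obtain ⟨κ, _, g₀, hg₀⟩ := exists_residue hU hy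
  let _ : Algebra Scal κ := (g₀.comp (algebraMap Scal Γ(S, U))).toAlgebra
  let g : Γ(S, U) →ₐ[Scal] κ := { g₀ with commutes' := fun _ => rfl }
  obtain ⟨m, hm⟩ := isUnit_two_scal.exists_right_inv
  let α : Γ(S, U) →ₐ[Scal] Jet κ := jet g (X.deriv 0) (X.deriv 1) m
  let β : Γ(S, U) →ₐ[Scal] Jet κ := jet g (X.deriv 0) (X.deriv 1) (-m)
  let red : Jet κ →+* κ := (Dbl.red κ).comp (Dbl.red (Dbl κ 0))
  have hred (x : Jet κ) : red x = x.re.re := by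
    simp only [red, RingHom.comp_apply, Dbl.red_apply]
  have hs (γ : Γ(S, U) →ₐ[Scal] Jet κ) : (sp (γ : Γ(S, U) →+* Jet κ) ≫ hU.fromSpec) ≫ s =
      sp (algebraMap Scal (Jet κ)) ≫ (isAffineOpen_top _).fromSpec := by
    rw [← sp_scal ((sp (γ : Γ(S, U) →+* Jet κ) ≫ hU.fromSpec) ≫ s),
      ← comp_appLE_eq_scal s hU (ρ := (γ : Γ(S, U) →+* Jet κ)) rfl, ← halg, γ.comp_algebraMap]
  let ψ₀ : Spec (.of (Jet κ)) ⟶ M.X := M.isPullback.lift (sp (α : Γ(S, U) →+* Jet κ) ≫ hU.fromSpec)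
    (sp (β : Γ(S, U) →+* Jet κ) ≫ hU.fromSpec) ((hs α).trans (hs β).symm)
  have hψa : ψ₀ ≫ M.a = sp (α : Γ(S, U) →+* Jet κ) ≫ hU.fromSpec := M.isPullback.lift_fst ..
  have hψb : ψ₀ ≫ M.b = sp (β : Γ(S, U) →+* Jet κ) ≫ hU.fromSpec := M.isPullback.lift_snd ..
  have hredψ : sp red ≫ ψ₀ = (sp g₀ ≫ hU.fromSpec) ≫ M.diag := by
    have e (t : Scal) : red.comp (jet g (X.deriv 0) (X.deriv 1) t : Γ(S, U) →+* Jet κ) = g₀ :=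
      RingHom.ext fun x => (hred _).trans rfl
    apply M.hom_ext
    · rw [Category.assoc, hψa, sp_comp_sp_assoc, e, Category.assoc, diag_a, Category.comp_id]
    · rw [Category.assoc, hψb, sp_comp_sp_assoc, e, Category.assoc, diag_b, Category.comp_id]
  have hredpt (w : Spec (.of κ)) : ψ₀ (sp red w) = M.diag y := by
    have h1 := congr($hredψ w)
    rw [Scheme.Hom.comp_apply, Scheme.Hom.comp_apply] at h1
    rw [h1]
    exact congrArg M.diag (hg₀ w)
  obtain ⟨ψ, hψ⟩ := exists_sp_comp_fromSpec hD' (w := ψ₀) fun z => by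
    obtain ⟨z', rfl⟩ := Dbl.exists_sp_red z
    obtain ⟨w, rfl⟩ := Dbl.exists_sp_red z'
    have h1 := hredpt w
    have h2 : sp red w = sp (Dbl.red (Dbl κ 0)) (sp (Dbl.red κ) w) := by
      rw [← Scheme.Hom.comp_apply, sp_comp_sp]
    rw [h2] at h1
    rw [h1]
    exact hyD
  have hψτ : ψ.comp (M.invol hq D) = (jetConj κ).comp ψ := sp_comp_fromSpec_injective hD' (by
    rw [← sp_comp_sp, ← sp_comp_sp, Category.assoc, Category.assoc, M.sp_invol_fromSpec hq hD', hψ,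
      ← Category.assoc, hψ]
    have e (t : Scal) : (jetConj κ).comp (jet g (X.deriv 0) (X.deriv 1) t : Γ(S, U) →+* Jet κ) =
      (jet g (X.deriv 0) (X.deriv 1) (-t) : Γ(S, U) →+* Jet κ) :=
      RingHom.ext fun x => jetConj_jet ..
    apply M.hom_ext
    · rw [Category.assoc, Category.assoc, M.σ_a, hψa, hψb, sp_comp_sp_assoc, e]
    · rw [Category.assoc, Category.assoc, M.σ_b, hψa, hψb, sp_comp_sp_assoc, e, neg_neg])
  have h2κ : IsUnit (2 : κ) := by
    simpa only [map_ofNat] using isUnit_two_scal.map (algebraMap Scal κ)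
  let _ : Algebra Scal Γ(Q, D) := (r.appLE ⊤ D le_top).hom.toAlgebra
  have hψi : (ψ.comp (q.app D).hom).comp (r.appLE ⊤ D le_top).hom = algebraMap Scal (Jet κ) := by
    have h1 : sp (ψ.comp (q.app D).hom) ≫ hD.fromSpec = ψ₀ ≫ q := by
      rw [← sp_comp_sp, Category.assoc, sp_app_fromSpec hD hD', ← hψ, Category.assoc]
    rw [comp_appLE_eq_scal r hD h1]
    refine sp_comp_fromSpec_injective (isAffineOpen_top _) ?_
    rw [sp_scal, Category.assoc, hr, ← Category.assoc, hψa, hs]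
  let χ : Γ(Q, D) →ₐ[Scal] Dbl κ 0 :=
    { jetEven h h2κ ψ hψτ with
      commutes' := fun k => by
        have h1 : ψ ((q.app D).hom (algebraMap Scal Γ(Q, D) k)) = algebraMap Scal (Jet κ) k :=
          congr($hψi k)
        change (⟨(ψ ((q.app D).hom (algebraMap Scal Γ(Q, D) k))).re.re,
          (ψ ((q.app D).hom (algebraMap Scal Γ(Q, D) k))).im.im⟩ : Dbl κ 0) = _
        rw [h1]
        rfl }
  have hχ (c) : χ c = ⟨(ψ ((q.app D).hom c)).re.re, (ψ ((q.app D).hom c)).im.im⟩ := rfl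
  have hδ (z) : ψ (M.delta q ha hb z) = ⟨⟨0, g (X.deriv 0 z)⟩, ⟨g (X.deriv 1 z), 0⟩⟩ := by
    have h1 := M.apply_delta hU hD' ha hb (ρ := ψ) (α := (α : Γ(S, U) →+* Jet κ))
      (β := (β : Γ(S, U) →+* Jet κ)) (by rw [← Category.assoc, hψ, hψa])
      (by rw [← Category.assoc, hψ, hψb]) z
    rw [h1]
    have e (w : κ) : m • w + m • w = w := by
      rw [← add_smul, ← two_mul, hm, one_smul]
    change α z - β z = _
    ext <;> simp [α, β, jet, e]
  have hd (i j) : g (X.deriv i (X.x j)) = if j = i then 1 else 0 := by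
    rw [X.deriv_apply]; split_ifs <;> simp
  have hu₀ : ψ (M.delta q ha hb (X.x 0)) = ⟨⟨0, 1⟩, ⟨0, 0⟩⟩ := by rw [hδ, hd, hd]; simp
  have hu₁ : ψ (M.delta q ha hb (X.x 1)) = ⟨⟨0, 0⟩, ⟨1, 0⟩⟩ := by rw [hδ, hd, hd]; simp
  have odd (z) := M.delta_mem_oddSet hq ha hb z
  obtain ⟨c₁, hc₁⟩ := h.exists_mul (odd (X.x 0)) (odd (X.x 0))
  obtain ⟨c₂, hc₂⟩ := h.exists_mul (odd (X.x 1)) (odd (X.x 1))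
  obtain ⟨c₃, hc₃⟩ := h.exists_mul (odd (X.x 0)) (odd (X.x 1))
  rw [formallySmooth_stalkMap_iff ⊤ (isAffineOpen_top _) D hD le_top hyD]
  refine not_formallySmooth_of_dual χ (c₁ := c₁) (c₂ := c₂) (c₃ := c₃) (h.inj ?_) ?_ ?_ ?_ _
    fun c hc hc0 => hc ?_
  · rw [map_mul, map_mul, hc₁, hc₂, hc₃]; ring
  · rw [hχ, hc₁, map_mul, hu₀]; ext <;> simp
  · rw [hχ, hc₂, map_mul, hu₁]; ext <;> simp
  · rw [hχ, hc₃, map_mul, hu₀, hu₁]; ext <;> simp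
  · let w : Spec (.of κ) := (⊥ : PrimeSpectrum κ)
    have h1 : sp ((red.comp ψ).comp (q.app D).hom) w = hD.primeIdealOf ⟨_, hyD⟩ := by
      refine hD.fromSpec.isOpenEmbedding.injective ?_
      rw [hD.fromSpec_primeIdealOf, ← Scheme.Hom.comp_apply, ← sp_comp_sp, Category.assoc,
        sp_app_fromSpec hD hD', ← sp_comp_sp, Category.assoc, ← Category.assoc (sp ψ), hψ,
        Scheme.Hom.comp_apply, Scheme.Hom.comp_apply, hredpt]
    rw [← h1]
    change (red.comp ψ).comp (q.app D).hom c ∈ (⊥ : Ideal κ)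
    rw [Ideal.mem_bot]
    exact (hred _).trans hc0

/-- On an affine open of the quotient, the ideal of the singular locus is generated by the products
of two odd functions. -/
lemma singularIdeal_ideal [IsSeparated s] [IsReduced S] [SmoothOfRelativeDimension 2 s]
    {r : Q ⟶ Spec (.of ℂ)} (hr : q ≫ r = M.a ≫ s) {D : Q.Opens} (hD : IsAffineOpen D) :
    (singularIdeal r).ideal ⟨D, hD⟩ = productIdeal (q.app D).hom (oddSet (M.invol hq D)) := by
  have := hq.isAffineHom
  have hs : Smooth s := SmoothOfRelativeDimension.smooth (n := 2) s
  have hsurj : Surjective q := ⟨hq.isQuotientMap.surjective⟩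
  have hD' : IsAffineOpen (q ⁻¹ᵁ D) := hD.preimage q
  set P := productIdeal (q.app D).hom (oddSet (M.invol hq D)) with hP
  have key : hD.fromSpec ⁻¹' {x : Q | ¬ (r.stalkMap x).hom.FormallySmooth} =
      PrimeSpectrum.zeroLocus (P : Set Γ(Q, D)) := by
    ext p
    change ¬ (r.stalkMap (hD.fromSpec p)).hom.FormallySmooth ↔ P ≤ p.asIdeal
    constructor
    · intro hp
      by_contra hle
      exact hp (M.formallySmooth_stalkMap_of_not_le hq hr hD p hle)
    · intro hle
      obtain ⟨y, hy⟩ := M.exists_eq_of_productIdeal_le hq r hD hD' p hle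
      rw [hy]
      exact M.not_formallySmooth_stalkMap hq hr y
  rw [singularIdeal, Scheme.IdealSheafData.vanishingIdeal_ideal]
  change PrimeSpectrum.vanishingIdeal (hD.fromSpec ⁻¹'
    (closure {x : Q | ¬ (r.stalkMap x).hom.FormallySmooth})) = P
  have hcl := hD.fromSpec.isOpenEmbedding.isOpenMap.preimage_closure_eq_closure_preimage
    hD.fromSpec.continuous {x : Q | ¬ (r.stalkMap x).hom.FormallySmooth}
  rw [key] at hcl
  exact (congrArg PrimeSpectrum.vanishingIdeal hcl).trans
    ((PrimeSpectrum.vanishingIdeal_closure _).trans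
      ((PrimeSpectrum.vanishingIdeal_zeroLocus_eq_radical _).trans
        (M.isRadical_productIdeal hq r hD').radical))

end SwapSquare

/-! ### The inverse image of the singular locus on a family -/

section Families

variable {S H : Scheme.{0}} {s : S ⟶ Spec (.of ℂ)} {B C : Type} [CommRing B] [CommRing C]

namespace Family

variable (F : Family s B)

lemma subsingleton_of_conjSpec_comp (h : Dbl.conjSpec F.f ≫ F.j = F.j) : Subsingleton B := by
  have h1 := F.mono (Dbl B F.f) (Dbl.conj F.f) (RingHom.id _) (by
    rw [Dbl.conj_comp_algebraMap, RingHom.id_comp]) (by rw [sp_id, Category.id_comp]; exact h)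
  have h2 := congr(($h1 (Dbl.root F.f)).im)
  simp only [Dbl.im_conj, RingHom.id_apply] at h2
  have h3 : (1 : B) = 0 := (isUnit_two_of_hom F.t).mul_right_eq_zero.1 (by linear_combination -h2)
  exact subsingleton_of_zero_eq_one h3.symm

/-- Over a nonempty base, a family of pairs is not invariant under conjugation, since it is
embedded. -/
lemma eq_top_of_conjSpec_comp (𝔟 : Ideal B)
    (h : Dbl.conjSpec _ ≫ (F.baseChange (Ideal.Quotient.mk 𝔟)).j =
      (F.baseChange (Ideal.Quotient.mk 𝔟)).j) : 𝔟 = ⊤ :=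
  Ideal.Quotient.subsingleton_iff.1 (subsingleton_of_conjSpec_comp _ h)

/-- The imaginary parts of the functions of a chart generate the unit ideal. -/
lemma span_im_eq_top {U : S.Opens} (hU : IsAffineOpen U) {ν : Γ(S, U) →+* Dbl B F.f}
    (hν : sp ν ≫ hU.fromSpec = F.j) : Ideal.span (Set.range fun g => (ν g).im) = ⊤ := by
  set 𝔟 := Ideal.span (Set.range fun g => (ν g).im)
  apply F.eq_top_of_conjSpec_comp
  let π := Ideal.Quotient.mk 𝔟
  have hπ : π F.f = 1 * 1 * π F.f := by ring
  have h1 : (Dbl.conj (π F.f)).comp ((Dbl.map π 1 (π F.f) hπ).comp ν) =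
      (Dbl.map π 1 (π F.f) hπ).comp ν := by
    refine RingHom.ext fun g => ?_
    have h2 : π (ν g).im = 0 := Ideal.Quotient.eq_zero_iff_mem.2 (Ideal.subset_span ⟨g, rfl⟩)
    ext <;> simp [h2]
  change Dbl.conjSpec (π F.f) ≫ sp (Dbl.map π 1 (π F.f) hπ) ≫ F.j =
    sp (Dbl.map π 1 (π F.f) hπ) ≫ F.j
  rw [← hν, sp_comp_sp_assoc, sp_comp_sp_assoc, sp_comp_sp_assoc, RingHom.comp_assoc, h1]

end Family

namespace SwapSquare

variable {M : SwapSquare s} {Q : Scheme.{0}} {q : M.X ⟶ Q} (hq : IsInvolutionQuotient M.σ q)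
  (r : Q ⟶ Spec (.of ℂ)) {D : Q.Opens} (hD : IsAffineOpen D) {F : Family s B}

include hq

/-- The imaginary parts of the odd functions generate the unit ideal. -/
lemma span_im_odd_eq_top {ρ : Γ(M.X, q ⁻¹ᵁ D) →+* Dbl B F.f}
    (hD' : IsAffineOpen (q ⁻¹ᵁ D)) (hρ : ρ.comp (M.invol hq D) = (Dbl.conj F.f).comp ρ)
    (hρF : sp ρ ≫ hD'.fromSpec = M.pair F) :
    Ideal.span {b | ∃ u ∈ oddSet (M.invol hq D), (ρ u).im = b} = ⊤ := by
  set 𝔟 := Ideal.span {b | ∃ u ∈ oddSet (M.invol hq D), (ρ u).im = b}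
  apply F.eq_top_of_conjSpec_comp
  let π := Ideal.Quotient.mk 𝔟
  have hπ : π F.f = 1 * 1 * π F.f := by ring
  have h1 := M.eq_comp_diag_of_odd hq hD' (χ := (Dbl.map π 1 (π F.f) hπ).comp ρ) fun u hu => by
    have h2 : π (ρ u).im = 0 := Ideal.Quotient.eq_zero_iff_mem.2 (Ideal.subset_span ⟨u, hu, rfl⟩)
    have h3 := re_eq_zero_of_odd (Family.isUnit_two_of_hom F.t) hρ hu
    ext <;> simp [h2, h3]
  have h4 : M.pair (F.baseChange π) = sp ((Dbl.map π 1 (π F.f) hπ).comp ρ) ≫ hD'.fromSpec := by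
    rw [← sp_comp_sp, Category.assoc, hρF]
    exact M.pair_map ..
  rw [← h4] at h1
  have h5 : M.pair (F.baseChange π) ≫ M.b = M.pair (F.baseChange π) ≫ M.a := by
    conv_lhs => rw [h1]
    rw [Category.assoc, diag_b, Category.comp_id]
  rw [pair_a, pair_b] at h5
  exact h5

include hD

/-- The Hilbert-Chow morphism as a homomorphism from the invariants. -/
lemma HC.exists_hom_eq {k : Spec (.of B) ⟶ Q} (hk : M.HC q F k) (hD' : IsAffineOpen (q ⁻¹ᵁ D))
    {φ : Γ(Q, D) →+* B} (hφ : sp φ ≫ hD.fromSpec = k) :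
    ∃ (ρ : Γ(M.X, q ⁻¹ᵁ D) →+* Dbl B F.f) (hρ : ρ.comp (M.invol hq D) = (Dbl.conj F.f).comp ρ),
      sp ρ ≫ hD'.fromSpec = M.pair F ∧
      evenHom (M.isInvolutionRing hq r D) (Family.isUnit_two_of_hom F.t) ρ hρ = φ := by
  obtain ⟨ρ, h1, h2, h3⟩ := hk.exists_hom hq hD hD' hφ
  refine ⟨ρ, h2, h1, RingHom.ext fun c => ?_⟩
  exact congr(($h3 c).re)

/-- The discriminant of a family generates the inverse image of the ideal of the singular locus
under the Hilbert-Chow morphism. -/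
lemma HC.comap_singularIdeal [IsSeparated s] [IsReduced S] [SmoothOfRelativeDimension 2 s]
    {r : Q ⟶ Spec (.of ℂ)} (hr : q ≫ r = M.a ≫ s) {k : Spec (.of B) ⟶ Q} (hk : M.HC q F k)
    {φ : Γ(Q, D) →+* B} (hφ : sp φ ≫ hD.fromSpec = k) :
    (singularIdeal r).comap k = specIdeal (Ideal.span {F.f}) := by
  have := hq.isAffineHom
  have hD' : IsAffineOpen (q ⁻¹ᵁ D) := hD.preimage q
  obtain ⟨ρ, hρ, h1, h2⟩ := hk.exists_hom_eq hq r hD hD' hφ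
  rw [← hφ, comap_sp_fromSpec, M.singularIdeal_ideal hq hr hD, ← h2,
    map_productIdeal_eq_span _ _ _ (span_im_odd_eq_top hq hD' hρ h1)]

/-- Two families with the same Hilbert-Chow morphism, whose discriminants are nonzerodivisors, are
locally isomorphic. -/
lemma HC.exists_classify_imp [IsSeparated s] {F₁ F₂ : Family s B} {k : Spec (.of B) ⟶ Q}
    (hr : q ≫ r = M.a ≫ s)
    (h₁ : M.HC q F₁ k) (h₂ : M.HC q F₂ k) (hf : F₂.f ∈ B⁰) {φ : Γ(Q, D) →+* B}
    (hφ : sp φ ≫ hD.fromSpec = k) (t : Spec (.of B)) :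
    ∃ g ∉ t.asIdeal, ∀ {H : Scheme.{0}} {h : H ⟶ Spec (.of ℂ)} {Z : (pullback s h).IdealSheafData}
      (v : Spec (.of (Localization.Away g)) ⟶ H),
        (F₁.baseChange (algebraMap B (Localization.Away g))).Classify Z v →
        (F₂.baseChange (algebraMap B (Localization.Away g))).Classify Z v := by
  have := hq.isAffineHom
  have hD' : IsAffineOpen (q ⁻¹ᵁ D) := hD.preimage q
  obtain ⟨ρ₁, hρ₁, hF₁, he₁⟩ := h₁.exists_hom_eq hq r hD hD' hφ
  obtain ⟨ρ₂, hρ₂, hF₂, he₂⟩ := h₂.exists_hom_eq hq r hD hD' hφ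
  have ex {F : Family s B} {ρ : Γ(M.X, q ⁻¹ᵁ D) →+* Dbl B F.f}
      (hρ : ρ.comp (M.invol hq D) = (Dbl.conj F.f).comp ρ) (hF : sp ρ ≫ hD'.fromSpec = M.pair F) :
      ∃ u ∈ oddSet (M.invol hq D), (ρ u).im ∉ t.asIdeal := by
    by_contra! H
    refine t.2.ne_top (top_le_iff.1 ?_)
    rw [← span_im_odd_eq_top hq hD' hρ hF, Ideal.span_le]
    rintro _ ⟨u, hu, rfl⟩
    exact H u hu
  obtain ⟨u₁, hu₁, h11⟩ := ex hρ₁ hF₁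
  obtain ⟨u₂, hu₂, h22⟩ := ex hρ₂ hF₂
  -- one of `u₁`, `u₂` and `u₁ + u₂` serves both families
  obtain ⟨u, hu, hut₁, hut₂⟩ : ∃ u ∈ oddSet (M.invol hq D), (ρ₁ u).im ∉ t.asIdeal ∧
      (ρ₂ u).im ∉ t.asIdeal := by
    by_cases h12 : (ρ₂ u₁).im ∈ t.asIdeal
    · by_cases h21 : (ρ₁ u₂).im ∈ t.asIdeal
      · refine ⟨u₁ + u₂, ?_, ?_, ?_⟩
        · have h3 : M.invol hq D u₁ = - u₁ := hu₁
          have h4 : M.invol hq D u₂ = - u₂ := hu₂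
          change M.invol hq D (u₁ + u₂) = - (u₁ + u₂)
          rw [map_add, h3, h4]; ring
        · rw [map_add, QuadraticAlgebra.im_add]
          exact fun h => h11 ((Submodule.add_mem_iff_left _ h21).1 h)
        · rw [map_add, QuadraticAlgebra.im_add]
          exact fun h => h22 ((Submodule.add_mem_iff_right _ h12).1 h)
      · exact ⟨u₂, hu₂, h21, h22⟩
    · exact ⟨u₁, hu₁, h11, h12⟩
  let g := (ρ₁ u).im * (ρ₂ u).im
  refine ⟨g, fun hg => (t.2.mem_or_mem hg).elim hut₁ hut₂, fun {H h Z} v hv => ?_⟩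
  let L := Localization.Away g
  let π : B →+* L := algebraMap B L
  have hgu : IsUnit (π g) := IsLocalization.Away.algebraMap_isUnit g
  have hgu' : IsUnit (π (ρ₁ u).im * π (ρ₂ u).im) := by rw [← map_mul]; exact hgu
  have e (f : B) : π f = 1 * 1 * π f := by ring
  let η₁ := (Dbl.map π 1 _ (e F₁.f)).comp ρ₁
  let η₂ := (Dbl.map π 1 _ (e F₂.f)).comp ρ₂
  have hη₁ : η₁.comp (M.invol hq D) = (Dbl.conj _).comp η₁ := by
    rw [RingHom.comp_assoc, hρ₁, ← RingHom.comp_assoc, Dbl.map_comp_conj, RingHom.comp_assoc]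
  have hη₂ : η₂.comp (M.invol hq D) = (Dbl.conj _).comp η₂ := by
    rw [RingHom.comp_assoc, hρ₂, ← RingHom.comp_assoc, Dbl.map_comp_conj, RingHom.comp_assoc]
  have him₁ : (η₁ u).im = π (ρ₁ u).im := by simp [η₁]
  have him₂ : (η₂ u).im = π (ρ₂ u).im := by simp [η₂]
  have h2 : IsUnit (2 : L) := by
    simpa only [map_ofNat] using (Family.isUnit_two_of_hom F₁.t).map π
  have hI := M.isInvolutionRing hq r D
  have heven : evenHom hI h2 η₁ hη₁ = evenHom hI h2 η₂ hη₂ := by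
    refine RingHom.ext fun c => ?_
    have h3 := congr($(he₁.trans he₂.symm) c)
    change (ρ₁ ((q.app D).hom c)).re = (ρ₂ ((q.app D).hom c)).re at h3
    change (Dbl.map π 1 _ (e F₁.f) (ρ₁ ((q.app D).hom c))).re =
      (Dbl.map π 1 _ (e F₂.f) (ρ₂ ((q.app D).hom c))).re
    rw [Dbl.re_map, Dbl.re_map, h3]
  have hfL : π F₂.f ∈ L⁰ := IsLocalization.map_nonZeroDivisors_le (Submonoid.powers g) L
    (Submonoid.mem_map_of_mem _ hf)
  obtain ⟨d, hd, hdu, hη⟩ := exists_map_comp_eq hI h2 hη₁ hη₂ heven hfL hu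
    (by rw [him₁]; exact isUnit_of_mul_isUnit_left hgu')
    (by rw [him₂]; exact isUnit_of_mul_isUnit_right hgu')
  have ht : F₁.t = F₂.t := (h₁.comp_eq hr).symm.trans (h₂.comp_eq hr)
  refine Family.classify_of_map_comp hv (by rw [← Family.map_t, ← Family.map_t, ht]) d hdu hd ?_
  have hj {F : Family s B} {ρ : Γ(M.X, q ⁻¹ᵁ D) →+* Dbl B F.f}
      (hF : sp ρ ≫ hD'.fromSpec = M.pair F) : (F.baseChange π).j =
        sp ((Dbl.map π 1 _ (e F.f)).comp ρ) ≫ hD'.fromSpec ≫ M.a := by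
    rw [← sp_comp_sp, Category.assoc, ← Category.assoc (sp ρ), hF, pair_a]
  rw [hj hF₁, hj hF₂, sp_comp_sp_assoc]
  exact congrArg (fun z => sp z ≫ hD'.fromSpec ≫ M.a) hη

end SwapSquare

end Families

/-! ### Construction of families from morphisms to the quotient -/

section Algebra

variable {R₀ R B : Type} [CommRing R₀] [CommRing R] [CommRing B] {i : R₀ →+* R} {τ : R →+* R}

/-- If the products of the elements of `G` generate the ideal of a nonzerodivisor `f` of `B`, then
locally `f` is the image of the square of an element of `G`, up to a unit: if it is not that of
`u²` or `v²`, but of `u v`, then it is that of `(u + v)²`. -/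
lemma IsInvolutionRing.exists_sq_eq_mul (h : IsInvolutionRing i τ) (φ : R₀ →+* B) {G : Set R}
    (hG : G ⊆ oddSet τ) (hadd : ∀ u ∈ G, ∀ v ∈ G, u + v ∈ G) {f : B} (hf : f ∈ B⁰)
    (hI : (productIdeal i G).map φ = Ideal.span {f}) (t : Ideal B) [t.IsPrime] :
    ∃ u ∈ G, ∃ c m, i c = u * u ∧ φ c = m * f ∧ m ∉ t := by
  have hf := mem_nonZeroDivisors_iff_right.1 hf
  have cancel {x y : B} (hxy : x * f = y * f) : x = y :=
    sub_eq_zero.1 (hf _ (by rw [sub_mul, hxy, sub_self]))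
  have ex {u v} (hu : u ∈ G) (hv : v ∈ G) : ∃ c m, i c = u * v ∧ φ c = m * f := by
    obtain ⟨c, hc⟩ := h.exists_mul (hG hu) (hG hv)
    have hmem : φ c ∈ Ideal.span {f} := by
      rw [← hI]; exact Ideal.mem_map_of_mem φ (Ideal.subset_span ⟨u, hu, v, hv, hc⟩)
    obtain ⟨m, hm⟩ := Ideal.mem_span_singleton'.1 hmem
    exact ⟨c, m, hc, hm.symm⟩
  by_contra! H
  have key : ∀ u ∈ G, ∀ v ∈ G, ∀ c m, i c = u * v → φ c = m * f → m ∈ t := by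
    intro u hu v hv c m hc hm
    obtain ⟨c₁, m₁, hc₁, hm₁⟩ := ex hu hu
    obtain ⟨c₂, m₂, hc₂, hm₂⟩ := ex hv hv
    have h1 := H u hu c₁ m₁ hc₁ hm₁
    have h2 := H v hv c₂ m₂ hc₂ hm₂
    have h3 := H _ (hadd u hu v hv) (c₁ + (2 * c + c₂)) (m₁ + (2 * m + m₂))
      (by simp only [map_add, map_mul, map_ofNat, hc₁, hc₂, hc]; ring)
      (by simp only [map_add, map_mul, map_ofNat, hm₁, hm₂, hm]; ring)
    have h4 : 2 * m ∈ t :=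
      (Submodule.add_mem_iff_left _ h2).1 ((Submodule.add_mem_iff_right _ h1).1 h3)
    have h2B : IsUnit (2 : B) := by simpa only [map_ofNat] using h.two.map φ
    exact (Ideal.unit_mul_mem_iff_mem _ h2B).1 h4
  have hle : Ideal.span {f} ≤ t * Ideal.span {f} := by
    refine hI.symm.le.trans (Ideal.map_le_iff_le_comap.2 (Ideal.span_le.2 ?_))
    rintro c ⟨u, hu, v, hv, hc⟩
    obtain ⟨c', m, hc', hm⟩ := ex hu hv
    obtain rfl : c = c' := h.inj (hc.trans hc'.symm)
    rw [SetLike.mem_coe, Ideal.mem_comap, hm]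
    exact Ideal.mul_mem_mul (key u hu v hv c m hc' hm) (Ideal.mem_span_singleton_self f)
  obtain ⟨m, hm, hmf⟩ := Ideal.mem_mul_span_singleton.1 (hle (Ideal.mem_span_singleton_self f))
  have : m = 1 := cancel (by rw [hmf, one_mul])
  exact Ideal.IsPrime.one_notMem ‹t.IsPrime› (this ▸ hm)

/-- In the situation of `exists_sq_eq_mul`, the multiplier can be made a unit by localization. -/
lemma IsInvolutionRing.exists_away (h : IsInvolutionRing i τ) (φ : R₀ →+* B) {G : Set R}
    (hG : G ⊆ oddSet τ) (hadd : ∀ u ∈ G, ∀ v ∈ G, u + v ∈ G) {f : B} (hf : f ∈ B⁰)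
    (hI : (productIdeal i G).map φ = Ideal.span {f}) (t : Ideal B) [t.IsPrime] :
    ∃ u ∈ G, ∃ c, i c = u * u ∧ ∃ m ∉ t, algebraMap B (Localization.Away m) (φ c) ∈
      (Localization.Away m)⁰ ∧ (productIdeal i G).map ((algebraMap B (Localization.Away m)).comp φ) ≤
        Ideal.span {algebraMap B (Localization.Away m) (φ c)} ∧
      (IsUnit f → IsUnit (algebraMap B (Localization.Away m) (φ c))) := by
  obtain ⟨u, hu, c, m, hc, hm, hmt⟩ := h.exists_sq_eq_mul φ hG hadd hf hI t
  let π := algebraMap B (Localization.Away m)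
  have hmu : IsUnit (π m) := IsLocalization.Away.algebraMap_isUnit m
  have hcm : π (φ c) = π m * π f := by rw [hm, map_mul]
  have hfL : π f ∈ (Localization.Away m)⁰ :=
    IsLocalization.map_nonZeroDivisors_le (Submonoid.powers m) _ (Submonoid.mem_map_of_mem _ hf)
  refine ⟨u, hu, c, hc, m, hmt, ?_, ?_, fun hfu => ?_⟩
  · exact hcm ▸ mul_mem hmu.mem_nonZeroDivisors hfL
  · rw [← Ideal.map_map, hI, Ideal.map_span, Set.image_singleton]
    exact (Ideal.span_singleton_le_span_singleton.2 (hcm ▸ (hmu.mul_left_dvd.2 dvd_rfl)))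
  · exact hcm ▸ hmu.mul (hfu.map π)

end Algebra

lemma exists_away_sp_comp_fromSpec {B : Type} [CommRing B] {Y : Scheme.{0}} (k : Spec (.of B) ⟶ Y)
    {D : Y.Opens} (hD : IsAffineOpen D) (t : Spec (.of B)) (h : k t ∈ D) :
    ∃ g ∉ t.asIdeal, ∃ φ : Γ(Y, D) →+* Localization.Away g,
      sp φ ≫ hD.fromSpec = away g ≫ k := by
  obtain ⟨g, hg, hgD⟩ := exists_basicOpen_le (W := k ⁻¹ᵁ D) h
  exact ⟨g, hg, exists_sp_comp_fromSpec hD fun x => by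
    rw [Scheme.Hom.comp_apply]; exact hgD ⟨x, rfl⟩⟩

namespace SwapSquare

variable {S : Scheme.{0}} {s : S ⟶ Spec (.of ℂ)} {B C : Type} [CommRing B] [CommRing C]
  {M : SwapSquare s} {Q : Scheme.{0}} {q : M.X ⟶ Q} (hq : IsInvolutionQuotient M.σ q)
  {r : Q ⟶ Spec (.of ℂ)} (hr : q ≫ r = M.a ≫ s) {D : Q.Opens} (hD : IsAffineOpen D)
  (hD' : IsAffineOpen (q ⁻¹ᵁ D))

include hq

/-- A homomorphism is invariant under the involution if its values on the two factors agree. -/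
lemma comp_invol_eq_of_comp_eq {α : Γ(M.X, q ⁻¹ᵁ D) →+* C}
    (h : sp α ≫ hD'.fromSpec ≫ M.b = sp α ≫ hD'.fromSpec ≫ M.a) :
    α.comp (M.invol hq D) = α := by
  refine sp_comp_fromSpec_injective hD' ?_
  rw [← sp_comp_sp, Category.assoc, M.sp_invol_fromSpec hq hD']
  apply M.hom_ext
  · simp only [Category.assoc, M.σ_a, h]
  · simp only [Category.assoc, M.σ_b, h]

include hr

/-- A morphism `φ` from the invariants is the Hilbert-Chow morphism of a family, if the ideal of
products of odd functions becomes the ideal of a nonzerodivisor that is the image of a square `u²`,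
and if equivariant extensions of `φ` are distinguished by their values on the first factor. -/
lemma exists_family {k : Spec (.of B) ⟶ Q} {φ : Γ(Q, D) →+* B} (hφ : sp φ ≫ hD.fromSpec = k)
    {u : Γ(M.X, q ⁻¹ᵁ D)} (hu : u ∈ oddSet (M.invol hq D)) {c : Γ(Q, D)}
    (hc : (q.app D).hom c = u * u) (hcf : φ c ∈ B⁰)
    (hI : (productIdeal (q.app D).hom (oddSet (M.invol hq D))).map φ ≤ Ideal.span {φ c})
    (hmono : ∀ (E : Type) [CommRing E] (α β : Γ(M.X, q ⁻¹ᵁ D) →+* E) (ε : B →+* E),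
      α.comp (q.app D).hom = ε.comp φ → β.comp (q.app D).hom = ε.comp φ →
      sp α ≫ hD'.fromSpec ≫ M.a = sp β ≫ hD'.fromSpec ≫ M.a → α u = β u) :
    ∃ F : Family s B, M.HC q F k := by
  obtain ⟨ρ, hρτ, hρi, hρu⟩ :=
    exists_equivariant_hom (M.isInvolutionRing hq r D) φ hu hc hcf hI
  have hk : sp ρ ≫ hD'.fromSpec ≫ q = Dbl.proj (φ c) ≫ k := by
    rw [← sp_app_fromSpec hD hD', sp_comp_sp_assoc, hρi, ← sp_comp_sp, Category.assoc, hφ]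
  let F : Family s B := {
    t := k ≫ r
    f := φ c
    j := sp ρ ≫ hD'.fromSpec ≫ M.a
    w := by
      rw [Category.assoc, Category.assoc, ← hr, ← Category.assoc _ k, ← hk]
      simp only [Category.assoc]
    mono E _ g₁ g₂ h₁ h₂ := by
      refine Dbl.hom_ext h₁ ?_
      rw [sp_comp_sp_assoc, sp_comp_sp_assoc] at h₂
      rw [← hρu]
      refine hmono E (g₁.comp ρ) (g₂.comp ρ) (g₁.comp (algebraMap B _)) ?_ ?_ h₂
      · rw [RingHom.comp_assoc, hρi, RingHom.comp_assoc]
      · rw [h₁, RingHom.comp_assoc, hρi, RingHom.comp_assoc] }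
  refine ⟨F, ?_⟩
  have hpair : M.pair F = sp ρ ≫ hD'.fromSpec := by
    apply M.hom_ext
    · rw [pair_a, Category.assoc]
    · rw [pair_b, Category.assoc]
      change Dbl.conjSpec (φ c) ≫ sp ρ ≫ hD'.fromSpec ≫ M.a = _
      rw [sp_comp_sp_assoc, ← hρτ, ← sp_comp_sp, Category.assoc,
        ← Category.assoc (sp (M.invol hq D)), M.sp_invol_fromSpec hq hD', Category.assoc, M.σ_a]
  rw [HC, hpair, Category.assoc, hk]

include hD'

/-- A morphism to the locus of the quotient where the square of an odd function `u` is invertible is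
the Hilbert-Chow morphism of a family. -/
lemma exists_family_of_isUnit {k : Spec (.of B) ⟶ Q} {φ : Γ(Q, D) →+* B}
    (hφ : sp φ ≫ hD.fromSpec = k) {u : Γ(M.X, q ⁻¹ᵁ D)} (hu : u ∈ oddSet (M.invol hq D))
    {c : Γ(Q, D)} (hc : (q.app D).hom c = u * u) (hcu : IsUnit (φ c)) :
    ∃ F : Family s B, M.HC q F k := by
  have h := M.isInvolutionRing hq r D
  refine exists_family hq hr hD hD' hφ hu hc hcu.mem_nonZeroDivisors (by
    rw [Ideal.span_singleton_eq_top.2 hcu]; exact le_top) fun E _ α β ε hα hβ hαβ => ?_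
  have hαi (z) : α ((q.app D).hom z) = ε (φ z) := congr($hα z)
  have hβi (z) : β ((q.app D).hom z) = ε (φ z) := congr($hβ z)
  have h2E : IsUnit (2 : E) := by simpa only [map_ofNat] using (h.two.map φ).map ε
  have hαu : α u * α u = ε (φ c) := by rw [← map_mul, ← hc, hαi]
  have hβu : β u * β u = ε (φ c) := by rw [← map_mul, ← hc, hβi]
  -- where `α u = - β u`, the homomorphism `β` is conjugate to `α`, so both are on the diagonal
  let π := Ideal.Quotient.mk (Ideal.span {α u + β u})
  have hsum : π (α u) = - π (β u) := by
    rw [eq_neg_iff_add_eq_zero, ← map_add]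
    exact Ideal.Quotient.eq_zero_iff_mem.2 (Ideal.mem_span_singleton_self _)
  have hunit : IsUnit (π (α u)) := by
    have : IsUnit (α u * α u) := by rw [hαu]; exact hcu.map ε
    exact (isUnit_of_mul_isUnit_left this).map π
  have hconj : (π.comp α).comp (M.invol hq D) = π.comp β := by
    refine RingHom.ext fun z => ?_
    obtain ⟨e, w, hw, rfl⟩ := h.exists_even_odd z
    obtain ⟨p, hp⟩ := h.exists_mul hw hu
    have h1 : π (α w) * π (α u) = π (β w) * π (β u) := by
      rw [← map_mul, ← map_mul, ← map_mul, ← map_mul, ← hp, hαi, hβi]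
    have h2 : π (β w) = - π (α w) := by
      refine hunit.mul_right_injective (?_ : π (α u) * _ = π (α u) * _)
      linear_combination π (β w) * hsum + h1
    have hw' : M.invol hq D w = - w := hw
    have he : M.invol hq D ((q.app D).hom e) = (q.app D).hom e := h.map_i e
    simp only [RingHom.comp_apply, map_add, he, hw', map_neg, h2]
    rw [hαi, hβi]
  have h3 := M.comp_invol_eq_of_comp_eq hq hD' (α := π.comp α) (by
    rw [← M.σ_a, ← Category.assoc hD'.fromSpec, ← M.sp_invol_fromSpec hq hD', Category.assoc,
      sp_comp_sp_assoc, hconj, ← sp_comp_sp, ← sp_comp_sp, Category.assoc, Category.assoc, hαβ])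
  have hu' : M.invol hq D u = - u := hu
  have h4 := congr($h3 u)
  simp only [RingHom.comp_apply, hu', map_neg] at h4
  have h5 : π (α u) = 0 := by
    have h2π : IsUnit (2 : E ⧸ Ideal.span {α u + β u}) := by simpa only [map_ofNat] using h2E.map π
    exact h2π.mul_right_eq_zero.1 (by linear_combination - h4)
  have h6 : IsUnit (α u + β u) := by
    rw [← Ideal.span_singleton_eq_top, ← Ideal.Quotient.subsingleton_iff]
    rw [h5] at hunit
    exact isUnit_zero_iff.1 hunit |> fun h => subsingleton_of_zero_eq_one h
  exact h6.mul_right_injective (by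
    change (α u + β u) * α u = (α u + β u) * β u
    linear_combination hαu - hβu)

omit hr in
/-- Near the diagonal, the odd functions are generated by the differences `g(p) - g(p')`. -/
lemma odd_subset_span_delta (r : Q ⟶ Spec (.of ℂ)) {U : S.Opens} (hU : IsAffineOpen U)
    (ha : q ⁻¹ᵁ D ≤ M.a ⁻¹ᵁ U) (hb : q ⁻¹ᵁ D ≤ M.b ⁻¹ᵁ U) :
    oddSet (M.invol hq D) ⊆ Ideal.span (Set.range (M.delta q ha hb)) := by
  intro u hu
  let χ := Ideal.Quotient.mk (Ideal.span (Set.range (M.delta q ha hb)))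
  have hχ : sp χ ≫ hD'.fromSpec ≫ M.b = sp χ ≫ hD'.fromSpec ≫ M.a := by
    rw [← hU.SpecMap_appLE_fromSpec M.b hD' hb, ← hU.SpecMap_appLE_fromSpec M.a hD' ha]
    change sp χ ≫ sp _ ≫ _ = sp χ ≫ sp _ ≫ _
    rw [sp_comp_sp_assoc, sp_comp_sp_assoc]
    congr 2
    refine RingHom.ext fun g => ?_
    have : χ (M.delta q ha hb g) = 0 :=
      Ideal.Quotient.eq_zero_iff_mem.2 (Ideal.subset_span ⟨g, rfl⟩)
    rw [delta, map_sub] at this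
    exact (sub_eq_zero.1 this).symm
  have h3 := congr($(M.comp_invol_eq_of_comp_eq hq hD' hχ) u)
  have hu' : M.invol hq D u = - u := hu
  simp only [RingHom.comp_apply, hu', map_neg] at h3
  have h2 : IsUnit (2 : Γ(M.X, q ⁻¹ᵁ D) ⧸ Ideal.span (Set.range (M.delta q ha hb))) := by
    simpa only [map_ofNat] using ((M.isInvolutionRing hq r D).two.map (q.app D).hom).map χ
  exact Ideal.Quotient.eq_zero_iff_mem.1 (h2.mul_right_eq_zero.1 (by linear_combination - h3))

omit hr in
/-- On the functions near the diagonal, the values on the first factor and on the invariants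
determine those on the odd functions `g(p) - g(p')`. -/
lemma apply_delta_eq {U : S.Opens} (hU : IsAffineOpen U) (ha : q ⁻¹ᵁ D ≤ M.a ⁻¹ᵁ U)
    (hb : q ⁻¹ᵁ D ≤ M.b ⁻¹ᵁ U) (r : Q ⟶ Spec (.of ℂ)) {α β : Γ(M.X, q ⁻¹ᵁ D) →+* C}
    (h : α.comp (q.app D).hom = β.comp (q.app D).hom)
    (hab : sp α ≫ hD'.fromSpec ≫ M.a = sp β ≫ hD'.fromSpec ≫ M.a) (g : Γ(S, U)) :
    α (M.delta q ha hb g) = β (M.delta q ha hb g) := by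
  have h1 : α.comp (M.a.appLE U (q ⁻¹ᵁ D) ha).hom = β.comp (M.a.appLE U (q ⁻¹ᵁ D) ha).hom := by
    refine sp_comp_fromSpec_injective hU ?_
    rw [← sp_comp_sp, ← sp_comp_sp, Category.assoc, Category.assoc]
    have h2 : sp (M.a.appLE U (q ⁻¹ᵁ D) ha).hom ≫ hU.fromSpec = hD'.fromSpec ≫ M.a :=
      hU.SpecMap_appLE_fromSpec M.a hD' ha
    rw [h2, hab]
  let x := (M.a.appLE U (q ⁻¹ᵁ D) ha).hom g
  let y := (M.b.appLE U (q ⁻¹ᵁ D) hb).hom g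
  obtain ⟨e, he⟩ := ((M.isInvolutionRing hq r D).range (x + y)).2 (by
    rw [map_add, M.invol_appLE_a hq ha hb, M.invol_appLE_b hq ha hb, add_comm])
  have h3 : α x = β x := congr($h1 g)
  have h4 : α x + α y = β x + β y := by
    rw [← map_add, ← map_add, ← he]; exact congr($h e)
  have h5 : M.delta q ha hb g = x - y := rfl
  rw [h5, map_sub, map_sub]
  linear_combination 2 * h3 - h4

omit hD' in
/-- A morphism to the quotient, under which the inverse image of the ideal of the singular locus is
generated by a nonzerodivisor, is locally the Hilbert-Chow morphism of a family. -/
lemma exists_hc_of_comap [IsSeparated s] [IsReduced S] [SmoothOfRelativeDimension 2 s]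
    (k : Spec (.of B) ⟶ Q) {f : B} (hf : f ∈ B⁰)
    (hk : (singularIdeal r).comap k = specIdeal (Ideal.span {f})) (t : Spec (.of B)) :
    ∃ (C : Type) (_ : CommRing C) (χ : B →+* C) (F : Family s C),
      IsOpenImmersion (sp χ) ∧ t ∈ Set.range (sp χ) ∧ M.HC q F (sp χ ≫ k) := by
  have := hq.isAffineHom
  have hsurj : Surjective q := ⟨hq.isQuotientMap.surjective⟩
  -- it suffices to find a chart `D` that contains the image of the point, and a set `G` of odd
  -- functions on it that generates the ideal
  suffices H : ∃ (g : B) (_ : g ∉ t.asIdeal) (D : Q.Opens) (hD : IsAffineOpen D)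
      (φ : Γ(Q, D) →+* Localization.Away g) (G : Set Γ(M.X, q ⁻¹ᵁ D)),
      sp φ ≫ hD.fromSpec = away g ≫ k ∧ G ⊆ oddSet (M.invol hq D) ∧
      (∀ u ∈ G, ∀ v ∈ G, u + v ∈ G) ∧
      productIdeal (q.app D).hom G = productIdeal (q.app D).hom (oddSet (M.invol hq D)) ∧
      (IsUnit (algebraMap B (Localization.Away g) f) ∨ ∀ (E : Type) [CommRing E]
        (α β : Γ(M.X, q ⁻¹ᵁ D) →+* E),
        α.comp (q.app D).hom = β.comp (q.app D).hom →
        sp α ≫ (hD.preimage q).fromSpec ≫ M.a = sp β ≫ (hD.preimage q).fromSpec ≫ M.a →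
        ∀ u ∈ G, α u = β u) by
    obtain ⟨g, hg, D, hD, φ, G, hφ, hG, hadd, hGI, hor⟩ := H
    obtain ⟨t, rfl⟩ := mem_range_away.2 hg
    have hfL : algebraMap B (Localization.Away g) f ∈ (Localization.Away g)⁰ :=
      IsLocalization.map_nonZeroDivisors_le (Submonoid.powers g) _ (Submonoid.mem_map_of_mem _ hf)
    have hI : (productIdeal (q.app D).hom G).map φ =
        Ideal.span {algebraMap B (Localization.Away g) f} := by
      rw [hGI, ← M.singularIdeal_ideal hq hr hD]
      apply specIdeal_injective
      rw [← comap_sp_fromSpec, hφ, Scheme.IdealSheafData.comap_comp, hk, comap_specIdeal,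
        Ideal.map_span, Set.image_singleton]
    have := t.2
    obtain ⟨u, hu, c, hc, m, hm, hcm, hIm, hunit⟩ :=
      (M.isInvolutionRing hq r D).exists_away φ hG hadd hfL hI t.asIdeal
    obtain ⟨t, rfl⟩ := mem_range_away.2 hm
    have hφ' : sp ((algebraMap _ (Localization.Away m)).comp φ) ≫ hD.fromSpec =
        away m ≫ away g ≫ k := by
      rw [← sp_comp_sp, Category.assoc, hφ]
    obtain ⟨F, hF⟩ : ∃ F : Family s (Localization.Away m), M.HC q F (away m ≫ away g ≫ k) := by
      rcases hor with hfu | hmono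
      · exact exists_family_of_isUnit hq hr hD (hD.preimage q) hφ' (hG hu) hc (hunit hfu)
      · refine exists_family hq hr hD (hD.preimage q) hφ' (hG hu) hc hcm (by rwa [← hGI])
          fun E _ α β ε h₁ h₂ h₃ => hmono E α β (h₁.trans h₂.symm) h₃ u hu
    refine ⟨_, _, (algebraMap _ (Localization.Away m)).comp (algebraMap B (Localization.Away g)),
      F, ?_, ⟨t, ?_⟩, ?_⟩
    · rw [← sp_comp_sp]; infer_instance
    · rw [← sp_comp_sp, Scheme.Hom.comp_apply]
    · rwa [← sp_comp_sp, Category.assoc]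
  obtain ⟨D₀, hD₀, htD₀, -⟩ := exists_isAffineOpen_mem_and_subset (U := ⊤) (x := k t) trivial
  -- at a zero of `f`, the image point is on the diagonal, and `G` consists of the differences
  -- `g(p) - g(p')`; elsewhere `G` consists of all odd functions
  by_cases hft : f ∈ t.asIdeal
  · obtain ⟨y, hy⟩ : ∃ y, k t = q (M.diag y) := by
      obtain ⟨g, hg, φ, hφ⟩ := exists_away_sp_comp_fromSpec k hD₀ t htD₀
      obtain ⟨t, rfl⟩ := mem_range_away.2 hg
      have hI : (productIdeal (q.app D₀).hom (oddSet (M.invol hq D₀))).map φ =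
          Ideal.span {algebraMap B (Localization.Away g) f} := by
        rw [← M.singularIdeal_ideal hq hr hD₀]
        apply specIdeal_injective
        rw [← comap_sp_fromSpec, hφ, Scheme.IdealSheafData.comap_comp, hk, comap_specIdeal,
          Ideal.map_span, Set.image_singleton]
      obtain ⟨y, hy⟩ := M.exists_eq_of_productIdeal_le hq r hD₀ (hD₀.preimage q) (sp φ t) (by
        refine Ideal.map_le_iff_le_comap.1 (hI.le.trans ((Ideal.span_singleton_le_iff_mem _).2 ?_))
        exact hft)
      refine ⟨y, hy ▸ ?_⟩
      exact congr($hφ.symm t)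
    obtain ⟨U, hU, hyU, -⟩ := exists_isAffineOpen_mem_and_subset (U := ⊤) (x := y) trivial
    obtain ⟨D, hD, hyD, ha, hb⟩ := M.exists_isAffineOpen_le hq hyU
    obtain ⟨g, hg, φ, hφ⟩ := exists_away_sp_comp_fromSpec k hD t (hy ▸ hyD)
    have hG : Set.range (M.delta q ha hb) ⊆ oddSet (M.invol hq D) := by
      rintro _ ⟨z, rfl⟩
      exact M.delta_mem_oddSet hq ha hb z
    refine ⟨g, hg, D, hD, φ, Set.range (M.delta q ha hb), hφ, hG, ?_, ?_, Or.inr ?_⟩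
    · rintro _ ⟨z, rfl⟩ _ ⟨z', rfl⟩
      exact ⟨z + z', by simp only [delta, map_add]; ring⟩
    · exact (M.isInvolutionRing hq r D).productIdeal_eq hG
        (odd_subset_span_delta hq (hD.preimage q) r hU ha hb)
    · rintro E _ α β h₁ h₂ _ ⟨z, rfl⟩
      exact apply_delta_eq hq (hD.preimage q) hU ha hb r h₁ h₂ z
  · obtain ⟨g, hg, hgD⟩ := exists_basicOpen_le (W := k ⁻¹ᵁ D₀) htD₀
    obtain ⟨φ, hφ⟩ := exists_sp_comp_fromSpec hD₀ (w := away (g * f) ≫ k) fun x => by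
      rw [Scheme.Hom.comp_apply]
      have h1 : g * f ∉ (away (g * f) x).asIdeal := mem_range_away.1 ⟨x, rfl⟩
      exact hgD (mem_range_away.2 fun h => h1 (Ideal.mul_mem_right _ _ h))
    refine ⟨g * f, fun h => (t.2.mem_or_mem h).elim hg hft, D₀, hD₀, φ, _, hφ, subset_rfl, ?_, rfl,
      Or.inl (isUnit_of_mul_isUnit_right (x := algebraMap B _ g) ?_)⟩
    · intro u hu v hv
      have hu : M.invol hq D₀ u = - u := hu
      have hv : M.invol hq D₀ v = - v := hv
      change M.invol hq D₀ (u + v) = - (u + v)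
      rw [map_add, hu, hv]; ring
    · rw [← map_mul]; exact IsLocalization.Away.algebraMap_isUnit (g * f)

end SwapSquare

/-! ### Discriminants on the Hilbert scheme -/

section Algebra

variable {K A B : Type} [CommRing K] [CommRing A] [CommRing B] [Algebra K A] [Algebra K B]

/-- If the imaginary parts of the functions generate the unit ideal, then at a point of the
discriminant the imaginary part of a coordinate does not vanish: modulo the point, the imaginary
part is a derivation, which is determined by its values on the coordinates. -/
lemma Coordinates.exists_im_notMem (X : Coordinates K A) {f : B} (ν : A →ₐ[K] Dbl B f)
    (hν : Ideal.span (Set.range fun a => (ν a).im) = ⊤) (p : Ideal B) [hp : p.IsPrime]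
    (hf : f ∈ p) : ∃ i, (ν (X.x i)).im ∉ p := by
  by_contra! H
  refine hp.ne_top (top_le_iff.1 (hν ▸ Ideal.span_le.2 ?_))
  rintro _ ⟨a, rfl⟩
  let π := Ideal.Quotient.mk p
  have hπf : π f = 0 := Ideal.Quotient.eq_zero_iff_mem.2 hf
  let ρ : A →+* B ⧸ p := (Dbl.eval (f := f) π (e := 0) (by rw [hπf, mul_zero])).comp ν
  have hρ (a) : ρ a = π (ν a).re := by
    simp [ρ, Dbl.eval_apply]
  let _ : Module A (B ⧸ p) := Module.compHom _ ρ
  have hsmul (a : A) (z : B ⧸ p) : a • z = ρ a * z := rfl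
  have hK (k : K) : ν (algebraMap K A k) = algebraMap B _ (algebraMap K B k) := by
    rw [ν.commutes]; exact IsScalarTower.algebraMap_apply K B (Dbl B f) k
  have : IsScalarTower K A (B ⧸ p) := .of_algebraMap_smul fun k z => by
    rw [hsmul, hρ, hK, QuadraticAlgebra.algebraMap_re, Algebra.smul_def]; rfl
  let δ : Derivation K A (B ⧸ p) := {
    toFun a := π (ν a).im
    map_add' a b := by simp
    map_smul' k a := by
      rw [map_smul, QuadraticAlgebra.im_smul]; rfl
    map_one_eq_zero' := by
      change π (ν 1).im = 0
      rw [map_one, QuadraticAlgebra.im_one, map_zero]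
    leibniz' a b := by
      simp [hsmul, hρ]; ring }
  have hδ : δ = 0 := by
    rw [← δ.liftKaehlerDifferential_comp]
    have h0 : δ.liftKaehlerDifferential = 0 := X.basis.ext fun i => by
      rw [X.basis_apply, Derivation.liftKaehlerDifferential_comp_D]
      exact Ideal.Quotient.eq_zero_iff_mem.2 (H i)
    ext; simp [h0]
  exact Ideal.Quotient.eq_zero_iff_mem.1 congr($hδ a)

/-- A nonzerodivisor may be detected on any ring through which a localization factors. -/
lemma mem_nonZeroDivisors_of_comp_eq {L E : Type} [CommRing L] [CommRing E] {c₀ y : L}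
    {θ : L →+* E} {χ : E →+* Localization.Away c₀}
    (h : χ.comp θ = algebraMap L (Localization.Away c₀)) (hy : θ y ∈ E⁰) :
    algebraMap L (Localization.Away c₀) y ∈ (Localization.Away c₀)⁰ := by
  rw [mem_nonZeroDivisors_iff_right]
  intro x hx
  obtain ⟨n, c, hc⟩ := IsLocalization.Away.surj c₀ x
  have hu : IsUnit (algebraMap L (Localization.Away c₀) c₀) := IsLocalization.Away.algebraMap_isUnit _
  have h1 : algebraMap L (Localization.Away c₀) (c * y) = algebraMap L (Localization.Away c₀) 0 := by
    rw [map_mul, ← hc, map_zero]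
    linear_combination (algebraMap L (Localization.Away c₀) c₀) ^ n * hx
  obtain ⟨k, hk⟩ := IsLocalization.Away.exists_of_eq c₀ h1
  have h2 : θ (c₀ ^ k * c) = 0 := by
    refine mem_nonZeroDivisors_iff_right.1 hy _ ?_
    rw [← map_mul, mul_assoc, hk, mul_zero, map_zero]
  have h3 : algebraMap L (Localization.Away c₀) (c₀ ^ k * c) = 0 := by
    rw [← h, RingHom.comp_apply, h2, map_zero]
  rw [map_mul, map_pow, ← hc] at h3
  have h4 := (hu.pow k).mul_right_eq_zero.1 h3
  exact (hu.pow n).mul_left_eq_zero.1 h4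

end Algebra

lemma scal_sp_comp {B C : Type} [CommRing B] [CommRing C] (χ : B →+* C)
    (t : Spec (.of B) ⟶ Spec (.of ℂ)) : scal (sp χ ≫ t) = χ.comp (scal t) :=
  sp_comp_fromSpec_injective (isAffineOpen_top _) (by
    rw [sp_scal, ← sp_comp_sp, Category.assoc, sp_scal])

namespace Family

variable {S H : Scheme.{0}} {s : S ⟶ Spec (.of ℂ)} {B C : Type} [CommRing B] [CommRing C]
  {h : H ⟶ Spec (.of ℂ)} {Z : (pullback s h).IdealSheafData}

lemma mk_congr {t t' : Spec (.of B) ⟶ Spec (.of ℂ)} {f : B} {j j' : Spec (.of (Dbl B f)) ⟶ S}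
    {w w' m m'} (ht : t = t') (hj : j = j') :
    (⟨t, f, j, w, m⟩ : Family s B) = ⟨t', f, j', w', m'⟩ := by
  subst ht hj; rfl

lemma Classify.unique [IsSeparated s] (hH : IsHilbertScheme 2 s h Z) {F : Family s B}
    {v v' : Spec (.of B) ⟶ H} (hv : F.Classify Z v) (hv' : F.Classify Z v') : v = v' :=
  (hH.universal F.t F.emb.ker F.isPointFamily).unique hv hv'

lemma exists_classify_of_isHilbertScheme [IsSeparated s] (hH : IsHilbertScheme 2 s h Z)
    (F : Family s B) : ∃ v, F.Classify Z v :=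
  (hH.universal F.t F.emb.ker F.isPointFamily).exists

/-- If the family over a chart of the Hilbert scheme is pulled back, along a morphism from the chart
to `Spec D`, from a family over `Spec D` whose discriminant is a nonzerodivisor, then its own
discriminant is locally a nonzerodivisor: near the image point the classifying morphism of `Spec D`
factors through the chart, which makes the chart locally a retract of `Spec D`. -/
lemma Classify.exists_mem_nonZeroDivisors_of_comp [IsSeparated s] {D L : Type} [CommRing D]
    [CommRing L] {G : Family s D} {F : Family s L} (hfD : G.f ∈ D⁰) {m : Spec (.of D) ⟶ H}
    (hm : G.Classify Z m) {v' : Spec (.of L) ⟶ H} [IsOpenImmersion v'] (hF : F.Classify Z v')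
    {χ : D →+* L} (hv : v' = sp χ ≫ m) (t : Spec (.of L)) :
    ∃ (C : Type) (_ : CommRing C) (ψ : L →+* C), IsOpenImmersion (sp ψ) ∧ t ∈ Set.range (sp ψ) ∧
      ψ F.f ∈ C⁰ := by
  have hmem : m (sp χ t) ∈ v'.opensRange := by
    rw [← Scheme.Hom.comp_apply, ← hv]; exact ⟨t, rfl⟩
  obtain ⟨e, het, he⟩ := exists_basicOpen_le (W := m ⁻¹ᵁ v'.opensRange) hmem
  obtain ⟨θ, hθ⟩ := exists_sp_comp (v := v') (w := away e ≫ m) (by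
    rintro _ ⟨z, rfl⟩
    rw [Scheme.Hom.comp_apply]
    exact he ⟨z, rfl⟩)
  have hθf : θ (F.f) ∈ (Localization.Away e)⁰ := by
    have h1 : (F.baseChange θ).Classify Z (away e ≫ m) := by
      rw [← hθ]; exact hF.map _ _ _ _ _
    have h2 : (G.baseChange (algebraMap D (Localization.Away e))).Classify Z (away e ≫ m) :=
      hm.map _ _ _ _ _
    obtain ⟨-, ε, hε, hεa, -⟩ := h2.exists_hom h1
    have h3 : algebraMap D (Localization.Away e) G.f ∈ Ideal.span {θ (F.f)} :=
      span_eq_of_bijective (isUnit_two_of_hom (away e ≫ m ≫ h)) ε hεa hε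
    have h4 : algebraMap D (Localization.Away e) G.f ∈ (Localization.Away e)⁰ :=
      IsLocalization.map_nonZeroDivisors_le (Submonoid.powers e) _
        (Submonoid.mem_map_of_mem _ hfD)
    obtain ⟨z, hz⟩ := Ideal.mem_span_singleton'.1 h3
    rw [← hz] at h4
    exact (mul_mem_nonZeroDivisors.1 h4).2
  let χe : Localization.Away e →+* Localization.Away (χ e) := Localization.awayMap χ e
  have hχe : χe.comp (algebraMap D _) = (algebraMap L (Localization.Away (χ e))).comp χ :=
    IsLocalization.map_comp _
  have hθχ : χe.comp θ = algebraMap L (Localization.Away (χ e)) := by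
    refine sp_injective ((cancel_mono v').1 ?_)
    rw [← sp_comp_sp, Category.assoc, hθ, sp_comp_sp_assoc, hχe, ← sp_comp_sp, Category.assoc, ← hv]
  have het' : χ e ∉ t.asIdeal := het
  obtain ⟨t, rfl⟩ := mem_range_away.2 het'
  exact ⟨_, _, algebraMap L (Localization.Away (χ e)), inferInstance, ⟨t, rfl⟩,
    mem_nonZeroDivisors_of_comp_eq hθχ hθf⟩

/-- The homomorphism that gives a family on an affine chart, as a homomorphism of algebras. -/
def structureAlgHom {U : S.Opens} (hU : IsAffineOpen U) [Algebra Scal Γ(S, U)]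
    (hUs : algebraMap Scal Γ(S, U) = (s.appLE ⊤ U le_top).hom) (F : Family s B)
    {ν : Γ(S, U) →+* Dbl B F.f} (hν : sp ν ≫ hU.fromSpec = F.j) :
    letI : Algebra Scal B := (scal F.t).toAlgebra
    Γ(S, U) →ₐ[Scal] Dbl B F.f :=
  letI : Algebra Scal B := (scal F.t).toAlgebra
  { ν with
    commutes' c := by
      have h1 := comp_appLE_eq_scal s hU hν
      rw [F.w, scal_sp_comp, ← hUs] at h1
      exact congr($h1 c) }

/-- If the first coordinate has an invertible imaginary part, the family over a chart of the Hilbert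
scheme is pulled back from the universal double cover near every zero of its discriminant, so that
this is a nonzerodivisor there. -/
lemma Classify.exists_mem_nonZeroDivisors_of_isUnit_im [IsSeparated s]
    (hH : IsHilbertScheme 2 s h Z) {U : S.Opens} (hU : IsAffineOpen U) [Algebra Scal Γ(S, U)]
    (hUs : algebraMap Scal Γ(S, U) = (s.appLE ⊤ U le_top).hom) [Algebra.Smooth Scal Γ(S, U)]
    (X : Coordinates Scal Γ(S, U)) {F : Family s B} {v : Spec (.of B) ⟶ H} [IsOpenImmersion v]
    (hF : F.Classify Z v) {ν : Γ(S, U) →+* Dbl B F.f} (hν : sp ν ≫ hU.fromSpec = F.j)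
    (hνu : IsUnit (ν (X.x 0)).im) (t : Spec (.of B)) (hft : F.f ∈ t.asIdeal) :
    ∃ (C : Type) (_ : CommRing C) (χ : B →+* C), IsOpenImmersion (sp χ) ∧ t ∈ Set.range (sp χ) ∧
      χ F.f ∈ C⁰ := by
  have hUs' : hU.fromSpec ≫ s = sp (algebraMap Scal Γ(S, U)) ≫ (isAffineOpen_top _).fromSpec := by
    rw [hUs]; exact ((isAffineOpen_top _).SpecMap_appLE_fromSpec s hU le_top).symm
  let _ : Algebra Scal B := (scal F.t).toAlgebra
  have hB : algebraMap Scal B = scal F.t := rfl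
  let ν' := F.structureAlgHom hU hUs hν
  obtain ⟨D, _, _, fD, hfD, μ, hμ, hD⟩ := X.exists_universal_double isUnit_two_scal
  have hμK : (μ : Γ(S, U) →+* Dbl D fD).comp (algebraMap Scal Γ(S, U)) =
      (algebraMap D (Dbl D fD)).comp (algebraMap Scal D) :=
    RingHom.ext fun c => (μ.commutes c).trans (IsScalarTower.algebraMap_apply Scal D _ c)
  let G : Family s D := {
    t := sp (algebraMap Scal D) ≫ (isAffineOpen_top _).fromSpec
    f := fD
    j := sp (μ : Γ(S, U) →+* Dbl D fD) ≫ hU.fromSpec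
    w := by rw [Category.assoc, hUs', sp_comp_sp_assoc, sp_comp_sp_assoc, hμK]
    mono E _ g₁ g₂ h₁ h₂ := by
      rw [sp_comp_sp_assoc, sp_comp_sp_assoc] at h₂
      have h3 := congr($(sp_comp_fromSpec_injective hU h₂) (X.x 0))
      have h4 : μ (X.x 0) = algebraMap D _ (μ (X.x 0)).re +
          algebraMap D _ (μ (X.x 0)).im * Dbl.root fD := by ext <;> simp
      have h5 (z) : g₁ (algebraMap D _ z) = g₂ (algebraMap D _ z) := congr($h₁ z)
      refine Dbl.hom_ext h₁ ?_
      change g₁ (μ (X.x 0)) = g₂ (μ (X.x 0)) at h3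
      rw [h4, map_add, map_add, map_mul, map_mul, h5, h5] at h3
      exact ((hμ.map (algebraMap D (Dbl D fD))).map g₂).mul_right_injective (add_left_cancel h3) }
  obtain ⟨m, hm⟩ := exists_classify_of_isHilbertScheme hH G
  obtain ⟨g, hg, hDg⟩ := hD B F.f ν' hνu
  have hgt : g ∉ t.asIdeal := fun h => t.2.ne_top ((Ideal.eq_top_iff_one _).2 (by
    have h1 : g - 1 ∈ t.asIdeal := (Ideal.span_singleton_le_iff_mem _).2 hft hg
    simpa using sub_mem h h1))
  obtain ⟨t, rfl⟩ := mem_range_away.2 hgt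
  let L := Localization.Away g
  let π := algebraMap B L
  let πK : B →ₐ[Scal] L := Algebra.algHom Scal B L
  obtain ⟨χ, d, hdu, hd, hχ⟩ := hDg L πK (by rw [one_mul, one_mul]; rfl)
    (IsLocalization.Away.algebraMap_isUnit g)
  have hfam : G.map (χ : D →+* L) d (π F.f) hd hdu = F.baseChange π := by
    refine mk_congr ?_ ?_
    · change sp _ ≫ sp _ ≫ _ = sp _ ≫ F.t
      rw [← sp_scal F.t, sp_comp_sp_assoc, sp_comp_sp_assoc, ← hB]
      congr 2
      refine RingHom.ext fun c => ?_
      exact (χ.commutes c).trans (πK.commutes c).symm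
    · change sp _ ≫ sp _ ≫ _ = sp _ ≫ F.j
      rw [← hν, sp_comp_sp_assoc, sp_comp_sp_assoc]
      exact congrArg (sp · ≫ hU.fromSpec) hχ
  have hFπ : (F.baseChange π).Classify Z (away g ≫ v) := hF.map _ _ _ _ _
  have hv : away g ≫ v = sp (χ : D →+* L) ≫ m := by
    refine Classify.unique hH hFπ ?_
    rw [← hfam]; exact hm.map _ _ _ _ _
  obtain ⟨C, _, ψ, hψ, ⟨t, rfl⟩, hψf⟩ :=
    Classify.exists_mem_nonZeroDivisors_of_comp (G := G) hfD hm hFπ hv t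
  refine ⟨C, inferInstance, ψ.comp π, ?_, ⟨t, ?_⟩, hψf⟩
  · rw [← sp_comp_sp]; infer_instance
  · rw [← sp_comp_sp, Scheme.Hom.comp_apply]

/-- At a zero of the discriminant the imaginary part of one of the two coordinates does not vanish,
and the two coordinates may be exchanged. -/
lemma Classify.exists_mem_nonZeroDivisors_of_coordinates [IsSeparated s]
    (hH : IsHilbertScheme 2 s h Z) {U : S.Opens} (hU : IsAffineOpen U) [Algebra Scal Γ(S, U)]
    (hUs : algebraMap Scal Γ(S, U) = (s.appLE ⊤ U le_top).hom) [Algebra.Smooth Scal Γ(S, U)]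
    (X : Coordinates Scal Γ(S, U)) {F : Family s B} {v : Spec (.of B) ⟶ H} [IsOpenImmersion v]
    (hF : F.Classify Z v) {ν : Γ(S, U) →+* Dbl B F.f} (hν : sp ν ≫ hU.fromSpec = F.j)
    (t : Spec (.of B)) (hft : F.f ∈ t.asIdeal) :
    ∃ (C : Type) (_ : CommRing C) (χ : B →+* C), IsOpenImmersion (sp χ) ∧ t ∈ Set.range (sp χ) ∧
      χ F.f ∈ C⁰ := by
  have key (X : Coordinates Scal Γ(S, U)) (ht : (ν (X.x 0)).im ∉ t.asIdeal) :
      ∃ (C : Type) (_ : CommRing C) (χ : B →+* C), IsOpenImmersion (sp χ) ∧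
        t ∈ Set.range (sp χ) ∧ χ F.f ∈ C⁰ := by
    obtain ⟨t, rfl⟩ := mem_range_away.2 ht
    let π := algebraMap B (Localization.Away (ν (X.x 0)).im)
    have hπ : π F.f = 1 * 1 * π F.f := by ring
    obtain ⟨C, _, ψ, hψ, ⟨t, rfl⟩, hf⟩ :=
      Classify.exists_mem_nonZeroDivisors_of_isUnit_im hH hU hUs X (F := F.baseChange π)
        (v := away _ ≫ v) (hF.map _ _ _ _ _) (ν := (Dbl.map π 1 (π F.f) hπ).comp ν)
        (by rw [← sp_comp_sp, Category.assoc, hν])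
        (by
          rw [RingHom.comp_apply, Dbl.im_map, mul_one]
          exact IsLocalization.Away.algebraMap_isUnit _) t hft
    refine ⟨C, inferInstance, ψ.comp π, ?_, ⟨t, ?_⟩, hf⟩
    · rw [← sp_comp_sp]; infer_instance
    · rw [← sp_comp_sp, Scheme.Hom.comp_apply]
  have := t.2
  let _ : Algebra Scal B := (scal F.t).toAlgebra
  obtain ⟨i, hi⟩ := X.exists_im_notMem (B := B) (F.structureAlgHom hU hUs hν)
    (F.span_im_eq_top hU hν) t.asIdeal hft
  fin_cases i
  · exact key X hi
  · exact key X.swap hi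

/-- The discriminant of a family over a chart of the Hilbert scheme is locally a nonzerodivisor. -/
lemma Classify.exists_mem_nonZeroDivisors [IsSeparated s] [SmoothOfRelativeDimension 2 s]
    (hH : IsHilbertScheme 2 s h Z) {F : Family s B} {v : Spec (.of B) ⟶ H} [IsOpenImmersion v]
    (hF : F.Classify Z v) (t : Spec (.of B)) :
    ∃ (C : Type) (_ : CommRing C) (ψ : B →+* C), IsOpenImmersion (sp ψ) ∧ t ∈ Set.range (sp ψ) ∧
      ψ F.f ∈ C⁰ := by
  -- it suffices to prove this after a base change to a neighbourhood
  have red (g : B) (hg : g ∉ t.asIdeal) (H : ∀ t' : Spec (.of (Localization.Away g)),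
      away g t' = t → ∃ (C : Type) (_ : CommRing C) (ψ : Localization.Away g →+* C),
        IsOpenImmersion (sp ψ) ∧ t' ∈ Set.range (sp ψ) ∧ ψ (algebraMap B _ F.f) ∈ C⁰) :
      ∃ (C : Type) (_ : CommRing C) (ψ : B →+* C), IsOpenImmersion (sp ψ) ∧
        t ∈ Set.range (sp ψ) ∧ ψ F.f ∈ C⁰ := by
    obtain ⟨t', ht'⟩ := mem_range_away.2 hg
    obtain ⟨C, _, ψ, hψ, ⟨z, hz⟩, hf⟩ := H t' ht'
    refine ⟨C, inferInstance, ψ.comp (algebraMap B _), ?_, ⟨z, ?_⟩, hf⟩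
    · rw [← sp_comp_sp]; infer_instance
    · rw [← sp_comp_sp, Scheme.Hom.comp_apply, hz, ht']
  by_cases hft : F.f ∈ t.asIdeal
  swap
  · exact ⟨_, _, algebraMap B (Localization.Away F.f), inferInstance, mem_range_away.2 hft,
      (IsLocalization.Away.algebraMap_isUnit F.f).mem_nonZeroDivisors⟩
  obtain ⟨y, rfl⟩ := (Dbl.flat_surjective_proj F.f).2.surj t
  obtain ⟨U, hU, _, hyU, hUs, _, ⟨X⟩⟩ := exists_coordinates_chart (s := s) (F.j y)
  obtain ⟨g, hg, hgW⟩ := Dbl.exists_notMem_of_mem (F.j ⁻¹ᵁ U) y hyU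
    (by rw [Dbl.conjSpec_eq_of_mem y hft]; exact hyU)
  refine red g hg fun t' ht' => ?_
  let F' := F.baseChange (algebraMap B (Localization.Away g))
  have hF' : F'.Classify Z (away g ≫ v) := hF.map _ _ _ _ _
  obtain ⟨ν, hν⟩ := exists_sp_comp_fromSpec hU (w := F'.j) fun x => by
    rw [Scheme.Hom.comp_apply]
    refine hgW _ ?_
    rw [← Scheme.Hom.comp_apply, sp_comp_sp, Dbl.map_comp_algebraMap, ← sp_comp_sp,
      Scheme.Hom.comp_apply, ← mem_range_away]
    exact ⟨_, rfl⟩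
  have hft' : F'.f ∈ t'.asIdeal := by
    rw [← ht'] at hft; exact hft
  exact hF'.exists_mem_nonZeroDivisors_of_coordinates hH hU hUs X hν t' hft'

end Family

/-! ### The Hilbert-Chow morphism as a blow-up -/

section Charts

variable {B C : Type} [CommRing B] [CommRing C] {T Y : Scheme.{0}}

lemma exists_away_sp_comp {v : Spec (.of C) ⟶ Y} [IsOpenImmersion v] (m : Spec (.of B) ⟶ Y)
    (t : Spec (.of B)) (h : m t ∈ Set.range v) :
    ∃ g ∉ t.asIdeal, ∃ χ : C →+* Localization.Away g, sp χ ≫ v = away g ≫ m := by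
  obtain ⟨g, hg, hgv⟩ := exists_basicOpen_le (W := m ⁻¹ᵁ v.opensRange) h
  refine ⟨g, hg, exists_sp_comp ?_⟩
  rintro _ ⟨z, rfl⟩
  rw [Scheme.Hom.comp_apply]
  exact hgv ⟨z, rfl⟩

lemma map_mem_nonZeroDivisors_of_isOpenImmersion {χ : B →+* C} [hχ : IsOpenImmersion (sp χ)] {f : B}
    (hf : f ∈ B⁰) : χ f ∈ C⁰ := by
  have h1 : Flat (sp χ) := inferInstance
  rw [Flat.SpecMap_iff] at h1
  algebraize [χ]
  have h2 : Module.Flat B C := h1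
  rw [mem_nonZeroDivisors_iff_right] at hf ⊢
  exact fun r hr => eq_zero_of_flat (fun a ha => hf a (by rwa [mul_comm])) (by rwa [mul_comm] at hr)

lemma IsInvertibleIdeal.exists_away {J : T.IdealSheafData} (hJ : IsInvertibleIdeal J)
    (w : Spec (.of B) ⟶ T) [IsOpenImmersion w] (t : Spec (.of B)) :
    ∃ g ∉ t.asIdeal, ∃ f ∈ (Localization.Away g)⁰,
      J.comap (away g ≫ w) = specIdeal (Ideal.span {f}) := by
  obtain ⟨C, _, v, f, hv, hx, hf, hJv⟩ := hJ.exists_chart (w t)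
  obtain ⟨g, hg, χ, hχ⟩ := exists_away_sp_comp w t hx
  have h1 : IsOpenImmersion (sp χ ≫ v) := by rw [hχ]; infer_instance
  have h2 : IsOpenImmersion (sp χ) := IsOpenImmersion.of_comp _ v
  refine ⟨g, hg, χ f, map_mem_nonZeroDivisors_of_isOpenImmersion hf, ?_⟩
  rw [← hχ, Scheme.IdealSheafData.comap_comp, hJv, comap_specIdeal, Ideal.map_span,
    Set.image_singleton]

end Charts

namespace SwapSquare

variable {S H : Scheme.{0}} {s : S ⟶ Spec (.of ℂ)} {B C : Type} [CommRing B] [CommRing C]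
  [IsSeparated s] [SmoothOfRelativeDimension 2 s]
  {M : SwapSquare s} {Q : Scheme.{0}} {q : M.X ⟶ Q} (hq : IsInvolutionQuotient M.σ q)
  {r : Q ⟶ Spec (.of ℂ)} (hr : q ≫ r = M.a ≫ s)
  {h : H ⟶ Spec (.of ℂ)} {Z : (pullback s h).IdealSheafData} (hH : IsHilbertScheme 2 s h Z)

include hq hH

/-- The Hilbert scheme is covered by charts over which the universal family is a double cover whose
discriminant is a nonzerodivisor, and which the Hilbert-Chow morphism maps to an affine open of the
quotient. -/
lemma exists_hilbertChow_chart (r : Q ⟶ Spec (.of ℂ)) (x : H) :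
    ∃ (B : Type) (_ : CommRing B) (v : Spec (.of B) ⟶ H) (F : Family s B) (k : Spec (.of B) ⟶ Q)
      (D : Q.Opens) (hD : IsAffineOpen D) (φ : Γ(Q, D) →+* B), IsOpenImmersion v ∧
      x ∈ Set.range v ∧ F.Classify Z v ∧ M.HC q F k ∧ sp φ ≫ hD.fromSpec = k ∧ F.f ∈ B⁰ := by
  obtain ⟨B, _, v, F, hv, ⟨t, rfl⟩, hF⟩ := exists_classify hH.family x
  obtain ⟨g, hg, k, hk⟩ := M.exists_hc hq r F t
  obtain ⟨t, rfl⟩ := mem_range_away.2 hg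
  obtain ⟨D, hD, htD, -⟩ := exists_isAffineOpen_mem_and_subset (U := ⊤) (x := k t) trivial
  obtain ⟨g', hg', φ, hφ⟩ := exists_away_sp_comp_fromSpec k hD t htD
  obtain ⟨t, rfl⟩ := mem_range_away.2 hg'
  let F₁ := F.baseChange (algebraMap B (Localization.Away g))
  have hF₁ : F₁.Classify Z (away g ≫ v) := hF.map _ _ _ _ _
  have hk₁ : M.HC q F₁ k := hk
  let F₂ := F₁.baseChange (algebraMap _ (Localization.Away g'))
  have hF₂ : F₂.Classify Z (away g' ≫ away g ≫ v) := hF₁.map _ _ _ _ _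
  have hk₂ : M.HC q F₂ (away g' ≫ k) := hk₁.map _ _ _ _ _
  obtain ⟨C, _, ψ, hψ, ⟨t, rfl⟩, hf⟩ := hF₂.exists_mem_nonZeroDivisors hH t
  refine ⟨C, _, sp ψ ≫ away g' ≫ away g ≫ v, F₂.baseChange ψ, sp ψ ≫ away g' ≫ k, D, hD,
    ψ.comp φ, inferInstance, ⟨t, ?_⟩, hF₂.map _ _ _ _ _, hk₂.map _ _ _ _ _, ?_, hf⟩
  · simp only [Scheme.Hom.comp_apply]
  · rw [← sp_comp_sp, Category.assoc, hφ]

/-- The Hilbert-Chow morphism of the Hilbert scheme: its composite with the classifying morphism of a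
family is the Hilbert-Chow morphism of this family. -/
lemma exists_hilbertChow (r : Q ⟶ Spec (.of ℂ)) : ∃ c : H ⟶ Q,
    ∀ (B : Type) [CommRing B] (F : Family s B) (m : Spec (.of B) ⟶ H) (k : Spec (.of B) ⟶ Q),
      F.Classify Z m → M.HC q F k → m ≫ c = k := by
  obtain ⟨c, hc⟩ := exists_hom_of_local
    (fun B _ v k => ∃ F : Family s B, F.Classify Z v ∧ M.HC q F k)
    (by
      rintro B C _ _ χ v k - - ⟨F, hF, hk⟩
      exact ⟨F.baseChange χ, hF.map _ _ _ _ _, hk.map _ _ _ _ _⟩)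
    (by
      rintro B _ v k k' - ⟨F, hF, hk⟩ ⟨F', hF', hk'⟩
      exact hk.unique_of_classify hk' hF hF')
    (fun x => by
      obtain ⟨B, _, v, F, k, -, -, -, hv, hx, hF, hk, -⟩ := exists_hilbertChow_chart hq hH r x
      exact ⟨B, _, v, k, hv, hx, F, hF, hk⟩)
  refine ⟨c, fun B _ F m k hF hk => hom_ext_of_charts fun t => ?_⟩
  obtain ⟨C, _, v, F₀, k₀, -, -, -, hv, hx, hF₀, hk₀, -⟩ := exists_hilbertChow_chart hq hH r (m t)
  obtain ⟨g, hg, χ, hχ⟩ := exists_away_sp_comp m t hx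
  refine ⟨_, _, away g, inferInstance, mem_range_away.2 hg, ?_⟩
  rw [← Category.assoc, ← hχ, Category.assoc, hc _ v k₀ hv ⟨F₀, hF₀, hk₀⟩]
  refine HC.unique_of_classify (hk₀.map χ _ _ (by ring) isUnit_one)
    (hk.map (algebraMap B (Localization.Away g)) _ _ (by ring) isUnit_one)
    (hF₀.map χ _ _ (by ring) isUnit_one) ?_
  rw [hχ]; exact hF.map _ _ _ _ _

variable {c : H ⟶ Q} (hc : ∀ (B : Type) [CommRing B] (F : Family s B) (m : Spec (.of B) ⟶ H)
  (k : Spec (.of B) ⟶ Q), F.Classify Z m → M.HC q F k → m ≫ c = k)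

include hc

/-- Locally, a morphism to the Hilbert scheme classifies a double cover, with the Hilbert-Chow
morphism given by a ring homomorphism. -/
lemma exists_away_classify (r : Q ⟶ Spec (.of ℂ)) (m : Spec (.of B) ⟶ H) (t : Spec (.of B)) :
    ∃ g ∉ t.asIdeal, ∃ (F : Family s (Localization.Away g)) (D : Q.Opens) (hD : IsAffineOpen D)
      (φ : Γ(Q, D) →+* Localization.Away g), F.Classify Z (away g ≫ m) ∧
      M.HC q F (away g ≫ m ≫ c) ∧ sp φ ≫ hD.fromSpec = away g ≫ m ≫ c := by
  obtain ⟨C, _, v, F₀, k₀, D, hD, φ, hv, hx, hF₀, hk₀, hφ, -⟩ :=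
    exists_hilbertChow_chart hq hH r (m t)
  obtain ⟨g, hg, χ, hχ⟩ := exists_away_sp_comp m t hx
  have h1 : away g ≫ m ≫ c = sp χ ≫ k₀ := by
    rw [← Category.assoc, ← hχ, Category.assoc, hc _ F₀ v k₀ hF₀ hk₀]
  refine ⟨g, hg, F₀.baseChange χ, D, hD, χ.comp φ, ?_, ?_, ?_⟩
  · rw [← hχ]; exact hF₀.map _ _ _ _ _
  · rw [h1]; exact hk₀.map _ _ _ _ _
  · rw [h1, ← hφ, ← sp_comp_sp, Category.assoc]

include hr

lemma hilbertChow_comp : c ≫ r = h := by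
  refine hom_ext_of_charts fun x => ?_
  obtain ⟨B, _, v, F, k, -, -, -, hv, hx, hF, hk, -⟩ := exists_hilbertChow_chart hq hH r x
  refine ⟨B, _, v, hv, hx, ?_⟩
  rw [← Category.assoc, hc _ F v k hF hk, hk.comp_eq hr]
  exact hF.choose.symm

/-- Morphisms to the Hilbert scheme that agree on the quotient, and under which the inverse image of
the ideal of the singular locus is invertible, agree. -/
lemma eq_of_comp_hilbertChow_eq [IsReduced S] {m m' : Spec (.of B) ⟶ H} (hm : m ≫ c = m' ≫ c)
    (hI : ∀ t : Spec (.of B), ∃ g ∉ t.asIdeal, ∃ f ∈ (Localization.Away g)⁰,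
      (singularIdeal r).comap (away g ≫ m ≫ c) = specIdeal (Ideal.span {f})) : m = m' := by
  refine hom_ext_of_charts fun t => ?_
  obtain ⟨g₁, hg₁, f, hf, hI⟩ := hI t
  obtain ⟨t, rfl⟩ := mem_range_away.2 hg₁
  obtain ⟨g₂, hg₂, F, -, -, -, hF, hk, -⟩ := exists_away_classify hq hH hc r (away g₁ ≫ m) t
  obtain ⟨t, rfl⟩ := mem_range_away.2 hg₂
  obtain ⟨g₃, hg₃, F', D, hD, φ, hF', hk', hφ⟩ :=
    exists_away_classify hq hH hc r (away g₂ ≫ away g₁ ≫ m') t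
  obtain ⟨t, rfl⟩ := mem_range_away.2 hg₃
  simp only [Category.assoc] at hF hk hF' hk' hφ
  rw [← hm] at hk' hφ
  let π := algebraMap (Localization.Away g₂) (Localization.Away g₃)
  have hF₃ : (F.baseChange π).Classify Z (away g₃ ≫ away g₂ ≫ away g₁ ≫ m) := hF.map _ _ _ _ _
  have hk₃ : M.HC q (F.baseChange π) (away g₃ ≫ away g₂ ≫ away g₁ ≫ m ≫ c) := hk.map _ _ _ _ _
  -- `F'.f` and the image of `f` generate the same ideal, the inverse image of the singular locus
  have hf' : F'.f ∈ (Localization.Away g₃)⁰ := by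
    have h1 := hk'.comap_singularIdeal hq hD hr hφ
    rw [← Category.assoc (away g₃), Scheme.IdealSheafData.comap_comp, hI, sp_comp_sp,
      comap_specIdeal, Ideal.map_span, Set.image_singleton] at h1
    have h2 := specIdeal_injective h1
    have h3 := map_mem_nonZeroDivisors_of_isOpenImmersion (χ := π)
      (map_mem_nonZeroDivisors_of_isOpenImmersion
        (χ := algebraMap (Localization.Away g₁) (Localization.Away g₂)) hf)
    obtain ⟨z, hz⟩ := Ideal.mem_span_singleton'.1 (h2.le (Ideal.mem_span_singleton_self _))
    rw [RingHom.comp_apply] at hz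
    rw [← hz] at h3
    exact (mul_mem_nonZeroDivisors.1 h3).2
  obtain ⟨g₄, hg₄, himp⟩ := hk₃.exists_classify_imp hq r hD hr hk' hf' hφ t
  refine ⟨_, _, away g₄ ≫ away g₃ ≫ away g₂ ≫ away g₁, inferInstance, ?_, ?_⟩
  · obtain ⟨t, rfl⟩ := mem_range_away.2 hg₄
    exact ⟨t, by simp only [Scheme.Hom.comp_apply]⟩
  · simp only [Category.assoc]
    exact Family.Classify.unique hH (himp _ (hF₃.map _ _ _ _ _)) (hF'.map _ _ _ _ _)

/-- The Hilbert-Chow morphism is the blow-up of the singular locus. -/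
lemma isBlowUp_hilbertChow [IsReduced S] : IsBlowUp c (singularIdeal r) where
  invertible := isInvertibleIdeal_of_charts fun x => by
    obtain ⟨B, _, v, F, k, D, hD, φ, hv, hx, hF, hk, hφ, hf⟩ := exists_hilbertChow_chart hq hH r x
    refine ⟨B, _, v, F.f, hv, hx, hf, ?_⟩
    rw [← Scheme.IdealSheafData.comap_comp, hc _ F v k hF hk, hk.comap_singularIdeal hq hD hr hφ]
  universal {T} f hf := by
    have uniq {B : Type} [CommRing B] {w : Spec (.of B) ⟶ T} [IsOpenImmersion w]
        {m m' : Spec (.of B) ⟶ H} (h₁ : m ≫ c = w ≫ f) (h₂ : m' ≫ c = w ≫ f) : m = m' := by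
      refine eq_of_comp_hilbertChow_eq hq hr hH hc (h₁.trans h₂.symm) fun t => ?_
      obtain ⟨g, hg, f₀, hf₀, hI⟩ := hf.exists_away w t
      refine ⟨g, hg, f₀, hf₀, ?_⟩
      rw [h₁, ← hI, ← Category.assoc, Scheme.IdealSheafData.comap_comp]
    have ex (x : T) : ∃ (B : Type) (_ : CommRing B) (w : Spec (.of B) ⟶ T) (m : Spec (.of B) ⟶ H),
        IsOpenImmersion w ∧ x ∈ Set.range w ∧ m ≫ c = w ≫ f := by
      obtain ⟨B, _, v, f₀, hv, ⟨t, rfl⟩, hf₀, hI⟩ := hf.exists_chart x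
      rw [← Scheme.IdealSheafData.comap_comp] at hI
      obtain ⟨C, _, χ, F, hχ, ⟨t, rfl⟩, hk⟩ := exists_hc_of_comap hq hr (v ≫ f) hf₀ hI t
      obtain ⟨m, hm⟩ := F.exists_classify_of_isHilbertScheme hH
      exact ⟨C, _, sp χ ≫ v, m, inferInstance, ⟨t, by rw [Scheme.Hom.comp_apply]⟩, by
        rw [hc _ F m _ hm hk, Category.assoc]⟩
    obtain ⟨g, hg⟩ := exists_hom_of_local (T := T) (Y := H) (fun B _ w m => m ≫ c = w ≫ f)
      (fun B C _ _ χ w m _ _ h => by rw [Category.assoc, h, Category.assoc])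
      (fun B _ w m m' _ h₁ h₂ => uniq h₁ h₂) ex
    refine ⟨g, hom_ext_of_charts fun x => ?_, fun g' hg' => hom_ext_of_charts fun x => ?_⟩
    · obtain ⟨B, _, w, m, hw, hx, h⟩ := ex x
      exact ⟨B, _, w, hw, hx, by rw [← Category.assoc, hg B w m hw h, h]⟩
    · obtain ⟨B, _, w, m, hw, hx, h⟩ := ex x
      refine ⟨B, _, w, hw, hx, ?_⟩
      rw [hg B w m hw h]
      exact uniq (by rw [Category.assoc, hg']) h

end SwapSquare

/-- Blow-ups are unique. -/
lemma IsBlowUp.exists_iso {X B B' : Scheme.{0}} {b : B ⟶ X} {b' : B' ⟶ X} {I : X.IdealSheafData}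
    (h : IsBlowUp b I) (h' : IsBlowUp b' I) : ∃ e : B ≅ B', e.hom ≫ b' = b := by
  obtain ⟨f, hf, -⟩ := h'.universal b h.invertible
  obtain ⟨g, hg, -⟩ := h.universal b' h'.invertible
  exact ⟨⟨f, g, (h.universal b h.invertible).unique (by rw [Category.assoc, hg, hf])
    (Category.id_comp b), (h'.universal b' h'.invertible).unique (by rw [Category.assoc, hf, hg])
    (Category.id_comp b')⟩, hf⟩

/-- The square `S × S` with the interchange `(p, q) ↦ (ι q, ι p)`, for an involution `ι`. -/
def SwapSquare.ofInvolution {S : Scheme.{0}} (s : S ⟶ Spec (.of ℂ)) (ι : S ⟶ S) (hs : ι ≫ s = s)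
    (hι : ι ≫ ι = 𝟙 S) : SwapSquare s where
  X := pullback s s
  a := pullback.fst s s
  b := pullback.snd s s ≫ ι
  isPullback := by
    have : IsIso ι := ⟨ι, hι, hι⟩
    refine (IsPullback.of_hasPullback s s).of_iso (Iso.refl _) (Iso.refl _) (asIso ι) (Iso.refl _)
      ?_ ?_ ?_ ?_ <;> simp [hs]
  σ := square s ι hs ≫ switch s
  σ_a := by
    have h1 : switch s ≫ pullback.fst s s = pullback.snd s s := pullback.lift_fst ..
    have h2 : square s ι hs ≫ pullback.snd s s = pullback.snd s s ≫ ι := pullback.lift_snd ..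
    rw [Category.assoc, h1, h2]
  σ_b := by
    have h1 : switch s ≫ pullback.snd s s = pullback.fst s s := pullback.lift_snd ..
    have h2 : square s ι hs ≫ pullback.fst s s = pullback.fst s s ≫ ι := pullback.lift_fst ..
    rw [Category.assoc, ← Category.assoc (switch s), h1, ← Category.assoc, h2, Category.assoc, hι,
      Category.comp_id]

end HilbSquare

end

theorem mainTheorem5 {S : Scheme.{0}} (s : S ⟶ Spec (.of ℂ)) (hS : HilbSquare.IsK3Surface s)
    (ι : S ⟶ S) (hι : HilbSquare.IsNonSymplecticInvolution s ι)
    {Q : Scheme.{0}} (q : pullback s s ⟶ Q) (r : Q ⟶ Spec (.of ℂ))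
    (hr : q ≫ r = pullback.fst s s ≫ s)
    (hq : HilbSquare.IsInvolutionQuotient
      (HilbSquare.square s ι hι.comp_eq ≫ HilbSquare.switch s) q)
    {B : Scheme.{0}} (b : B ⟶ Q) (hb : HilbSquare.IsBlowUp b (HilbSquare.singularIdeal r))
    {H : Scheme.{0}} (h : H ⟶ Spec (.of ℂ)) (Z : (pullback s h).IdealSheafData)
    (hH : HilbSquare.IsHilbertScheme 2 s h Z) :
    ∃ e : B ≅ H, e.hom ≫ h = b ≫ r := by
  have := hS.isIntegral
  have := hS.isProper
  have := hS.smooth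
  let M := HilbSquare.SwapSquare.ofInvolution s ι hι.comp_eq hι.involutive
  have hq' : HilbSquare.IsInvolutionQuotient M.σ q := hq
  have hr' : q ≫ r = M.a ≫ s := hr
  obtain ⟨c, hc⟩ := HilbSquare.SwapSquare.exists_hilbertChow hq' hH r
  obtain ⟨e, he⟩ := hb.exists_iso (HilbSquare.SwapSquare.isBlowUp_hilbertChow hq' hr' hH hc)
  exact ⟨e, by rw [← he, Category.assoc, HilbSquare.SwapSquare.hilbertChow_comp hq' hr' hH hc]⟩
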